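/- Let $n\ge 1$ and let $F:\mathbb{R}^{n+1}\to[0,\infty)$ be a Minkowski norm: $F$ is convex, $F(tx)=tF(x)$ for $t\ge 0$, $F(x)>0$ for $x\ne 0$, $F\in C^\infty(\mathbb{R}^{n+1}\setminus\{0\})$, and $D^2(\tfrac12F^2)$ is positive definite on $\mathbb{R}^{n+1}\setminus\{0\}$. Write $G(x)=D^2(\tfrac12F^2)(x)$, $Q(x)=D^3(\tfrac12F^2)(x)$ for $x\neq0$, $F^0(\xi)=\sup_{x\ne0}\langle x,\xi\rangle/F(x)$ for the dual norm, and $\mathcal W=\{F=1\}$ for the Wulff shape, with the Riemannian metric $g(z)=G(z)|_{T_z\mathcal W}$. For a function $S\in C^2(\mathcal W)$, a point $z\in\mathcal W$ and a $g$-orthonormal basis $e_1,\dots,e_n$ of $T_z\mathcal W$, let $$A_S(z)=\Big(S_{ij}-\tfrac12\sum_k Q_{ijk}S_k+S\delta_{ij}\Big)_{1\le i,j\le n},$$ where $S_i,S_{ij}$ are the first and second covariant derivatives of $S$ with respect to the Levi-Civita connection of $g$, and $Q_{ijk}=Q(z)(e_i,e_j,e_k)$. A $C^2$ (closed) strongly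 convex hypersurface is the boundary $M$ of a compact convex set with nonempty interior in $\mathbb{R}^{n+1}$ which is an embedded $C^2$ hypersurface with everywhere positive definite second fundamental form. With $\bar\nu$ its unit outer normal, its anisotropic Gauss map is $\nu=DF^0(\bar\nu):M\to\mathcal W$ and its anisotropic support function is $S(z)=\sup_{y\in M}G(z)(z,y)$, $z\in\mathcal W$. In a local $C^2$ parametrization $X$ of $M$ put $g_{ij}=G(\nu)(\partial_iX,\partial_jX)$ and $h_{ij}=-G(\nu)(\nu,\partial_i\partial_jX)$. The anisotropic principal curvatures are the eigenvalues of $(g_{ij})^{-1}(h_{ij})$, the anisotropic principal radii are their inverses, and $K=\det\big((g_{ij})^{-1}(h_{ij})\big)$ is the anisotropic Gauss–Kronecker curvature. 1. Let $M$ be a $C^2$ strongly convex hypersurface with anisotropic support function $S$. Then $\nu:M\to\mathcal W$ is a bijection, its inverse $X=\nu^{-1}:\mathcal W\to M$ is a regular $C^1$ parametrization of $M$ (that is, $X\circ Z$ is a regular local $C^1$ parametrization of $M$ for each smooth local parametrization $Z$ of $\mathcal W$), $S\in C^2(\mathcal W)$, and $S(z)=G(z)(z,X(z))$ for all $z\in\mathcal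 W$. For every $z\in\mathcal W$ and every $g$-orthonormal basis of $T_z\mathcal W$, the matrix $A_S(z)$ is symmetric and positive definite, its eigenvalues, counted with multiplicity, are the anisotropic principal radii of $M$ at $X(z)$, and $$\det A_S(z)=\frac1{K(X(z))}.$$ 2. Conversely, let $S\in C^2(\mathcal W)$ be such that $A_S(z)$ is positive definite for every $z\in\mathcal W$ (and every $g$-orthonormal basis of $T_z\mathcal W$). Then $S$ is the anisotropic support function of some $C^2$ strongly convex hypersurface $M\subset\mathbb{R}^{n+1}$. -/

import Mathlib

open scoped ContDiff

noncomputable section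

namespace AnisoMinkowski

/-- The Euclidean space `ℝᵐ`. -/
abbrev Euc (m : ℕ) : Type := EuclideanSpace ℝ (Fin m)

/-! ### Minkowski norms, the metric `G` and the cubic form `Q` -/

/-- The function `F² / 2`. -/
def halfSq {m : ℕ} (F : Euc m → ℝ) (x : Euc m) : ℝ := F x ^ 2 / 2

/-- `G(x)(ξ, η)`, the second derivative of `F² / 2` at `x` in the directions `ξ`, `η`. -/
def G {m : ℕ} (F : Euc m → ℝ) (x ξ η : Euc m) : ℝ :=
  fderiv ℝ (fderiv ℝ (halfSq F)) x ξ η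

/-- `Q(x)(ξ, η, ζ)`, the third derivative of `F² / 2` at `x` in the directions `ξ`, `η`, `ζ`. -/
def Q {m : ℕ} (F : Euc m → ℝ) (x ξ η ζ : Euc m) : ℝ :=
  fderiv ℝ (fderiv ℝ (fderiv ℝ (halfSq F))) x ξ η ζ

/-- Minkowski norms: convex, positively 1-homogeneous, positive and smooth away from the origin,
with `F² / 2` having a positive definite Hessian away from the origin. (Symmetry `F (-x) = F x` is
not required.) -/
structure IsMinkowskiNorm {m : ℕ} (F : Euc m → ℝ) : Prop where
  convexOn : ConvexOn ℝ Set.univ F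
  map_smul : ∀ t : ℝ, 0 ≤ t → ∀ x : Euc m, F (t • x) = t * F x
  pos : ∀ x : Euc m, x ≠ 0 → 0 < F x
  smooth : ContDiffOn ℝ ∞ F {x : Euc m | x ≠ 0}
  elliptic : ∀ x : Euc m, x ≠ 0 → ∀ ξ : Euc m, ξ ≠ 0 → 0 < G F x ξ ξ

/-- The dual norm `F⁰(ξ) = sup_{x ≠ 0} ⟨x, ξ⟩ / F(x)`. -/
def dualNorm {m : ℕ} (F : Euc m → ℝ) (ξ : Euc m) : ℝ :=
  sSup ((fun x : Euc m => inner ℝ x ξ / F x) '' {x : Euc m | x ≠ 0})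

/-- The Wulff shape `{F = 1}`. -/
def wulff {m : ℕ} (F : Euc m → ℝ) : Set (Euc m) := {x | F x = 1}

/-! ### Hypersurfaces -/

/-- The `i`-th partial derivative of a map on (an open subset of) `ℝⁿ`. -/
def pd {n : ℕ} {V : Type*} [NormedAddCommGroup V] [NormedSpace ℝ V]
    (i : Fin n) (f : Euc n → V) (u : Euc n) : V :=
  fderiv ℝ f u (EuclideanSpace.single i 1)

/-- `X : U → M` is a regular local parametrization of class `C^k` of the hypersurface `M` of
`ℝⁿ⁺¹`: an immersion of the open set `U ⊆ ℝⁿ` which is a homeomorphism onto a relatively open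
subset of `M`. -/
structure IsLocalParam {n : ℕ} (k : WithTop ℕ∞) (M : Set (Euc (n + 1)))
    (U : Set (Euc n)) (X : Euc n → Euc (n + 1)) : Prop where
  isOpen : IsOpen U
  contDiffOn : ContDiffOn ℝ k X U
  injective_fderiv : ∀ u ∈ U, Function.Injective (fderiv ℝ X u)
  isEmbedding : Topology.IsEmbedding (U.domRestrict X)
  image_eq : ∃ O : Set (Euc (n + 1)), IsOpen O ∧ X '' U = M ∩ O

/-- `M` is an embedded hypersurface of class `C^k` in `ℝⁿ⁺¹` (without boundary). -/
def IsHypersurface {n : ℕ} (k : WithTop ℕ∞) (M : Set (Euc (n + 1))) : Prop :=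
  ∀ p ∈ M, ∃ (U : Set (Euc n)) (X : Euc n → Euc (n + 1)), IsLocalParam k M U X ∧ p ∈ X '' U

/-- `v` is a unit outer normal at `p` of the boundary `M` of a convex body: a unit vector such that
the body lies in the half-space `⟨v, y - p⟩ ≤ 0`. (At a point where `M` is a differentiable
hypersurface, it is the unique outward unit vector orthogonal to the tangent space.) -/
def IsUnitOuterNormal {m : ℕ} (M : Set (Euc m)) (p v : Euc m) : Prop :=
  ‖v‖ = 1 ∧ ∀ y ∈ M, inner ℝ v (y - p) ≤ 0

/-- The unit outer normal at `p`. -/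
def unitOuterNormal {m : ℕ} (M : Set (Euc m)) (p : Euc m) : Euc m :=
  Classical.epsilon (IsUnitOuterNormal M p)

/-- The Euclidean second fundamental form of `M` in the parametrization `X`, with the sign for which
it is positive on round spheres. -/
def euclideanSecondForm {n : ℕ} (M : Set (Euc (n + 1))) (X : Euc n → Euc (n + 1)) (u : Euc n) :
    Matrix (Fin n) (Fin n) ℝ :=
  Matrix.of fun i j => -inner ℝ (unitOuterNormal M (X u)) (pd i (pd j X) u)

/-- Closed strongly convex hypersurfaces of class `C²`: boundaries of convex bodies (compact convex
sets with interior points) that are `C²` hypersurfaces with positive definite second fundamental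
form. -/
structure IsStronglyConvexHypersurface {n : ℕ} (M : Set (Euc (n + 1))) : Prop where
  exists_body : ∃ C : Set (Euc (n + 1)),
    Convex ℝ C ∧ IsCompact C ∧ (interior C).Nonempty ∧ frontier C = M
  isHypersurface : IsHypersurface 2 M
  posDef : ∀ (U : Set (Euc n)) (X : Euc n → Euc (n + 1)), IsLocalParam 2 M U X →
    ∀ u ∈ U, (euclideanSecondForm M X u).PosDef

/-! ### Anisotropic geometry of a strongly convex hypersurface -/

/-- The anisotropic Gauss map `ν = DF⁰(unit outer normal)`. -/
def gaussMap {m : ℕ} (F : Euc m → ℝ) (M : Set (Euc m)) (p : Euc m) : Euc m :=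
  gradient (dualNorm F) (unitOuterNormal M p)

/-- The inverse of the anisotropic Gauss map `M → wulff F`. -/
def inverseGaussMap {m : ℕ} (F : Euc m → ℝ) (M : Set (Euc m)) : Euc m → Euc m :=
  Function.invFunOn (gaussMap F M) M

/-- The anisotropic support function `S(z) = sup_{y ∈ M} G(z)(z, y)`. -/
def supportFunction {m : ℕ} (F : Euc m → ℝ) (M : Set (Euc m)) (z : Euc m) : ℝ :=
  sSup ((fun y => G F z z y) '' M)

/-- The metric `g_ij = G(ν)(∂_i X, ∂_j X)` on `M` in the parametrization `X`. -/
def metric {n : ℕ} (F : Euc (n + 1) → ℝ) (M : Set (Euc (n + 1)))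
    (X : Euc n → Euc (n + 1)) (u : Euc n) : Matrix (Fin n) (Fin n) ℝ :=
  Matrix.of fun i j => G F (gaussMap F M (X u)) (pd i X u) (pd j X u)

/-- The anisotropic second fundamental form `h_ij = -G(ν)(ν, ∂_i ∂_j X)`. -/
def secondForm {n : ℕ} (F : Euc (n + 1) → ℝ) (M : Set (Euc (n + 1)))
    (X : Euc n → Euc (n + 1)) (u : Euc n) : Matrix (Fin n) (Fin n) ℝ :=
  Matrix.of fun i j => -G F (gaussMap F M (X u)) (gaussMap F M (X u)) (pd i (pd j X) u)

/-- The anisotropic principal curvatures at `X u`: the eigenvalues of `g⁻¹ h`, with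
multiplicities. -/
def principalCurvatures {n : ℕ} (F : Euc (n + 1) → ℝ) (M : Set (Euc (n + 1)))
    (X : Euc n → Euc (n + 1)) (u : Euc n) : Multiset ℝ :=
  ((metric F M X u)⁻¹ * secondForm F M X u).charpoly.roots

/-- The anisotropic principal radii at `X u`: the inverses of the principal curvatures. -/
def principalRadii {n : ℕ} (F : Euc (n + 1) → ℝ) (M : Set (Euc (n + 1)))
    (X : Euc n → Euc (n + 1)) (u : Euc n) : Multiset ℝ :=
  (principalCurvatures F M X u).map fun κ => κ⁻¹

/-- The anisotropic Gauss-Kronecker curvature `K = det (g⁻¹ h)` at `X u`. -/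
def gaussKronecker {n : ℕ} (F : Euc (n + 1) → ℝ) (M : Set (Euc (n + 1)))
    (X : Euc n → Euc (n + 1)) (u : Euc n) : ℝ :=
  ((metric F M X u)⁻¹ * secondForm F M X u).det

/-! ### Calculus on the Wulff shape

`Z` is a smooth local parametrization of the Wulff shape; the metric is the restriction of `G(z)`
to the tangent space at `z`. Functions on the Wulff shape are functions on `ℝⁿ⁺¹` of which only the
values on the Wulff shape are used. -/

/-- `g_ij = G(z)(∂_i Z, ∂_j Z)`. -/
def wulffMetric {n : ℕ} (F : Euc (n + 1) → ℝ) (Z : Euc n → Euc (n + 1)) (u : Euc n) :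
    Matrix (Fin n) (Fin n) ℝ :=
  Matrix.of fun i j => G F (Z u) (pd i Z u) (pd j Z u)

/-- The Christoffel symbols `Γ_ij^k` of the Levi-Civita connection of the metric `g`. -/
def christoffel {n : ℕ} (F : Euc (n + 1) → ℝ) (Z : Euc n → Euc (n + 1)) (u : Euc n)
    (i j k : Fin n) : ℝ :=
  (1 / 2) * ∑ l, (wulffMetric F Z u)⁻¹ k l *
    (pd i (fun w => wulffMetric F Z w j l) u + pd j (fun w => wulffMetric F Z w i l) u
      - pd l (fun w => wulffMetric F Z w i j) u)

/-- The second covariant derivative of `S` on the tangent vectors with coordinates `a` and `b`: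
`a^i b^j (∂_i ∂_j S - Γ_ij^k ∂_k S)`. -/
def covHessian {n : ℕ} (F : Euc (n + 1) → ℝ) (S : Euc (n + 1) → ℝ) (Z : Euc n → Euc (n + 1))
    (u a b : Euc n) : ℝ :=
  ∑ i, ∑ j, a i * b j *
    (pd i (pd j (fun w => S (Z w))) u - ∑ k, christoffel F Z u i j k * pd k (fun w => S (Z w)) u)

/-- The tangent vectors `e_i = DZ(u)(a_i)` form a `g`-orthonormal basis of the tangent space of the
Wulff shape at `Z u`; here `a_i ∈ ℝⁿ` is the coordinate vector of `e_i`. -/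
def IsOrthonormalFrame {n : ℕ} (F : Euc (n + 1) → ℝ) (Z : Euc n → Euc (n + 1)) (u : Euc n)
    (a : Fin n → Euc n) : Prop :=
  ∀ i j, G F (Z u) (fderiv ℝ Z u (a i)) (fderiv ℝ Z u (a j)) = if i = j then 1 else 0

/-- The matrix `S_ij - (1/2) Q_ijk S_k + S δ_ij` in the orthonormal basis `e_i = DZ(u)(a_i)`. -/
def supportMatrix {n : ℕ} (F : Euc (n + 1) → ℝ) (S : Euc (n + 1) → ℝ) (Z : Euc n → Euc (n + 1))
    (u : Euc n) (a : Fin n → Euc n) : Matrix (Fin n) (Fin n) ℝ :=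
  Matrix.of fun i j =>
    covHessian F S Z u (a i) (a j)
      - (1 / 2) * ∑ k, Q F (Z u) (fderiv ℝ Z u (a i)) (fderiv ℝ Z u (a j)) (fderiv ℝ Z u (a k))
          * fderiv ℝ (fun w => S (Z w)) u (a k)
      + S (Z u) * (if i = j then 1 else 0)

/-- `S ∈ C²(wulff F)`. -/
def IsC2OnWulff {n : ℕ} (F : Euc (n + 1) → ℝ) (S : Euc (n + 1) → ℝ) : Prop :=
  ∀ (V : Set (Euc n)) (Z : Euc n → Euc (n + 1)), IsLocalParam ∞ (wulff F) V Z →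
    ContDiffOn ℝ 2 (fun u => S (Z u)) V

end AnisoMinkowski

end

open AnisoMinkowski

/-! Write `ℓ = D(F²/2)` for the Legendre map, which is `gradient (halfSq F)`. Seen from an interior
point `c` of its body, a strongly convex `M` is the unit sphere of a gauge `ρ`, and `ρ` is an
elliptic norm; conversely, translated unit spheres of elliptic norms are strongly convex. Since `M`
is only C², so is `ρ`, which is why the norms considered have finite smoothness.

Legendre duality carries the argument. Off the origin `ℓ` is a bijection whose inverse is the
Legendre map of `F⁰`; hence the dual of an elliptic norm is elliptic of the same class, and `F⁰⁰ =
F`. The same holds for `ρ`. Let `h(ξ) = ρ⁰(ξ) + ⟨c, ξ⟩` be the Euclidean support function of `M`. On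
the Wulff shape, `S = h ∘ ℓ`, and the inverse anisotropic Gauss map is `X = Dh ∘ ℓ`.

The key identity is `supportMatrix_apply`: the entries of `A_S` are `D²h(ℓ(z))(Dℓ e_i, Dℓ e_j)`.
Differentiating `h ∘ ℓ` twice produces a term `Q(e_i, e_j, X)`. The Christoffel symbols absorb half
of it, because the metric `G(z)` itself varies at the rate `Q`; the component of `∂_i ∂_j Z` along
`z` produces `-S g_ij`. The two correction terms in `A_S` cancel what is left. Positivity of `A_S`
is therefore positivity of `D²h` transversally to rays. Moreover the Hessians of `ρ` and `ρ⁰` are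
inverse to each other on tangent spaces (`hessian_mul_hessian_dualNorm`), so that `A_S` is inverse
to the anisotropic shape operator in an orthonormal frame; this gives the radii and the determinant.

For the converse, extend `S` to the homogeneous function `h(ξ) = F⁰(ξ) S(DF⁰(ξ))`. By the key
identity `D²h` is positive transversally to rays, so `h` lies above its tangent hyperplanes, and
subtracting a suitable linear function `⟨c, ·⟩` makes it positive, hence an elliptic norm. The unit
sphere of the dual of that norm, translated by `c`, is the required `M`. -/

noncomputable section

namespace AnisoMinkowski

open Set Filter Topology

/-! ### Positively homogeneous functions -/

/-- Positively 1-homogeneous functions. -/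
def PosHomogeneous {m : ℕ} (g : Euc m → ℝ) : Prop :=
  ∀ t : ℝ, 0 < t → ∀ x : Euc m, g (t • x) = t * g x

theorem isOpen_ne_zero {m : ℕ} : IsOpen {x : Euc m | x ≠ 0} := isOpen_ne

section Homogeneous

variable {m : ℕ} {g : Euc m → ℝ}

theorem PosHomogeneous.fderiv_smul (hg : PosHomogeneous g) {t : ℝ} (ht : 0 < t) (x : Euc m) :
    fderiv ℝ g (t • x) = fderiv ℝ g x := by
  have h1 : fderiv ℝ (fun y => g (t • y)) x = t • fderiv ℝ g (t • x) := fderiv_comp_smul t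
  have h2 : (fun y => g (t • y)) = t • g := by
    funext y; simp [hg t ht y]
  rw [h2, fderiv_const_smul_field] at h1
  exact (smul_right_injective _ ht.ne' h1).symm

theorem PosHomogeneous.gradient_smul (hg : PosHomogeneous g) {t : ℝ} (ht : 0 < t) (x : Euc m) :
    gradient g (t • x) = gradient g x := by
  simp only [gradient, hg.fderiv_smul ht]

theorem PosHomogeneous.fderiv_fderiv_smul (hg : PosHomogeneous g) {t : ℝ} (ht : 0 < t)
    (x : Euc m) : fderiv ℝ (fderiv ℝ g) (t • x) = t⁻¹ • fderiv ℝ (fderiv ℝ g) x := by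
  have h1 : fderiv ℝ (fun y => fderiv ℝ g (t • y)) x = t • fderiv ℝ (fderiv ℝ g) (t • x) :=
    fderiv_comp_smul t
  have h2 : (fun y => fderiv ℝ g (t • y)) = fderiv ℝ g := by
    funext y; exact hg.fderiv_smul ht y
  rw [h2] at h1
  rw [h1, smul_smul, inv_mul_cancel₀ ht.ne', one_smul]

/-- The derivative at `x` in the direction `x`, computed along the ray. -/
theorem hasDerivAt_ray {V : Type*} [NormedAddCommGroup V] [NormedSpace ℝ V] {f : Euc m → V}
    {x : Euc m} (hd : DifferentiableAt ℝ f x) :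
    HasDerivAt (fun t : ℝ => f (t • x)) (fderiv ℝ f x x) 1 := by
  have h1 : HasDerivAt (fun t : ℝ => t • x) x 1 := by
    simpa using (hasDerivAt_id (1 : ℝ)).smul_const x
  have h2 : HasFDerivAt f (fderiv ℝ f x) ((1 : ℝ) • x) := by simpa using hd.hasFDerivAt
  exact h2.comp_hasDerivAt 1 h1

theorem PosHomogeneous.fderiv_self (hg : PosHomogeneous g) {x : Euc m}
    (hd : DifferentiableAt ℝ g x) : fderiv ℝ g x x = g x := by
  have h1 := hasDerivAt_ray hd
  have h2 : HasDerivAt (fun t : ℝ => t * g x) (g x) 1 := by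
    simpa using (hasDerivAt_id (1 : ℝ)).mul_const (g x)
  refine h1.unique (h2.congr_of_eventuallyEq ?_)
  filter_upwards [lt_mem_nhds (zero_lt_one (α := ℝ))] with t ht using hg t ht x

theorem PosHomogeneous.fderiv_fderiv_self (hg : PosHomogeneous g) {x : Euc m}
    (hd : DifferentiableAt ℝ (fderiv ℝ g) x) : fderiv ℝ (fderiv ℝ g) x x = 0 := by
  have h1 := hasDerivAt_ray hd
  refine h1.unique ((hasDerivAt_const (1 : ℝ) (fderiv ℝ g x)).congr_of_eventuallyEq ?_)
  filter_upwards [lt_mem_nhds (zero_lt_one (α := ℝ))] with t ht using hg.fderiv_smul ht x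

theorem isSymmSndFDerivAt_of_contDiffAt {f : Euc m → ℝ} {x : Euc m} (h : ContDiffAt ℝ 2 f x)
    (v w : Euc m) : fderiv ℝ (fderiv ℝ f) x v w = fderiv ℝ (fderiv ℝ f) x w v :=
  h.isSymmSndFDerivAt (by simp) v w

/-- The Riesz isomorphism from the dual, as a continuous linear map. -/
def riesz (m : ℕ) : StrongDual ℝ (Euc m) →L[ℝ] Euc m :=
  LinearMap.toContinuousLinearMap
    { toFun := (InnerProductSpace.toDual ℝ (Euc m)).symm
      map_add' := map_add _
      map_smul' := fun t φ => by simp }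

theorem inner_riesz (φ : StrongDual ℝ (Euc m)) (y : Euc m) : inner ℝ (riesz m φ) y = φ y :=
  InnerProductSpace.toDual_symm_apply

theorem hasFDerivAt_gradient {f : Euc m → ℝ} {x : Euc m}
    (h : DifferentiableAt ℝ (fderiv ℝ f) x) :
    HasFDerivAt (gradient f) ((riesz m).comp (fderiv ℝ (fderiv ℝ f) x)) x :=
  (riesz m).hasFDerivAt.comp x h.hasFDerivAt

theorem inner_fderiv_gradient {f : Euc m → ℝ} {x : Euc m}
    (h : DifferentiableAt ℝ (fderiv ℝ f) x) (ξ η : Euc m) :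
    inner ℝ (fderiv ℝ (gradient f) x ξ) η = fderiv ℝ (fderiv ℝ f) x ξ η := by
  rw [(hasFDerivAt_gradient h).fderiv]
  exact inner_riesz _ _

theorem contDiffAt_gradient {f : Euc m → ℝ} {x : Euc m} {j k : WithTop ℕ∞}
    (h : ContDiffAt ℝ k f x) (hjk : j + 1 ≤ k) : ContDiffAt ℝ j (gradient f) x :=
  (riesz m).contDiff.contDiffAt.comp x
    (h.fderiv_right hjk)

theorem fderiv_halfSq_of_differentiableAt {x : Euc m} (h : DifferentiableAt ℝ g x) :
    fderiv ℝ (halfSq g) x = g x • fderiv ℝ g x := by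
  have h2 : HasFDerivAt (halfSq g) _ x :=
    ((h.hasFDerivAt.mul h.hasFDerivAt).mul_const (2⁻¹ : ℝ)).congr_of_eventuallyEq
      (Eventually.of_forall fun y => by simp [halfSq]; ring)
  rw [h2.fderiv]
  ext y
  simp
  ring

end Homogeneous

/-! ### Elliptic norms of finite smoothness -/

/-- A (not necessarily symmetric) norm which is of class `C²` off the origin. -/
structure IsC2Norm {m : ℕ} (F : Euc m → ℝ) : Prop where
  map_smul : ∀ t : ℝ, 0 ≤ t → ∀ x : Euc m, F (t • x) = t * F x
  pos : ∀ x : Euc m, x ≠ 0 → 0 < F x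
  contDiffOn_two : ContDiffOn ℝ 2 F {x : Euc m | x ≠ 0}
  fderiv_le : ∀ x : Euc m, x ≠ 0 → ∀ y : Euc m, fderiv ℝ F x y ≤ F y

/-- A (not necessarily symmetric) norm of class `C^(j+1)` off the origin whose half square has a
positive definite Hessian. -/
structure IsEllipticNorm {m : ℕ} (j : ℕ) (F : Euc m → ℝ) : Prop extends IsC2Norm F where
  one_le : 1 ≤ j
  smooth : ContDiffOn ℝ (j + 1 : ℕ) F {x : Euc m | x ≠ 0}
  elliptic : ∀ x : Euc m, x ≠ 0 → ∀ ξ : Euc m, ξ ≠ 0 → 0 < G F x ξ ξ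

/-- A subadditive homogeneous function lies above its tangent hyperplanes. -/
theorem fderiv_le_of_subadditive {m : ℕ} {F : Euc m → ℝ} (hs : PosHomogeneous F)
    (ha : ∀ x y, F (x + y) ≤ F x + F y) {x : Euc m} (hd : DifferentiableAt ℝ F x) (y : Euc m) :
    fderiv ℝ F x y ≤ F y := by
  have h0 : HasDerivAt (fun t : ℝ => x + t • y) y 0 := by
    simpa using ((hasDerivAt_id (0 : ℝ)).smul_const y).const_add x
  have h1 : HasDerivAt (fun t : ℝ => F (x + t • y)) (fderiv ℝ F x y) 0 := by
    have h2 : HasFDerivAt F (fderiv ℝ F x) (x + (0 : ℝ) • y) := by simpa using hd.hasFDerivAt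
    exact h2.comp_hasDerivAt 0 h0
  have h3 := h1.tendsto_slope_zero_right
  refine le_of_tendsto h3 ?_
  filter_upwards [self_mem_nhdsWithin] with t ht
  have ht' : (0 : ℝ) < t := ht
  have h4 := ha x (t • y)
  rw [hs t ht'] at h4
  simp only [zero_add, zero_smul, add_zero, smul_eq_mul]
  rw [inv_mul_le_iff₀ ht']
  linarith

theorem IsMinkowskiNorm.subadditive {m : ℕ} {F : Euc m → ℝ} (hF : IsMinkowskiNorm F)
    (x y : Euc m) : F (x + y) ≤ F x + F y := by
  have h := hF.convexOn.2 (mem_univ x) (mem_univ y) (by norm_num : (0 : ℝ) ≤ 1 / 2)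
    (by norm_num : (0 : ℝ) ≤ 1 / 2) (by norm_num)
  rw [← smul_add, hF.map_smul _ (by norm_num)] at h
  simp only [smul_eq_mul] at h
  linarith

theorem IsMinkowskiNorm.isEllipticNorm {m : ℕ} {F : Euc m → ℝ} (hF : IsMinkowskiNorm F) (j : ℕ)
    (hj : 1 ≤ j) : IsEllipticNorm j F where
  one_le := hj
  map_smul := hF.map_smul
  pos := hF.pos
  contDiffOn_two := hF.smooth.of_le ENat.LEInfty.out
  smooth := hF.smooth.of_le (by exact_mod_cast le_top)
  elliptic := hF.elliptic
  fderiv_le x hx y := by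
    refine fderiv_le_of_subadditive (fun t ht x => hF.map_smul t ht.le x) hF.subadditive ?_ y
    exact (hF.smooth.contDiffAt (isOpen_ne_zero.mem_nhds hx)).differentiableAt (by simp)

/-! ### Euler relations for the metric `G` and the Legendre map -/

namespace IsC2Norm

variable {m : ℕ} {F : Euc m → ℝ}

theorem posHomogeneous (hF : IsC2Norm F) : PosHomogeneous F :=
  fun t ht x => hF.map_smul t ht.le x

theorem map_zero (hF : IsC2Norm F) : F 0 = 0 := by
  simpa using hF.map_smul 0 le_rfl 0

theorem nonneg (hF : IsC2Norm F) (x : Euc m) : 0 ≤ F x := by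
  rcases eq_or_ne x 0 with rfl | hx
  · exact hF.map_zero.ge
  · exact (hF.pos x hx).le

theorem ne_zero_of_mem_wulff (hF : IsC2Norm F) {x : Euc m} (hx : x ∈ wulff F) : x ≠ 0 := by
  rintro rfl
  have : F 0 = 1 := hx
  rw [hF.map_zero] at this
  exact zero_ne_one this

theorem contDiffAt_two (hF : IsC2Norm F) {x : Euc m} (hx : x ≠ 0) :
    ContDiffAt ℝ 2 F x := hF.contDiffOn_two.contDiffAt (isOpen_ne_zero.mem_nhds hx)

theorem differentiableAt (hF : IsC2Norm F) {x : Euc m} (hx : x ≠ 0) :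
    DifferentiableAt ℝ F x := (hF.contDiffAt_two hx).differentiableAt (by simp)

theorem differentiableAt_fderiv (hF : IsC2Norm F) {x : Euc m} (hx : x ≠ 0) :
    DifferentiableAt ℝ (fderiv ℝ F) x :=
  ((hF.contDiffAt_two hx).fderiv_right (m := 1) (by norm_num)).differentiableAt (by simp)

theorem contDiffAt_halfSq_two (hF : IsC2Norm F) {x : Euc m} (hx : x ≠ 0) :
    ContDiffAt ℝ 2 (halfSq F) x := ((hF.contDiffAt_two hx).pow 2).div_const 2

theorem differentiableAt_fderiv_halfSq (hF : IsC2Norm F) {x : Euc m} (hx : x ≠ 0) :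
    DifferentiableAt ℝ (fderiv ℝ (halfSq F)) x :=
  ((hF.contDiffAt_halfSq_two hx).fderiv_right (m := 1) (by norm_num)).differentiableAt (by simp)

theorem fderiv_halfSq (hF : IsC2Norm F) {x : Euc m} (hx : x ≠ 0) :
    fderiv ℝ (halfSq F) x = F x • fderiv ℝ F x :=
  fderiv_halfSq_of_differentiableAt (hF.differentiableAt hx)

theorem gradient_halfSq (hF : IsC2Norm F) {x : Euc m} (hx : x ≠ 0) :
    gradient (halfSq F) x = F x • gradient F x := by
  simp [gradient, hF.fderiv_halfSq hx]

theorem G_eq (hF : IsC2Norm F) {x : Euc m} (hx : x ≠ 0) (ξ η : Euc m) :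
    G F x ξ η = fderiv ℝ F x ξ * fderiv ℝ F x η + F x * fderiv ℝ (fderiv ℝ F) x ξ η := by
  have h1 : fderiv ℝ (halfSq F) =ᶠ[𝓝 x] fun y => F y • fderiv ℝ F y := by
    filter_upwards [isOpen_ne_zero.mem_nhds hx] with y hy using hF.fderiv_halfSq hy
  have h2 := (hF.differentiableAt hx).hasFDerivAt.smul (hF.differentiableAt_fderiv hx).hasFDerivAt
  rw [G, h1.fderiv_eq]
  erw [h2.fderiv]
  simp
  ring

theorem G_symm (hF : IsC2Norm F) {x : Euc m} (hx : x ≠ 0) (ξ η : Euc m) :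
    G F x ξ η = G F x η ξ := isSymmSndFDerivAt_of_contDiffAt (hF.contDiffAt_halfSq_two hx) ξ η

theorem fderiv_self (hF : IsC2Norm F) {x : Euc m} (hx : x ≠ 0) : fderiv ℝ F x x = F x :=
  hF.posHomogeneous.fderiv_self (hF.differentiableAt hx)

/-- Euler's relations: `DF` is 0-homogeneous, so `D²F(x) x = 0`, and `DF(x) x = F(x)`. -/
theorem G_self_left (hF : IsC2Norm F) {x : Euc m} (hx : x ≠ 0) (η : Euc m) :
    G F x x η = F x * fderiv ℝ F x η := by
  rw [hF.G_eq hx, hF.fderiv_self hx,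
    hF.posHomogeneous.fderiv_fderiv_self (hF.differentiableAt_fderiv hx)]
  simp

theorem G_self_left' (hF : IsC2Norm F) {x : Euc m} (hx : x ≠ 0) (η : Euc m) :
    G F x x η = fderiv ℝ (halfSq F) x η := by
  rw [hF.G_self_left hx, hF.fderiv_halfSq hx]; rfl

theorem inner_legendre (hF : IsC2Norm F) {x : Euc m} (hx : x ≠ 0) (η : Euc m) :
    inner ℝ (gradient (halfSq F) x) η = G F x x η := by
  rw [inner_gradient_left, hF.G_self_left' hx]

theorem inner_legendre_self (hF : IsC2Norm F) {x : Euc m} (hx : x ≠ 0) :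
    inner ℝ (gradient (halfSq F) x) x = F x ^ 2 := by
  rw [hF.inner_legendre hx, hF.G_self_left hx, hF.fderiv_self hx, sq]

theorem legendre_ne_zero (hF : IsC2Norm F) {x : Euc m} (hx : x ≠ 0) :
    gradient (halfSq F) x ≠ 0 := by
  intro h
  have h2 := hF.inner_legendre_self hx
  rw [h, inner_zero_left] at h2
  exact (pow_pos (hF.pos x hx) 2).ne h2

theorem legendre_smul (hF : IsC2Norm F) {t : ℝ} (ht : 0 < t) {x : Euc m} (hx : x ≠ 0) :
    gradient (halfSq F) (t • x) = t • gradient (halfSq F) x := by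
  rw [hF.gradient_halfSq hx, hF.gradient_halfSq (smul_ne_zero ht.ne' hx),
    hF.posHomogeneous.gradient_smul ht, hF.map_smul t ht.le, mul_smul]

theorem inner_fderiv_legendre (hF : IsC2Norm F) {x : Euc m} (hx : x ≠ 0) (ξ η : Euc m) :
    inner ℝ (fderiv ℝ (gradient (halfSq F)) x ξ) η = G F x ξ η :=
  inner_fderiv_gradient (hF.differentiableAt_fderiv_halfSq hx) ξ η

theorem differentiableAt_legendre (hF : IsC2Norm F) {x : Euc m} (hx : x ≠ 0) :
    DifferentiableAt ℝ (gradient (halfSq F)) x :=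
  (hasFDerivAt_gradient (hF.differentiableAt_fderiv_halfSq hx)).differentiableAt

theorem fderiv_legendre_self (hF : IsC2Norm F) {x : Euc m} (hx : x ≠ 0) :
    fderiv ℝ (gradient (halfSq F)) x x = gradient (halfSq F) x := by
  refine ext_inner_right ℝ fun y => ?_
  rw [hF.inner_fderiv_legendre hx, hF.inner_legendre hx]

/-- Ellipticity follows from positivity of the Hessian off the radial direction. -/
theorem elliptic_of_fderiv_fderiv_pos (hF : IsC2Norm F) {x : Euc m} (hx : x ≠ 0)
    (h : ∀ v : Euc m, (∀ t : ℝ, v ≠ t • x) → 0 < fderiv ℝ (fderiv ℝ F) x v v)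
    {ξ : Euc m} (hξ : ξ ≠ 0) : 0 < G F x ξ ξ := by
  have hFx := hF.pos x hx
  rw [hF.G_eq hx]
  by_cases hv : ∃ t : ℝ, ξ = t • x
  · obtain ⟨t, rfl⟩ := hv
    have ht : t ≠ 0 := fun h => hξ (by rw [h, zero_smul])
    rw [_root_.map_smul (fderiv ℝ F x), _root_.map_smul (fderiv ℝ (fderiv ℝ F) x),
      hF.posHomogeneous.fderiv_fderiv_self (hF.differentiableAt_fderiv hx), hF.fderiv_self hx]
    have : 0 < (t * F x) * (t * F x) := mul_self_pos.2 (mul_ne_zero ht hFx.ne')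
    simpa using this
  · have h1 := mul_pos hFx (h ξ fun t ht => hv ⟨t, ht⟩)
    have h2 := mul_self_nonneg (fderiv ℝ F x ξ)
    linarith

end IsC2Norm

namespace IsEllipticNorm

variable {m j : ℕ} {F : Euc m → ℝ}

theorem contDiffAt (hF : IsEllipticNorm j F) {x : Euc m} (hx : x ≠ 0) :
    ContDiffAt ℝ (j + 1 : ℕ) F x := hF.smooth.contDiffAt (isOpen_ne_zero.mem_nhds hx)

theorem contDiffAt_halfSq (hF : IsEllipticNorm j F) {x : Euc m} (hx : x ≠ 0) :
    ContDiffAt ℝ (j + 1 : ℕ) (halfSq F) x := ((hF.contDiffAt hx).pow 2).div_const 2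

theorem contDiffAt_legendre (hF : IsEllipticNorm j F) {x : Euc m} (hx : x ≠ 0) :
    ContDiffAt ℝ j (gradient (halfSq F)) x :=
  contDiffAt_gradient (hF.contDiffAt_halfSq hx) (by exact_mod_cast le_rfl)

theorem fderiv_legendre_injective (hF : IsEllipticNorm j F) {x : Euc m} (hx : x ≠ 0) :
    Function.Injective (fderiv ℝ (gradient (halfSq F)) x) := by
  rw [injective_iff_map_eq_zero]
  intro v hv
  by_contra hne
  have := hF.elliptic x hx v hne
  rw [← hF.inner_fderiv_legendre hx, hv, inner_zero_left] at this
  exact lt_irrefl _ this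

/-- The Hessian of an elliptic norm is positive off the radial direction. -/
theorem fderiv_fderiv_pos (hF : IsEllipticNorm j F) {x : Euc m} (hx : x ≠ 0) {v : Euc m}
    (hv : ∀ t : ℝ, v ≠ t • x) : 0 < fderiv ℝ (fderiv ℝ F) x v v := by
  set t := fderiv ℝ F x v / F x with ht
  have hFx := hF.pos x hx
  have hw : v - t • x ≠ 0 := sub_ne_zero.2 (hv t)
  have h1 := hF.elliptic x hx _ hw
  have h2 : fderiv ℝ F x (v - t • x) = 0 := by
    rw [map_sub, _root_.map_smul, hF.fderiv_self hx, smul_eq_mul, ht]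
    field_simp
    ring
  have h3 : fderiv ℝ (fderiv ℝ F) x x = 0 :=
    hF.posHomogeneous.fderiv_fderiv_self (hF.differentiableAt_fderiv hx)
  have h4 : fderiv ℝ (fderiv ℝ F) x v x = 0 := by
    rw [isSymmSndFDerivAt_of_contDiffAt (hF.contDiffAt_two hx), h3]; rfl
  rw [hF.G_eq hx, h2] at h1
  simp only [map_sub, _root_.map_smul, sub_apply,
    smul_apply, h3, h4] at h1
  simp at h1
  exact (pos_iff_pos_of_mul_pos h1).1 hFx

end IsEllipticNorm

/-- An injective linear map between spaces of the same finite dimension, as an equivalence. -/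
theorem exists_continuousLinearEquiv {E E' : Type*} [NormedAddCommGroup E] [NormedSpace ℝ E]
    [NormedAddCommGroup E'] [NormedSpace ℝ E'] [FiniteDimensional ℝ E] [FiniteDimensional ℝ E']
    (hd : Module.finrank ℝ E = Module.finrank ℝ E') (f : E →L[ℝ] E')
    (hf : Function.Injective f) : ∃ f' : E ≃L[ℝ] E', (f' : E →L[ℝ] E') = f := by
  refine ⟨(LinearEquiv.ofInjectiveOfFinrankEq (f : E →ₗ[ℝ] E') hf hd).toContinuousLinearEquiv, ?_⟩
  ext v
  rfl

/-- The inverse function theorem in finite dimension. -/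
theorem exists_contDiffAt_rightInverse {E E' : Type*} [NormedAddCommGroup E] [NormedSpace ℝ E]
    [NormedAddCommGroup E'] [NormedSpace ℝ E'] [FiniteDimensional ℝ E] [FiniteDimensional ℝ E']
    (hd : Module.finrank ℝ E = Module.finrank ℝ E') {f : E → E'} {x : E} {k : WithTop ℕ∞}
    (hk : k ≠ 0) (hf : ContDiffAt ℝ k f x) (hinj : Function.Injective (fderiv ℝ f x))
    {s : Set E} (hs : s ∈ 𝓝 x) :
    ∃ g : E' → E, ContDiffAt ℝ k g (f x) ∧ g (f x) = x ∧
      ∀ᶠ y in 𝓝 (f x), g y ∈ s ∧ f (g y) = y := by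
  have : CompleteSpace E := FiniteDimensional.complete ℝ E
  obtain ⟨f', hf'⟩ := exists_continuousLinearEquiv hd _ hinj
  have hder : HasFDerivAt f (f' : E →L[ℝ] E') x := by
    rw [hf']
    exact (hf.differentiableAt hk).hasFDerivAt
  have h1 := hf.to_localInverse hder hk
  have h0 := hf.localInverse_apply_image hder hk
  refine ⟨hf.localInverse hder hk, h1, h0, ?_⟩
  have h2 : ∀ᶠ y in 𝓝 (f x), f (hf.localInverse hder hk y) = y :=
    (hf.hasStrictFDerivAt' hder hk).eventually_right_inverse
  have h3 : ∀ᶠ y in 𝓝 (f x), hf.localInverse hder hk y ∈ s :=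
    h1.continuousAt.eventually_mem (by rwa [h0])
  exact h3.and h2

/-! ### Comparison with the Euclidean norm and compactness of the Wulff shape -/

namespace IsC2Norm

variable {m : ℕ} {F : Euc m → ℝ}

theorem exists_bounds (hF : IsC2Norm F) :
    ∃ c > 0, ∃ C, ∀ x, c * ‖x‖ ≤ F x ∧ F x ≤ C * ‖x‖ := by
  have hK : IsCompact (Metric.sphere (0 : Euc m) 1) := isCompact_sphere 0 1
  have hne : ∀ x ∈ Metric.sphere (0 : Euc m) 1, x ≠ 0 := by
    rintro x hx rfl
    simp at hx
  have hcont : ContinuousOn F (Metric.sphere (0 : Euc m) 1) := fun x hx =>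
    (hF.differentiableAt (hne x hx)).continuousAt.continuousWithinAt
  have hmem : ∀ x : Euc m, x ≠ 0 → ‖x‖⁻¹ • x ∈ Metric.sphere (0 : Euc m) 1 := fun x hx => by
    simp [norm_smul, hx]
  have hscale : ∀ x : Euc m, x ≠ 0 → F x = ‖x‖ * F (‖x‖⁻¹ • x) := fun x hx => by
    rw [hF.map_smul _ (by positivity), ← mul_assoc, mul_inv_cancel₀ (norm_ne_zero_iff.2 hx),
      one_mul]
  -- The sphere is empty exactly in dimension zero, where any constants do.
  rcases (Metric.sphere (0 : Euc m) 1).eq_empty_or_nonempty with he | hn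
  · refine ⟨1, one_pos, 1, fun x => ?_⟩
    have hx : x = 0 := by
      by_contra hx
      have := hmem x hx
      rw [he] at this
      exact this
    simp [hx, hF.map_zero]
  · obtain ⟨a, ha, ha'⟩ := hK.exists_isMinOn hn hcont
    obtain ⟨b, hb, hb'⟩ := hK.exists_isMaxOn hn hcont
    refine ⟨F a, hF.pos a (hne a ha), F b, fun x => ?_⟩
    rcases eq_or_ne x 0 with rfl | hx
    · simp [hF.map_zero]
    · rw [hscale x hx, mul_comm (F a), mul_comm (F b)]
      exact ⟨mul_le_mul_of_nonneg_left (ha' (hmem x hx)) (norm_nonneg _),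
        mul_le_mul_of_nonneg_left (hb' (hmem x hx)) (norm_nonneg _)⟩

theorem continuous (hF : IsC2Norm F) : Continuous F := by
  rw [continuous_iff_continuousAt]
  intro x
  rcases eq_or_ne x 0 with rfl | hx
  · obtain ⟨c, hc, C, h⟩ := hF.exists_bounds
    have h1 : Tendsto (fun x : Euc m => C * ‖x‖) (𝓝 0) (𝓝 0) := by
      have : Continuous fun x : Euc m => C * ‖x‖ := by fun_prop
      simpa using this.tendsto 0
    rw [ContinuousAt, hF.map_zero]
    exact tendsto_of_tendsto_of_tendsto_of_le_of_le tendsto_const_nhds h1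
      (fun x => hF.nonneg x) (fun x => (h x).2)
  · exact (hF.differentiableAt hx).continuousAt

theorem isCompact_wulff (hF : IsC2Norm F) : IsCompact (wulff F) := by
  obtain ⟨c, hc, C, h⟩ := hF.exists_bounds
  refine Metric.isCompact_of_isClosed_isBounded (isClosed_eq hF.continuous continuous_const)
    ((Metric.isBounded_closedBall (x := (0 : Euc m)) (r := c⁻¹)).subset fun x hx => ?_)
  have h1 := (h x).1
  rw [show F x = 1 from hx] at h1
  rw [mem_closedBall_zero_iff]
  rwa [← one_div, le_div_iff₀ hc, mul_comm]

theorem inv_smul_mem_wulff (hF : IsC2Norm F) {x : Euc m} (hx : x ≠ 0) :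
    (F x)⁻¹ • x ∈ wulff F := by
  show F _ = 1
  rw [hF.map_smul _ (inv_nonneg.2 (hF.nonneg x)), inv_mul_cancel₀ (hF.pos x hx).ne']

end IsC2Norm

/-! ### Bijectivity and smoothness of the Legendre map -/

namespace IsEllipticNorm

variable {m j : ℕ} {F : Euc m → ℝ}

/-- On a segment avoiding the origin the derivative of `F²/2` along it is strictly increasing, so
Rolle's theorem excludes equal values at the ends. If the segment meets the origin, `x` and `y`
point in opposite directions, and equality would contradict `⟨ℓ(x), x⟩ = F(x)² > 0`. -/
theorem legendre_injOn (hF : IsEllipticNorm j F) :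
    InjOn (gradient (halfSq F)) {x : Euc m | x ≠ 0} := by
  intro x hx y hy hxy
  by_contra hne
  have hv : x - y ≠ 0 := sub_ne_zero.2 hne
  by_cases h0 : ∃ t : ℝ, t ∈ Icc (0 : ℝ) 1 ∧ y + t • (x - y) = 0
  · obtain ⟨t, ⟨ht0, ht1⟩, ht⟩ := h0
    have hx' : x = (1 - t) • (x - y) := by
      have : x = y + t • (x - y) + (1 - t) • (x - y) := by module
      rwa [ht, zero_add] at this
    have hy' : -y = t • (x - y) := by
      rw [neg_eq_iff_add_eq_zero, ht]
    have ht0' : 0 < t := ht0.lt_of_ne (by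
      rintro rfl
      rw [zero_smul, neg_eq_zero] at hy'
      exact hy hy')
    have ht1' : 0 < 1 - t := (sub_nonneg.2 ht1).lt_of_ne (by
      intro h
      rw [← h, zero_smul] at hx'
      exact hx hx')
    have h1 := hF.inner_legendre_self hx
    have h2 := hF.inner_legendre_self hy
    have h3 : inner ℝ (gradient (halfSq F) x) x
        = (1 - t) * inner ℝ (gradient (halfSq F) x) (x - y) := by
      rw [← inner_smul_right, ← hx']
    have h4 : -inner ℝ (gradient (halfSq F) y) y
        = t * inner ℝ (gradient (halfSq F) y) (x - y) := by
      rw [← inner_neg_right, hy', inner_smul_right]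
    rw [← hxy] at h4
    rw [h1] at h3
    rw [hxy, h2] at h4
    rw [hxy] at h3
    have h5 : 0 < inner ℝ (gradient (halfSq F) y) (x - y) :=
      (pos_iff_pos_of_mul_pos (h3 ▸ pow_pos (hF.pos x hx) 2)).1 ht1'
    have h6 := mul_pos ht0' h5
    rw [← h4] at h6
    nlinarith [sq_nonneg (F y)]
  · have h0' : ∀ t ∈ Icc (0 : ℝ) 1, y + t • (x - y) ≠ 0 := fun t ht h => h0 ⟨t, ht, h⟩
    have hder : ∀ t ∈ Icc (0 : ℝ) 1, HasDerivAt
        (fun t : ℝ => fderiv ℝ (halfSq F) (y + t • (x - y)) (x - y))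
        (G F (y + t • (x - y)) (x - y) (x - y)) t := by
      intro t ht
      have h1 : HasDerivAt (fun t : ℝ => y + t • (x - y)) (x - y) t := by
        simpa using ((hasDerivAt_id t).smul_const (x - y)).const_add y
      have h2 := (hF.differentiableAt_fderiv_halfSq (h0' t ht)).hasFDerivAt.comp_hasDerivAt t h1
      exact h2.clm_apply (hasDerivAt_const t (x - y)) |>.congr_deriv (by simp [G])
    obtain ⟨t, ht, h⟩ := exists_hasDerivAt_eq_zero (zero_lt_one (α := ℝ))
      (fun t ht => (hder t ht).continuousAt.continuousWithinAt)
      (by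
        simp only [zero_smul, add_zero, one_smul, add_sub_cancel]
        rw [← inner_gradient_left, ← inner_gradient_left, hxy])
      (fun t ht => hder t (Ioo_subset_Icc_self ht))
    exact (hF.elliptic _ (h0' t (Ioo_subset_Icc_self ht)) _ hv).ne' h

/-- The preimage is found by maximizing `⟨ξ, ·⟩` on the compact Wulff shape: at a maximum point `a`
with value `c`, Lagrange multipliers give `ξ = c DF(a) = ℓ(c a)`. -/
theorem exists_legendre_eq (hF : IsEllipticNorm j F) {ξ : Euc m} (hξ : ξ ≠ 0) :
    ∃ x, x ≠ 0 ∧ gradient (halfSq F) x = ξ := by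
  obtain ⟨a, ha, hmax⟩ := hF.isCompact_wulff.exists_isMaxOn
    ⟨_, hF.inv_smul_mem_wulff hξ⟩ (f := fun y => inner ℝ ξ y) (by fun_prop)
  have ha0 := hF.ne_zero_of_mem_wulff ha
  set c := inner ℝ ξ a with hc
  have hle : ∀ y, inner ℝ ξ y ≤ c * F y := by
    intro y
    rcases eq_or_ne y 0 with rfl | hy
    · simp [hF.map_zero]
    · have h1 : inner ℝ ξ ((F y)⁻¹ • y) ≤ c := hmax (hF.inv_smul_mem_wulff hy)
      rwa [inner_smul_right, inv_mul_le_iff₀ (hF.pos y hy), mul_comm] at h1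
  have hcpos : 0 < c := by
    have h1 := hle ξ
    have h2 : 0 < inner ℝ ξ ξ := by
      rw [real_inner_self_eq_norm_sq]; positivity
    have h3 := hF.pos ξ hξ
    by_contra h
    nlinarith
  refine ⟨c • a, smul_ne_zero hcpos.ne' ha0, ?_⟩
  have hder : HasFDerivAt (fun y => c * F y - inner ℝ ξ y)
      (c • fderiv ℝ F a - innerSL ℝ ξ) a :=
    ((hF.differentiableAt ha0).hasFDerivAt.const_mul c).sub (innerSL ℝ ξ).hasFDerivAt
  have hmin : IsLocalMin (fun y => c * F y - inner ℝ ξ y) a := Eventually.of_forall fun y => by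
    have : F a = 1 := ha
    simp only [this, ← hc]
    linarith [hle y]
  have h0 := hmin.hasFDerivAt_eq_zero hder
  rw [hF.legendre_smul hcpos ha0, hF.gradient_halfSq ha0, show F a = 1 from ha, one_smul]
  refine ext_inner_right ℝ fun y => ?_
  rw [inner_smul_left, inner_gradient_left]
  have := congrArg (fun φ => φ y) h0
  simp at this
  simp
  linarith

/-- The inverse of the Legendre transform. -/
theorem legendreInv_legendre (hF : IsEllipticNorm j F) {x : Euc m} (hx : x ≠ 0) :
    Function.invFunOn (gradient (halfSq F)) {x : Euc m | x ≠ 0} (gradient (halfSq F) x) = x :=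
  hF.legendre_injOn.leftInvOn_invFunOn hx

/-- By global injectivity, the global inverse coincides near `ξ` with the one given by the inverse
function theorem. -/
theorem contDiffAt_legendreInv (hF : IsEllipticNorm j F) {ξ : Euc m} (hξ : ξ ≠ 0) :
    ContDiffAt ℝ j (Function.invFunOn (gradient (halfSq F)) {x : Euc m | x ≠ 0}) ξ := by
  obtain ⟨x, hx, rfl⟩ := hF.exists_legendre_eq hξ
  obtain ⟨g, hg, -, hev⟩ := exists_contDiffAt_rightInverse rfl
    (by have := hF.one_le; exact_mod_cast (by omega : j ≠ 0)) (hF.contDiffAt_legendre hx)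
    (hF.fderiv_legendre_injective hx) (isOpen_ne_zero.mem_nhds hx)
  refine hg.congr_of_eventuallyEq ?_
  filter_upwards [hev] with y ⟨hy1, hy2⟩
  have := hF.legendreInv_legendre hy1
  rwa [hy2] at this

/-! ### The dual norm -/

/-- The Cauchy–Schwarz inequality of Finsler geometry: `ℓ(x) = F(x) DF(x)` and `DF(x) y ≤ F(y)`.
Equality at `y = x` identifies the dual norm. -/
theorem inner_legendre_le (hF : IsEllipticNorm j F) {x : Euc m} (hx : x ≠ 0) (y : Euc m) :
    inner ℝ y (gradient (halfSq F) x) ≤ F y * F x := by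
  rw [real_inner_comm, hF.inner_legendre hx, hF.G_self_left hx, mul_comm (F y)]
  exact mul_le_mul_of_nonneg_left (hF.fderiv_le x hx y) (hF.nonneg x)

theorem dualNorm_legendre (hF : IsEllipticNorm j F) {x : Euc m} (hx : x ≠ 0) :
    dualNorm F (gradient (halfSq F) x) = F x := by
  refine IsGreatest.csSup_eq ⟨⟨x, hx, ?_⟩, ?_⟩
  · have := (hF.pos x hx).ne'
    simp only [real_inner_comm _ x, hF.inner_legendre_self hx]
    field_simp
  · rintro _ ⟨y, hy, rfl⟩
    show inner ℝ y _ / F y ≤ F x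
    rw [div_le_iff₀ (hF.pos y hy), mul_comm]
    exact hF.inner_legendre_le hx y

theorem dualNorm_zero (F : Euc m → ℝ) : dualNorm F 0 = 0 := by
  simp only [dualNorm, inner_zero_right, zero_div]
  rcases Set.eq_empty_or_nonempty {x : Euc m | x ≠ 0} with h | h
  · rw [h, image_empty, Real.sSup_empty]
  · rw [h.image_const, csSup_singleton]

theorem inner_le_mul_dualNorm (hF : IsEllipticNorm j F) (y ξ : Euc m) :
    inner ℝ y ξ ≤ F y * dualNorm F ξ := by
  rcases eq_or_ne ξ 0 with rfl | hξ
  · simp [dualNorm_zero]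
  · obtain ⟨x, hx, rfl⟩ := hF.exists_legendre_eq hξ
    rw [hF.dualNorm_legendre hx]
    exact hF.inner_legendre_le hx y

theorem dualNorm_eq (hF : IsEllipticNorm j F) {ξ : Euc m} (hξ : ξ ≠ 0) :
    dualNorm F ξ =
      F (Function.invFunOn (gradient (halfSq F)) {x : Euc m | x ≠ 0} ξ) := by
  obtain ⟨x, hx, rfl⟩ := hF.exists_legendre_eq hξ
  rw [hF.dualNorm_legendre hx, hF.legendreInv_legendre hx]

theorem differentiableAt_dualNorm (hF : IsEllipticNorm j F) {ξ : Euc m} (hξ : ξ ≠ 0) :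
    DifferentiableAt ℝ (dualNorm F) ξ := by
  have h1 : dualNorm F =ᶠ[𝓝 ξ]
      F ∘ Function.invFunOn (gradient (halfSq F)) {x : Euc m | x ≠ 0} := by
    filter_upwards [isOpen_ne_zero.mem_nhds hξ] with η hη using hF.dualNorm_eq hη
  refine DifferentiableAt.congr_of_eventuallyEq ?_ h1
  have h2 := (hF.contDiffAt_legendreInv hξ).differentiableAt
    (by have := hF.one_le; exact_mod_cast (by omega : j ≠ 0))
  obtain ⟨x, hx, rfl⟩ := hF.exists_legendre_eq hξ
  refine DifferentiableAt.comp _ ?_ h2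
  rw [hF.legendreInv_legendre hx]
  exact hF.differentiableAt hx

/-- The function `F(x) F⁰ - ⟨x, ·⟩` is nonnegative and vanishes at `ℓ(x)`, so its derivative
vanishes there. -/
theorem fderiv_dualNorm_legendre (hF : IsEllipticNorm j F) {x : Euc m} (hx : x ≠ 0) :
    fderiv ℝ (dualNorm F) (gradient (halfSq F) x) = (F x)⁻¹ • innerSL ℝ x := by
  have hd := hF.differentiableAt_dualNorm (hF.legendre_ne_zero hx)
  have hder := (hd.hasFDerivAt.const_mul (F x)).sub (innerSL ℝ x).hasFDerivAt
  have hmin : IsLocalMin (fun ξ => F x * dualNorm F ξ - innerSL ℝ x ξ)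
      (gradient (halfSq F) x) := Eventually.of_forall fun ξ => by
    have h1 := hF.inner_le_mul_dualNorm x ξ
    have h2 := hF.inner_legendre_self hx
    rw [real_inner_comm] at h2
    simp only [innerSL_apply_apply, hF.dualNorm_legendre hx, h2]
    nlinarith
  have h0 := hmin.hasFDerivAt_eq_zero hder
  rw [sub_eq_zero] at h0
  rw [← h0, smul_smul, inv_mul_cancel₀ (hF.pos x hx).ne', one_smul]

theorem gradient_dualNorm_legendre (hF : IsEllipticNorm j F) {x : Euc m} (hx : x ≠ 0) :
    gradient (dualNorm F) (gradient (halfSq F) x) = (F x)⁻¹ • x := by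
  refine ext_inner_right ℝ fun y => ?_
  rw [inner_gradient_left, hF.fderiv_dualNorm_legendre hx, inner_smul_left]
  simp

theorem legendre_dualNorm_legendre (hF : IsEllipticNorm j F) {x : Euc m} (hx : x ≠ 0) :
    gradient (halfSq (dualNorm F)) (gradient (halfSq F) x) = x := by
  have h := fderiv_halfSq_of_differentiableAt
    (hF.differentiableAt_dualNorm (hF.legendre_ne_zero hx))
  refine ext_inner_right ℝ fun y => ?_
  rw [inner_gradient_left, h, hF.fderiv_dualNorm_legendre hx, hF.dualNorm_legendre hx, smul_smul,
    mul_inv_cancel₀ (hF.pos x hx).ne', one_smul]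
  simp

/-- The formula `F⁰ = F ∘ ℓ⁻¹` only gives class C^j. The missing derivative is gained because `DF⁰ =
ℓ⁻¹ / F(ℓ⁻¹)` is again of class C^j. -/
theorem contDiffOn_dualNorm (hF : IsEllipticNorm j F) :
    ContDiffOn ℝ (j + 1 : ℕ) (dualNorm F) {ξ : Euc m | ξ ≠ 0} := by
  have h := contDiffOn_succ_iff_fderiv_of_isOpen (𝕜 := ℝ) (n := (j : WithTop ℕ∞))
    (f := dualNorm F) (isOpen_ne_zero (m := m))
  push_cast
  refine h.2 ⟨fun ξ hξ => (hF.differentiableAt_dualNorm hξ).differentiableWithinAt,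
    fun h => absurd h (by simp), fun ξ hξ => ContDiffAt.contDiffWithinAt ?_⟩
  set ℓ := Function.invFunOn (gradient (halfSq F)) {x : Euc m | x ≠ 0} with hℓ
  have h1 : fderiv ℝ (dualNorm F) =ᶠ[𝓝 ξ] fun η => (F (ℓ η))⁻¹ • innerSL ℝ (ℓ η) := by
    filter_upwards [isOpen_ne_zero.mem_nhds hξ] with η hη
    obtain ⟨x, hx, rfl⟩ := hF.exists_legendre_eq hη
    rw [hF.fderiv_dualNorm_legendre hx, hℓ, hF.legendreInv_legendre hx]
  refine ContDiffAt.congr_of_eventuallyEq ?_ h1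
  have h2 := hF.contDiffAt_legendreInv hξ
  obtain ⟨x, hx, rfl⟩ := hF.exists_legendre_eq hξ
  have h3 : ℓ (gradient (halfSq F) x) = x := hF.legendreInv_legendre hx
  have h4 : ContDiffAt ℝ j (fun η => F (ℓ η)) (gradient (halfSq F) x) := by
    refine ContDiffAt.comp _ ?_ h2
    rw [h3]
    exact (hF.contDiffAt hx).of_le (by exact_mod_cast Nat.le_succ j)
  refine (h4.inv ?_).smul ((innerSL ℝ).contDiff.contDiffAt.comp _ h2)
  rw [h3]
  exact (hF.pos x hx).ne'

/-- The dual of an elliptic norm is an elliptic norm of the same smoothness. -/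
theorem dual (hF : IsEllipticNorm j F) : IsEllipticNorm j (dualNorm F) where
  one_le := hF.one_le
  map_smul t ht ξ := by
    rcases ht.eq_or_lt with rfl | ht
    · simp [dualNorm_zero]
    rcases eq_or_ne ξ 0 with rfl | hξ
    · simp [dualNorm_zero]
    obtain ⟨x, hx, rfl⟩ := hF.exists_legendre_eq hξ
    rw [← hF.legendre_smul ht hx, hF.dualNorm_legendre hx,
      hF.dualNorm_legendre (smul_ne_zero ht.ne' hx), hF.map_smul t ht.le]
  pos ξ hξ := by
    obtain ⟨x, hx, rfl⟩ := hF.exists_legendre_eq hξ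
    rw [hF.dualNorm_legendre hx]
    exact hF.pos x hx
  contDiffOn_two := hF.contDiffOn_dualNorm.of_le
    (by have := hF.one_le; exact_mod_cast (by omega : 2 ≤ j + 1))
  smooth := hF.contDiffOn_dualNorm
  elliptic ξ hξ η hη := by
    obtain ⟨x, hx, rfl⟩ := hF.exists_legendre_eq hξ
    set L := gradient (halfSq F) with hL
    set L₀ := gradient (halfSq (dualNorm F)) with hL₀
    have h0 : L₀ =ᶠ[𝓝 (L x)] Function.invFunOn L {x : Euc m | x ≠ 0} := by
      filter_upwards [isOpen_ne_zero.mem_nhds (hF.legendre_ne_zero hx)] with η hη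
      obtain ⟨y, hy, rfl⟩ := hF.exists_legendre_eq hη
      rw [hL₀, hL, hF.legendre_dualNorm_legendre hy, hF.legendreInv_legendre hy]
    have hd : DifferentiableAt ℝ L₀ (L x) :=
      ((hF.contDiffAt_legendreInv (hF.legendre_ne_zero hx)).congr_of_eventuallyEq
        h0).differentiableAt (by have := hF.one_le; exact_mod_cast (by omega : j ≠ 0))
    have hd' : DifferentiableAt ℝ (fderiv ℝ (halfSq (dualNorm F))) (L x) := by
      have : fderiv ℝ (halfSq (dualNorm F)) = fun ξ => innerSL ℝ (L₀ ξ) := by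
        funext ξ
        ext y
        rw [innerSL_apply_apply, inner_gradient_left]
      rw [this]
      exact (innerSL ℝ).differentiableAt.comp _ hd
    obtain ⟨f', hf'⟩ := exists_continuousLinearEquiv rfl _ (hF.fderiv_legendre_injective hx)
    -- Every `η` is `Dℓ(x) v`. The two Legendre maps have inverse derivatives, so the dual metric at
    -- `(η, η)` is `⟨v, Dℓ(x) v⟩ = G F x v v`.
    obtain ⟨v, rfl⟩ : ∃ v, fderiv ℝ L x v = η := ⟨f'.symm η, by
      rw [← hf']; exact f'.apply_symm_apply η⟩
    have hcomp : fderiv ℝ L₀ (L x) (fderiv ℝ L x v) = v := by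
      have h1 := hd.hasFDerivAt.comp x (hF.differentiableAt_legendre hx).hasFDerivAt
      have h2 : L₀ ∘ L =ᶠ[𝓝 x] id := by
        filter_upwards [isOpen_ne_zero.mem_nhds hx] with y hy
          using hF.legendre_dualNorm_legendre hy
      have h3 := h1.unique ((hasFDerivAt_id x).congr_of_eventuallyEq h2)
      exact congrArg (fun φ => φ v) h3
    rw [G, ← inner_fderiv_gradient hd', hcomp, real_inner_comm, hF.inner_fderiv_legendre hx]
    refine hF.elliptic x hx v ?_
    rintro rfl
    simp at hη
  fderiv_le ξ hξ η := by
    obtain ⟨x, hx, rfl⟩ := hF.exists_legendre_eq hξ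
    rw [hF.fderiv_dualNorm_legendre hx]
    have := hF.inner_le_mul_dualNorm x η
    simp only [smul_apply, innerSL_apply_apply, smul_eq_mul]
    rwa [inv_mul_le_iff₀ (hF.pos x hx)]

theorem dualNorm_dualNorm (hF : IsEllipticNorm j F) : dualNorm (dualNorm F) = F := by
  funext x
  rcases eq_or_ne x 0 with rfl | hx
  · rw [dualNorm_zero, hF.map_zero]
  · have h1 := hF.dual.dualNorm_legendre (hF.legendre_ne_zero hx)
    rw [hF.legendre_dualNorm_legendre hx] at h1
    rw [h1, hF.dualNorm_legendre hx]

end IsEllipticNorm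

/-! ### Local parametrizations -/

namespace IsLocalParam

variable {n : ℕ} {k : WithTop ℕ∞} {M : Set (Euc (n + 1))} {U : Set (Euc n)}
  {X : Euc n → Euc (n + 1)}

theorem mem (h : IsLocalParam k M U X) {u : Euc n} (hu : u ∈ U) : X u ∈ M := by
  obtain ⟨O, -, hO⟩ := h.image_eq
  exact (hO ▸ mem_image_of_mem X hu : X u ∈ M ∩ O).1

theorem contDiffAt (h : IsLocalParam k M U X) {u : Euc n} (hu : u ∈ U) : ContDiffAt ℝ k X u :=
  h.contDiffOn.contDiffAt (h.isOpen.mem_nhds hu)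

theorem translate (h : IsLocalParam k M U X) (c : Euc (n + 1)) :
    IsLocalParam k {y | y - c ∈ M} U (fun u => X u + c) where
  isOpen := h.isOpen
  contDiffOn := h.contDiffOn.add contDiffOn_const
  injective_fderiv u hu := by
    rw [fderiv_add_const]
    exact h.injective_fderiv u hu
  isEmbedding := (Homeomorph.addRight c).isEmbedding.comp h.isEmbedding
  image_eq := by
    obtain ⟨O, hO, hXO⟩ := h.image_eq
    refine ⟨{y | y - c ∈ O}, hO.preimage (continuous_id.sub continuous_const), ?_⟩
    ext y
    have := Set.ext_iff.1 hXO (y - c)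
    simp only [mem_image, mem_inter_iff, mem_ofPred_eq, eq_sub_iff_add_eq] at this ⊢
    exact this

/-- A differentiable left inverse `π` defined on an open set of the ambient space yields both the
injectivity of the derivative and the embedding property. -/
theorem of_leftInverse (hk : k ≠ 0) (hX : ContDiff ℝ k X) {O : Set (Euc (n + 1))} (hO : IsOpen O)
    {π : Euc (n + 1) → Euc n} (hπ : DifferentiableOn ℝ π O) (hXM : ∀ u, X u ∈ M ∩ O)
    (hleft : ∀ u, π (X u) = u) (hright : ∀ x ∈ M ∩ O, X (π x) = x) :
    IsLocalParam k M univ X where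
  isOpen := isOpen_univ
  contDiffOn := hX.contDiffOn
  injective_fderiv u _ := by
    have h1 := ((hπ.differentiableAt (hO.mem_nhds (hXM u).2)).hasFDerivAt).comp u
      (hX.differentiable hk u).hasFDerivAt
    have h2 := h1.unique ((hasFDerivAt_id u).congr_of_eventuallyEq (Eventually.of_forall hleft))
    intro v w hvw
    have h3 : ∀ v, fderiv ℝ π (X u) (fderiv ℝ X u v) = v := fun v => congrArg (fun φ => φ v) h2
    rw [← h3 v, hvw, h3]
  isEmbedding := by
    let g : ↥(univ : Set (Euc n)) → ↥O := fun u => ⟨X u, (hXM u).2⟩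
    let f : ↥O → ↥(univ : Set (Euc n)) := fun x => ⟨π x, mem_univ _⟩
    have hf : Continuous f := (hπ.continuousOn.domRestrict).subtype_mk _
    have hg : Continuous g := (hX.continuous.comp continuous_subtype_val).subtype_mk _
    have hfg : Function.LeftInverse f g := fun u => Subtype.ext (hleft u)
    exact Topology.IsEmbedding.subtypeVal.comp (hfg.isEmbedding hf hg)
  image_eq := by
    refine ⟨O, hO, Subset.antisymm ?_ fun x hx => ⟨π x, mem_univ _, hright x hx⟩⟩
    rintro _ ⟨u, -, rfl⟩
    exact hXM u

end IsLocalParam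

/-- A level set of a homogeneous function has local parametrizations by radial projection of
hyperplanes. -/
theorem exists_radialParam {n : ℕ} {k : WithTop ℕ∞} (hk : k ≠ 0) {F : Euc (n + 1) → ℝ}
    (hhom : PosHomogeneous F) (hpos : ∀ x, x ≠ 0 → 0 < F x) (hF : ContDiffOn ℝ k F {x | x ≠ 0})
    {z : Euc (n + 1)} (hz : z ≠ 0) :
    ∃ (Z : Euc n → Euc (n + 1)) (π : Euc (n + 1) → Euc n), IsLocalParam k (wulff F) univ Z ∧
      ContDiffOn ℝ k π {x | 0 < inner ℝ z x} ∧
      ∀ x, 0 < inner ℝ z x → Z (π x) = (F x)⁻¹ • x := by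
  have : Fact (Module.finrank ℝ (Euc (n + 1)) = n + 1) := ⟨finrank_euclideanSpace_fin⟩
  let b := OrthonormalBasis.fromOrthogonalSpanSingleton (𝕜 := ℝ) n hz
  let T : Euc n →L[ℝ] Euc (n + 1) :=
    (ℝ ∙ z)ᗮ.subtypeL.comp (b.repr.symm.toContinuousLinearEquiv : Euc n →L[ℝ] (ℝ ∙ z)ᗮ)
  let P : Euc (n + 1) →L[ℝ] Euc n :=
    (b.repr.toContinuousLinearEquiv : (ℝ ∙ z)ᗮ →L[ℝ] Euc n).comp
      (ℝ ∙ z)ᗮ.orthogonalProjectionOnto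
  have hzz : 0 < inner ℝ z z := by rw [real_inner_self_eq_norm_sq]; positivity
  have hTz : ∀ u, inner ℝ z (T u) = 0 := fun u =>
    Submodule.mem_orthogonal_singleton_iff_inner_right.1 (b.repr.symm u).2
  have hPT : ∀ u, P (T u) = u := fun u => by
    simp [P, T]
  have hPz : P z = 0 := by
    simp only [P, ContinuousLinearMap.comp_apply]
    rw [Submodule.orthogonalProjectionOnto_orthogonal_apply_eq_zero
      (Submodule.mem_span_singleton_self z)]
    simp
  have hTP : ∀ x, inner ℝ z x = 0 → T (P x) = x := fun x hx => by
    have h1 : x ∈ (ℝ ∙ z)ᗮ := Submodule.mem_orthogonal_singleton_iff_inner_right.2 hx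
    simp only [P, T, ContinuousLinearMap.comp_apply]
    simp [Submodule.starProjection_eq_self_iff.2 h1]
  have hne : ∀ u, z + T u ≠ 0 := fun u h => by
    have := congrArg (inner ℝ z) h
    rw [inner_add_right, hTz, inner_zero_right, add_zero] at this
    exact hzz.ne' this
  -- `Z` projects the affine hyperplane `z + z^⊥` radially onto the level set; `π` scales `x` back
  -- into that hyperplane and then drops the `z` component.
  let Z : Euc n → Euc (n + 1) := fun u => (F (z + T u))⁻¹ • (z + T u)
  let π : Euc (n + 1) → Euc n := fun x => P ((inner ℝ z z / inner ℝ z x) • x)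
  have hZc : ContDiff ℝ k Z := by
    have h1 : ContDiff ℝ k fun u => z + T u := contDiff_const.add T.contDiff
    refine ContDiff.smul (ContDiff.inv ?_ fun u => (hpos _ (hne u)).ne') h1
    exact hF.comp_contDiff h1 hne
  have hπc : ContDiffOn ℝ k π {x | 0 < inner ℝ z x} := by
    have h1 : ContDiffOn ℝ k (fun x => inner ℝ z z / inner ℝ z x) {x | 0 < inner ℝ z x} :=
      contDiffOn_const.div (innerSL ℝ z).contDiff.contDiffOn fun x hx => ne_of_gt hx
    exact P.contDiff.comp_contDiffOn (h1.smul contDiffOn_id)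
  have hright : ∀ x, 0 < inner ℝ z x → Z (π x) = (F x)⁻¹ • x := by
    intro x hx
    set t := inner ℝ z z / inner ℝ z x with ht
    have htpos : 0 < t := div_pos hzz hx
    have h1 : T (π x) = t • x - z := by
      have h2 : π x = P (t • x - z) := by rw [map_sub, hPz, sub_zero]
      rw [h2]
      refine hTP _ ?_
      rw [inner_sub_right, inner_smul_right, ht]
      field_simp
      ring
    show (F (z + T (π x)))⁻¹ • (z + T (π x)) = _
    rw [h1, add_sub_cancel, hhom t htpos, smul_smul]
    congr 1
    field_simp
  have hZF : ∀ u, F (Z u) = 1 := fun u => by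
    have := hpos _ (hne u)
    rw [hhom _ (inv_pos.2 this), inv_mul_cancel₀ this.ne']
  have hZz : ∀ u, inner ℝ z (Z u) = (F (z + T u))⁻¹ * inner ℝ z z := fun u => by
    rw [inner_smul_right, inner_add_right, hTz, add_zero]
  have hZO : ∀ u, 0 < inner ℝ z (Z u) := fun u => by
    rw [hZz]
    exact mul_pos (inv_pos.2 (hpos _ (hne u))) hzz
  refine ⟨Z, π, IsLocalParam.of_leftInverse hk hZc (O := {x | 0 < inner ℝ z x})
    (isOpen_lt continuous_const (by fun_prop)) (hπc.differentiableOn hk)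
    (fun u => ⟨hZF u, hZO u⟩) (fun u => ?_) ?_, hπc, hright⟩
  · show P _ = u
    have hFp := hpos _ (hne u)
    have : (inner ℝ z z / inner ℝ z (Z u)) • Z u = z + T u := by
      rw [hZz, smul_smul]
      have : inner ℝ z z / ((F (z + T u))⁻¹ * inner ℝ z z) * (F (z + T u))⁻¹ = 1 := by
        field_simp
      rw [this, one_smul]
    rw [this, map_add, hPz, hPT, zero_add]
  · rintro x ⟨hx1, hx2⟩
    rw [hright x hx2, show F x = 1 from hx1, inv_one, one_smul]

/-! ### The support matrix as a Hessian -/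

theorem fderiv_eq_sum_pd {n : ℕ} {W : Type*} [NormedAddCommGroup W] [NormedSpace ℝ W]
    (f : Euc n → W) (u a : Euc n) : fderiv ℝ f u a = ∑ i, a i • pd i f u := by
  conv_lhs => rw [← (EuclideanSpace.basisFun (Fin n) ℝ).sum_repr a]
  simp [pd]

theorem bilinear_fderiv_eq_sum {n : ℕ} {W : Type*} [NormedAddCommGroup W] [NormedSpace ℝ W]
    (B : W →L[ℝ] W →L[ℝ] ℝ) (f : Euc n → W) (u a b : Euc n) :
    B (fderiv ℝ f u a) (fderiv ℝ f u b) = ∑ i, ∑ j, a i * b j * B (pd i f u) (pd j f u) := by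
  simp only [fderiv_eq_sum_pd f u a, fderiv_eq_sum_pd f u b, map_sum, map_smul, sum_apply,
    smul_apply, smul_eq_mul, Finset.mul_sum]
  rw [Finset.sum_comm]
  exact Finset.sum_congr rfl fun i _ => Finset.sum_congr rfl fun j _ => by ring

theorem contDiffAt_pd {n : ℕ} {W : Type*} [NormedAddCommGroup W] [NormedSpace ℝ W] {f : Euc n → W}
    {u : Euc n} {k l : WithTop ℕ∞} (hf : ContDiffAt ℝ k f u) (hk : l + 1 ≤ k) (i : Fin n) :
    ContDiffAt ℝ l (pd i f) u :=
  (hf.fderiv_right hk).clm_apply contDiffAt_const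

theorem pd_pd_eq {n : ℕ} {W : Type*} [NormedAddCommGroup W] [NormedSpace ℝ W] {f : Euc n → W}
    {u : Euc n} (hf : ContDiffAt ℝ 2 f u) (i j : Fin n) :
    pd i (pd j f) u =
      fderiv ℝ (fderiv ℝ f) u (EuclideanSpace.single i 1) (EuclideanSpace.single j 1) := by
  have h1 : DifferentiableAt ℝ (fderiv ℝ f) u :=
    (hf.fderiv_right (m := 1) (by norm_num)).differentiableAt (by simp)
  have h2 := h1.hasFDerivAt.clm_apply (hasFDerivAt_const (EuclideanSpace.single j (1 : ℝ)) u)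
  have h3 : HasFDerivAt (pd j f) _ u := h2
  rw [pd, h3.fderiv]
  simp

theorem pd_comm {n : ℕ} {W : Type*} [NormedAddCommGroup W] [NormedSpace ℝ W] {f : Euc n → W}
    {u : Euc n} (hf : ContDiffAt ℝ 2 f u) (i j : Fin n) :
    pd i (pd j f) u = pd j (pd i f) u := by
  rw [pd_pd_eq hf, pd_pd_eq hf]
  exact hf.isSymmSndFDerivAt (by simp) _ _

namespace IsEllipticNorm

variable {m n : ℕ}

/-! ### Symmetries of the cubic form `Q` -/

section Cubic

variable {F : Euc m → ℝ} {x : Euc m}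

theorem contDiffAt_fderiv_halfSq (hF : IsEllipticNorm 2 F) (hx : x ≠ 0) :
    ContDiffAt ℝ 2 (fderiv ℝ (halfSq F)) x :=
  (hF.contDiffAt_halfSq hx).fderiv_right (by norm_num)

theorem differentiableAt_fderiv_fderiv_halfSq (hF : IsEllipticNorm 2 F) (hx : x ≠ 0) :
    DifferentiableAt ℝ (fderiv ℝ (fderiv ℝ (halfSq F))) x :=
  ((hF.contDiffAt_fderiv_halfSq hx).fderiv_right (m := 1) (by norm_num)).differentiableAt (by simp)

theorem hasFDerivAt_G (hF : IsEllipticNorm 2 F) {V : Type*} [NormedAddCommGroup V]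
    [NormedSpace ℝ V] {Z a b : V → Euc m} {u : V} (hx : Z u ≠ 0)
    (hZ : DifferentiableAt ℝ Z u) (ha : DifferentiableAt ℝ a u) (hb : DifferentiableAt ℝ b u)
    (v : V) :
    fderiv ℝ (fun w => G F (Z w) (a w) (b w)) u v =
      Q F (Z u) (fderiv ℝ Z u v) (a u) (b u) + G F (Z u) (fderiv ℝ a u v) (b u)
        + G F (Z u) (a u) (fderiv ℝ b u v) := by
  have h1 := HasFDerivAt.comp (f := Z) (g := fderiv ℝ (fderiv ℝ (halfSq F))) u
    (hF.differentiableAt_fderiv_fderiv_halfSq hx).hasFDerivAt hZ.hasFDerivAt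
  have h2 := (h1.clm_apply ha.hasFDerivAt).clm_apply hb.hasFDerivAt
  have h3 : HasFDerivAt (fun w => G F (Z w) (a w) (b w)) _ u := h2
  rw [h3.fderiv]
  simp [Q, G]
  ring

theorem Q_swap (hF : IsEllipticNorm 2 F) (hx : x ≠ 0) (ξ η ζ : Euc m) :
    Q F x ξ η ζ = Q F x η ξ ζ := by
  have h := (hF.contDiffAt_fderiv_halfSq hx).isSymmSndFDerivAt (by simp)
  exact congrArg (fun φ => φ ζ) (h ξ η)

theorem Q_swap_right (hF : IsEllipticNorm 2 F) (hx : x ≠ 0) (ξ η ζ : Euc m) :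
    Q F x ξ η ζ = Q F x ξ ζ η := by
  have h1 := hF.hasFDerivAt_G (Z := id) (a := fun _ => η) (b := fun _ => ζ) hx differentiableAt_id
    (differentiableAt_const _) (differentiableAt_const _) ξ
  have h2 := hF.hasFDerivAt_G (Z := id) (a := fun _ => ζ) (b := fun _ => η) hx differentiableAt_id
    (differentiableAt_const _) (differentiableAt_const _) ξ
  have h3 : (fun w => G F (id w) η ζ) =ᶠ[𝓝 x] fun w => G F (id w) ζ η := by
    filter_upwards [isOpen_ne_zero.mem_nhds hx] with w hw using hF.G_symm hw _ _
  rw [h3.fderiv_eq, h2] at h1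
  simpa [G] using h1.symm

/-- Differentiating `G(w)(η, w) = D(F²/2)(w) η` in `w` produces `G(ξ, η)` on both sides, and only
the `Q` term is left over. -/
theorem Q_self_right (hF : IsEllipticNorm 2 F) (hx : x ≠ 0) (ξ η : Euc m) :
    Q F x ξ η x = 0 := by
  have h1 := hF.hasFDerivAt_G (Z := id) (a := fun _ => η) (b := id) hx differentiableAt_id
    (differentiableAt_const _) differentiableAt_id ξ
  have h3 : (fun w => G F (id w) η (id w)) =ᶠ[𝓝 x] fun w => fderiv ℝ (halfSq F) w η := by
    filter_upwards [isOpen_ne_zero.mem_nhds hx] with w hw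
    rw [id, hF.G_symm hw, hF.G_self_left' hw]
  have h4 : fderiv ℝ (fun w => fderiv ℝ (halfSq F) w η) x ξ = G F x ξ η := by
    rw [((hF.differentiableAt_fderiv_halfSq hx).hasFDerivAt.clm_apply
      (hasFDerivAt_const η x)).fderiv]
    simp [G]
  rw [h3.fderiv_eq, h4, hF.G_symm hx] at h1
  simpa [G] using h1

end Cubic

variable {F : Euc (n + 1) → ℝ}

/-- Expansion in a basis consisting of `z` and an orthonormal basis of its orthogonal complement. -/
theorem eq_sum_of_orthonormal {j : ℕ} (hF : IsEllipticNorm j F) {z : Euc (n + 1)}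
    (hz : z ∈ wulff F) {e : Fin n → Euc (n + 1)}
    (he : ∀ i j, G F z (e i) (e j) = if i = j then 1 else 0) (hze : ∀ i, G F z z (e i) = 0)
    (v : Euc (n + 1)) : v = G F z z v • z + ∑ k, G F z (e k) v • e k := by
  have hz0 := hF.ne_zero_of_mem_wulff hz
  have hzz : G F z z z = 1 := by
    rw [hF.G_self_left hz0, hF.fderiv_self hz0, show F z = 1 from hz, one_mul]
  let φ : Euc (n + 1) →ₗ[ℝ] ℝ × (Fin n → ℝ) :=
    { toFun := fun v => (G F z z v, fun k => G F z (e k) v)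
      map_add' := fun v w => by ext <;> simp [G]
      map_smul' := fun t v => by ext <;> simp [G] }
  have hcomb : ∀ (t : ℝ) (c : Fin n → ℝ), φ (t • z + ∑ k, c k • e k) = (t, c) := by
    intro t c
    have hez : ∀ i, G F z (e i) z = 0 := fun i => by rw [hF.G_symm hz0, hze]
    have h1 : ∀ w, G F z w (t • z + ∑ k, c k • e k)
        = t * G F z w z + ∑ k, c k * G F z w (e k) := fun w => by simp [G]
    ext i
    · show G F z z _ = t
      simp [h1, hzz, hze]
    · show G F z (e i) _ = c i
      simp [h1, hez, he]
  -- Prescribed coordinates are realized by `hcomb`; as the dimensions agree, the coordinate map is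
  -- also injective.
  have hsurj : Function.Surjective φ := fun p => ⟨p.1 • z + ∑ k, p.2 k • e k, hcomb _ _⟩
  have hinj : Function.Injective φ :=
    (LinearMap.injective_iff_surjective_of_finrank_eq_finrank (by simp [add_comm])).2 hsurj
  exact hinj (hcomb _ _).symm

/-- The derivative of `ℓ` represents `G`, so the chain rule reads `S_i = G(e_i, X)` with `X = Dh ∘
ℓ`. -/
theorem fderiv_comp_legendre {j : ℕ} (hF : IsEllipticNorm j F) {h : Euc (n + 1) → ℝ}
    (hh : ContDiffOn ℝ 2 h {x | x ≠ 0}) {Z : Euc n → Euc (n + 1)} {u : Euc n}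
    (hZ : DifferentiableAt ℝ Z u) (h0 : Z u ≠ 0) (v : Euc n) :
    fderiv ℝ (fun w => h (gradient (halfSq F) (Z w))) u v =
      G F (Z u) (fderiv ℝ Z u v) (gradient h (gradient (halfSq F) (Z u))) := by
  have h1 : DifferentiableAt ℝ h (gradient (halfSq F) (Z u)) :=
    (hh.contDiffAt (isOpen_ne_zero.mem_nhds (hF.legendre_ne_zero h0))).differentiableAt (by simp)
  have h2 := (h1.hasFDerivAt.comp (Z u) (hF.differentiableAt_legendre h0).hasFDerivAt).comp u
    hZ.hasFDerivAt
  have h3 : HasFDerivAt (fun w => h (gradient (halfSq F) (Z w))) _ u := h2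
  rw [h3.fderiv, ← hF.inner_fderiv_legendre h0, real_inner_comm, inner_gradient_left]
  rfl

variable {V : Set (Euc n)} {Z : Euc n → Euc (n + 1)} {k : WithTop ℕ∞}

/-- `F` is constant along the chart and `G(z)(z, ·) = F(z) DF(z)`: the position vector is the
`G`-normal of the Wulff shape. -/
theorem G_self_fderiv {j : ℕ} (hF : IsEllipticNorm j F) (hZ : IsLocalParam k (wulff F) V Z)
    (hk : k ≠ 0) {u : Euc n} (hu : u ∈ V) (v : Euc n) :
    G F (Z u) (Z u) (fderiv ℝ Z u v) = 0 := by
  have hz0 := hF.ne_zero_of_mem_wulff (hZ.mem hu)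
  have h1 := (hF.differentiableAt hz0).hasFDerivAt.comp u
    ((hZ.contDiffAt hu).differentiableAt hk).hasFDerivAt
  have h2 : F ∘ Z =ᶠ[𝓝 u] fun _ => 1 := by
    filter_upwards [hZ.isOpen.mem_nhds hu] with w hw using hZ.mem hw
  have h3 := h1.unique ((hasFDerivAt_const (1 : ℝ) u).congr_of_eventuallyEq h2)
  rw [hF.G_self_left hz0]
  have h4 : fderiv ℝ F (Z u) (fderiv ℝ Z u v) = 0 := congrArg (fun φ => φ v) h3
  rw [h4, mul_zero]

/-- Gauss formula for the Wulff shape: differentiate `G(Z)(Z, ∂_j Z) = 0`, where the `Q` term dies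
because one of its arguments is `Z`. -/
theorem G_self_pd_pd (hF : IsEllipticNorm 2 F) (hZ : IsLocalParam k (wulff F) V Z)
    (hk : 2 ≤ k) {u : Euc n} (hu : u ∈ V) (i j : Fin n) :
    G F (Z u) (Z u) (pd i (pd j Z) u) = -G F (Z u) (pd i Z u) (pd j Z u) := by
  have hz0 := hF.ne_zero_of_mem_wulff (hZ.mem hu)
  have hZ2 : ContDiffAt ℝ 2 Z u := (hZ.contDiffAt hu).of_le hk
  have hk0 : k ≠ 0 := fun h => by simp [h] at hk
  have h1 := hF.hasFDerivAt_G hz0 (hZ2.differentiableAt (by simp))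
    (hZ2.differentiableAt (by simp))
    ((contDiffAt_pd hZ2 (l := 1) (by norm_num) j).differentiableAt (by simp))
    (EuclideanSpace.single i 1)
  have h2 : (fun w => G F (Z w) (Z w) (pd j Z w)) =ᶠ[𝓝 u] fun _ => 0 := by
    filter_upwards [hZ.isOpen.mem_nhds hu] with w hw using hF.G_self_fderiv hZ hk0 hw _
  rw [h2.fderiv_eq, hF.Q_swap_right hz0, hF.Q_self_right hz0] at h1
  simp at h1
  simp only [pd] at h1 ⊢
  linarith

theorem wulffMetric_symm {j : ℕ} (hF : IsEllipticNorm j F) {u : Euc n} (h0 : Z u ≠ 0) :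
    (wulffMetric F Z u).transpose = wulffMetric F Z u := by
  ext i j
  exact hF.G_symm h0 _ _

/-- The lowered Christoffel symbols of the Wulff shape. -/
theorem pd_wulffMetric_combination (hF : IsEllipticNorm 2 F) {u : Euc n}
    (h0 : Z u ≠ 0) (hZ : ContDiffAt ℝ 2 Z u) (i j l : Fin n) :
    pd i (fun w => wulffMetric F Z w j l) u + pd j (fun w => wulffMetric F Z w i l) u
      - pd l (fun w => wulffMetric F Z w i j) u =
    Q F (Z u) (pd i Z u) (pd j Z u) (pd l Z u) + 2 * G F (Z u) (pd i (pd j Z) u) (pd l Z u) := by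
  have hd : ∀ i, DifferentiableAt ℝ (pd i Z) u := fun i =>
    (contDiffAt_pd hZ (l := 1) (by norm_num) i).differentiableAt (by simp)
  have hpd : ∀ i j l, pd i (fun w => wulffMetric F Z w j l) u =
      Q F (Z u) (pd i Z u) (pd j Z u) (pd l Z u) + G F (Z u) (pd i (pd j Z) u) (pd l Z u)
        + G F (Z u) (pd j Z u) (pd i (pd l Z) u) := fun i j l =>
    hF.hasFDerivAt_G h0 (hZ.differentiableAt (by simp)) (hd j) (hd l) _
  rw [hpd, hpd, hpd, pd_comm hZ j i, pd_comm hZ l i, pd_comm hZ l j,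
    hF.Q_swap h0 (pd j Z u), hF.Q_swap h0 (pd l Z u), hF.Q_swap_right h0 (pd i Z u) (pd l Z u),
    hF.G_symm h0 (pd i (pd l Z) u)]
  ring

theorem pd_pd_comp_legendre (hF : IsEllipticNorm 2 F) {h : Euc (n + 1) → ℝ}
    (hh : ContDiffOn ℝ 2 h {x | x ≠ 0}) (hV : IsOpen V) (hZ : ContDiffOn ℝ 2 Z V)
    (h0 : ∀ u ∈ V, Z u ≠ 0) {u : Euc n} (hu : u ∈ V) (i j : Fin n) :
    pd i (pd j (fun w => h (gradient (halfSq F) (Z w)))) u =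
      Q F (Z u) (pd i Z u) (pd j Z u) (gradient h (gradient (halfSq F) (Z u)))
      + G F (Z u) (pd i (pd j Z) u) (gradient h (gradient (halfSq F) (Z u)))
      + fderiv ℝ (fderiv ℝ h) (gradient (halfSq F) (Z u))
          (fderiv ℝ (gradient (halfSq F)) (Z u) (pd i Z u))
          (fderiv ℝ (gradient (halfSq F)) (Z u) (pd j Z u)) := by
  have hZ2 : ContDiffAt ℝ 2 Z u := hZ.contDiffAt (hV.mem_nhds hu)
  have h1 : pd j (fun w => h (gradient (halfSq F) (Z w))) =ᶠ[𝓝 u]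
      fun w => G F (Z w) (pd j Z w) (gradient h (gradient (halfSq F) (Z w))) := by
    filter_upwards [hV.mem_nhds hu] with w hw
    exact hF.fderiv_comp_legendre hh
      ((hZ.contDiffAt (hV.mem_nhds hw)).differentiableAt (by simp)) (h0 w hw) _
  have hξ := hF.legendre_ne_zero (h0 u hu)
  have hdh : DifferentiableAt ℝ (fderiv ℝ h) (gradient (halfSq F) (Z u)) :=
    ((hh.contDiffAt (isOpen_ne_zero.mem_nhds hξ)).fderiv_right (m := 1)
      (by norm_num)).differentiableAt (by simp)
  have hdX : HasFDerivAt (fun w => gradient h (gradient (halfSq F) (Z w)))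
      ((fderiv ℝ (gradient h) (gradient (halfSq F) (Z u))).comp
        ((fderiv ℝ (gradient (halfSq F)) (Z u)).comp (fderiv ℝ Z u))) u := by
    have hdL := HasFDerivAt.comp (f := Z) u (hF.differentiableAt_legendre (h0 u hu)).hasFDerivAt
      (hZ2.differentiableAt (by simp)).hasFDerivAt
    exact HasFDerivAt.comp (f := gradient (halfSq F) ∘ Z) u
      (hasFDerivAt_gradient hdh).differentiableAt.hasFDerivAt hdL
  have h2 := hF.hasFDerivAt_G (h0 u hu) (hZ2.differentiableAt (by simp))
    ((contDiffAt_pd hZ2 (l := 1) (by norm_num) j).differentiableAt (by simp))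
    hdX.differentiableAt (EuclideanSpace.single i 1)
  rw [pd, h1.fderiv_eq, h2, hdX.fderiv]
  congr 1
  rw [← hF.inner_fderiv_legendre (h0 u hu), real_inner_comm]
  exact inner_fderiv_gradient hdh _ _

end IsEllipticNorm

/-! ### Christoffel symbols and the Hessian form of `A_S` -/

namespace IsEllipticNorm

variable {n : ℕ} {F : Euc (n + 1) → ℝ} {V : Set (Euc n)} {Z : Euc n → Euc (n + 1)}
  {k : WithTop ℕ∞}

theorem det_wulffMetric_ne_zero {u : Euc n} {a : Fin n → Euc n}
    (ha : IsOrthonormalFrame F Z u a) : IsUnit (wulffMetric F Z u).det := by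
  set A : Matrix (Fin n) (Fin n) ℝ := Matrix.of fun l i => a i l with hA
  have h1 : A.transpose * (wulffMetric F Z u * A) = 1 := by
    ext i j
    have h2 := ha i j
    have h3 := bilinear_fderiv_eq_sum (fderiv ℝ (fderiv ℝ (halfSq F)) (Z u)) Z u (a i) (a j)
    rw [G, h3] at h2
    rw [Matrix.one_apply, ← h2]
    simp only [Matrix.mul_apply, Finset.mul_sum, Matrix.transpose_apply, hA, Matrix.of_apply,
      wulffMetric, G]
    exact Finset.sum_congr rfl fun l _ => Finset.sum_congr rfl fun r _ => by ring
  have h2 := congrArg Matrix.det h1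
  rw [Matrix.det_mul, Matrix.det_mul, Matrix.det_one] at h2
  exact IsUnit.of_mul_eq_one (A.det * A.transpose.det) (by linarith)

/-- Contraction of the Christoffel symbols with a covector lowered from the coordinates `y`. -/
theorem sum_christoffel (hF : IsEllipticNorm 2 F) {u : Euc n}
    (h0 : Z u ≠ 0) (hZ : ContDiffAt ℝ 2 Z u) (hdet : IsUnit (wulffMetric F Z u).det)
    (i j : Fin n) (y : Euc n) :
    ∑ k, christoffel F Z u i j k * G F (Z u) (pd k Z u) (fderiv ℝ Z u y) =
      (1 / 2) * Q F (Z u) (pd i Z u) (pd j Z u) (fderiv ℝ Z u y)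
        + G F (Z u) (pd i (pd j Z) u) (fderiv ℝ Z u y) := by
  set P := wulffMetric F Z u with hP
  set c : Fin n → ℝ := fun l => Q F (Z u) (pd i Z u) (pd j Z u) (pd l Z u)
    + 2 * G F (Z u) (pd i (pd j Z) u) (pd l Z u) with hc
  have h1 : ∀ k, christoffel F Z u i j k = (1 / 2) * (P⁻¹.mulVec c) k := fun k => by
    simp only [christoffel, hF.pd_wulffMetric_combination h0 hZ, Matrix.mulVec, dotProduct, hc, hP]
  have h2 : ∀ k, G F (Z u) (pd k Z u) (fderiv ℝ Z u y) = (P.mulVec y) k := fun k => by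
    rw [fderiv_eq_sum_pd]
    simp [G, Matrix.mulVec, dotProduct, hP, wulffMetric, mul_comm]
  have h3 : P⁻¹.mulVec c ⬝ᵥ P.mulVec y = c ⬝ᵥ y := by
    rw [Matrix.dotProduct_mulVec, ← Matrix.mulVec_transpose, hF.wulffMetric_symm h0,
      Matrix.mulVec_mulVec, Matrix.mul_nonsing_inv _ hdet, Matrix.one_mulVec]
  have h4 : c ⬝ᵥ y = Q F (Z u) (pd i Z u) (pd j Z u) (fderiv ℝ Z u y)
      + 2 * G F (Z u) (pd i (pd j Z) u) (fderiv ℝ Z u y) := by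
    rw [fderiv_eq_sum_pd]
    simp only [Q, G, map_sum, _root_.map_smul, smul_eq_mul, hc, dotProduct, Finset.mul_sum,
      ← Finset.sum_add_distrib]
    exact Finset.sum_congr rfl fun l _ => by ring
  simp only [h1, h2, mul_assoc, ← Finset.mul_sum]
  have h5 : ∑ k, (P⁻¹.mulVec c) k * (P.mulVec y) k = P⁻¹.mulVec c ⬝ᵥ P.mulVec y := rfl
  rw [h5, h3, h4]
  ring

/-- In an orthonormal frame, the matrix `A_S` is the Hessian of the homogeneous function `h` such
that `S` is the composition of `h` with the Legendre transform. -/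
theorem supportMatrix_apply (hF : IsEllipticNorm 2 F) {h S : Euc (n + 1) → ℝ}
    (hh : ContDiffOn ℝ 2 h {x | x ≠ 0}) (hhom : PosHomogeneous h)
    (hS : ∀ z ∈ wulff F, S z = h (gradient (halfSq F) z))
    (hZ : IsLocalParam k (wulff F) V Z) (hk : 2 ≤ k) {u : Euc n} (hu : u ∈ V)
    {a : Fin n → Euc n} (ha : IsOrthonormalFrame F Z u a) (p q : Fin n) :
    supportMatrix F S Z u a p q =
      fderiv ℝ (fderiv ℝ h) (gradient (halfSq F) (Z u))
        (fderiv ℝ (gradient (halfSq F)) (Z u) (fderiv ℝ Z u (a p)))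
        (fderiv ℝ (gradient (halfSq F)) (Z u) (fderiv ℝ Z u (a q))) := by
  have hk0 : k ≠ 0 := fun h => by simp [h] at hk
  have hZ2 : ContDiffOn ℝ 2 Z V := hZ.contDiffOn.of_le hk
  have h0 : ∀ w ∈ V, Z w ≠ 0 := fun w hw => hF.ne_zero_of_mem_wulff (hZ.mem hw)
  have hz0 := h0 u hu
  set z := Z u with hz
  set ξ := gradient (halfSq F) z with hξ
  have hξ0 : ξ ≠ 0 := hF.legendre_ne_zero hz0
  set X := gradient h ξ with hX
  set s : Euc n → ℝ := fun w => h (gradient (halfSq F) (Z w)) with hs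
  have hSs : (fun w => S (Z w)) =ᶠ[𝓝 u] s := by
    filter_upwards [hZ.isOpen.mem_nhds hu] with w hw using hS _ (hZ.mem hw)
  have hZu : ContDiffAt ℝ 2 Z u := (hZ.contDiffAt hu).of_le hk
  have hds : ∀ v, fderiv ℝ s u v = G F z (fderiv ℝ Z u v) X := fun v =>
    hF.fderiv_comp_legendre hh (hZu.differentiableAt (by simp)) hz0 v
  have hzX : G F z z X = s u := by
    rw [← hF.inner_legendre hz0, real_inner_comm, hX, inner_gradient_left]
    exact hhom.fderiv_self
      ((hh.contDiffAt (isOpen_ne_zero.mem_nhds hξ0)).differentiableAt (by simp))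
  -- `y` is the coordinate vector of the tangential part of `X`; the normal part is `s u • z`.
  set y : Euc n := ∑ r, G F z (fderiv ℝ Z u (a r)) X • a r with hy
  have hexp : X = s u • z + fderiv ℝ Z u y := by
    have := hF.eq_sum_of_orthonormal (hZ.mem hu) ha (fun i => hF.G_self_fderiv hZ hk0 hu (a i)) X
    rw [hzX] at this
    simpa only [hy, map_sum, _root_.map_smul] using this
  have hQX : ∀ v w, Q F z v w X = Q F z v w (fderiv ℝ Z u y) := fun v w => by
    have h1 := hF.Q_self_right hz0 v w
    rw [hexp]
    simp only [Q] at h1 ⊢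
    rw [map_add, _root_.map_smul, h1, smul_zero, zero_add]
  have hGX : ∀ v, G F z v X = s u * G F z z v + G F z v (fderiv ℝ Z u y) := fun v => by
    rw [hexp, hF.G_symm hz0 z v]
    simp [G]
  have hdet := det_wulffMetric_ne_zero ha
  -- The Christoffel term takes away half of `Q(∂_i, ∂_j, X)` and all of the tangential part of
  -- `G(∂_i ∂_j Z, X)`; the normal part of `∂_i ∂_j Z` leaves `-s g_ij`.
  have hcoef : ∀ i j, pd i (pd j s) u - ∑ r, christoffel F Z u i j r * pd r s u =
      fderiv ℝ (fderiv ℝ h) ξ (fderiv ℝ (gradient (halfSq F)) z (pd i Z u))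
          (fderiv ℝ (gradient (halfSq F)) z (pd j Z u))
        + (1 / 2) * Q F z (fderiv ℝ Z u y) (pd i Z u) (pd j Z u)
        - s u * G F z (pd i Z u) (pd j Z u) := by
    intro i j
    have h1 : ∀ r, pd r s u = G F z (pd r Z u) (fderiv ℝ Z u y) := fun r => by
      rw [pd, hds, hGX, hF.G_self_fderiv hZ hk0 hu, mul_zero, zero_add, pd]
    simp only [h1]
    rw [hF.sum_christoffel hz0 hZu hdet, hF.pd_pd_comp_legendre hh hZ.isOpen hZ2 h0 hu,
      hQX, hGX, hF.G_self_pd_pd hZ hk hu, hF.Q_swap hz0 (fderiv ℝ Z u y),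
      hF.Q_swap_right hz0 (pd i Z u) (fderiv ℝ Z u y)]
    ring
  have hcov : ∀ b c : Euc n, covHessian F S Z u b c =
      fderiv ℝ (fderiv ℝ h) ξ (fderiv ℝ (gradient (halfSq F)) z (fderiv ℝ Z u b))
          (fderiv ℝ (gradient (halfSq F)) z (fderiv ℝ Z u c))
        + (1 / 2) * Q F z (fderiv ℝ Z u y) (fderiv ℝ Z u b) (fderiv ℝ Z u c)
        - s u * G F z (fderiv ℝ Z u b) (fderiv ℝ Z u c) := by
    intro b c
    have e1 := bilinear_fderiv_eq_sum ((fderiv ℝ (fderiv ℝ h) ξ).bilinearComp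
      (fderiv ℝ (gradient (halfSq F)) z) (fderiv ℝ (gradient (halfSq F)) z)) Z u b c
    have e2 := bilinear_fderiv_eq_sum
      (fderiv ℝ (fderiv ℝ (fderiv ℝ (halfSq F))) z (fderiv ℝ Z u y)) Z u b c
    have e3 := bilinear_fderiv_eq_sum (fderiv ℝ (fderiv ℝ (halfSq F)) z) Z u b c
    simp only [ContinuousLinearMap.bilinearComp_apply] at e1
    rw [e1, Q, e2, G, e3, covHessian]
    have e4 : ∀ j, pd j (fun w => S (Z w)) =ᶠ[𝓝 u] pd j s := fun j => by
      filter_upwards [hSs.fderiv (𝕜 := ℝ)] with w hw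
      simp only [pd, hw]
    have e5 : ∀ i j, pd i (pd j (fun w => S (Z w))) u = pd i (pd j s) u := fun i j => by
      rw [pd, (e4 j).fderiv_eq, pd]
    simp only [e5, (e4 _).eq_of_nhds, hcoef, Finset.mul_sum, ← Finset.sum_add_distrib,
      ← Finset.sum_sub_distrib, Q, G]
    exact Finset.sum_congr rfl fun i _ => Finset.sum_congr rfl fun j _ => by ring
  -- Since `S_r = G(e_r, X)`, contracting `Q` with the derivatives of `S` inserts the tangential
  -- part of `X`. This cancels the remaining half of `Q`.
  have hQsum : ∑ r, Q F z (fderiv ℝ Z u (a p)) (fderiv ℝ Z u (a q)) (fderiv ℝ Z u (a r))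
      * fderiv ℝ s u (a r) = Q F z (fderiv ℝ Z u y) (fderiv ℝ Z u (a p)) (fderiv ℝ Z u (a q)) := by
    rw [hF.Q_swap hz0 (fderiv ℝ Z u y), hF.Q_swap_right hz0 (fderiv ℝ Z u (a p))
      (fderiv ℝ Z u y)]
    simp only [hds, hy, map_sum, _root_.map_smul, Q, smul_eq_mul, mul_comm]
  simp only [supportMatrix, Matrix.of_apply]
  rw [hSs.fderiv_eq, hQsum, hcov, ha p q, show S (Z u) = s u from hSs.eq_of_nhds]
  ring

end IsEllipticNorm

/-! ### Strong convexity of the unit spheres of elliptic norms -/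

theorem posDef_of_bilinear {n : ℕ} {W : Type*} [NormedAddCommGroup W] [NormedSpace ℝ W]
    (B : W →L[ℝ] W →L[ℝ] ℝ) (e : Fin n → W) (hsymm : ∀ i j, B (e i) (e j) = B (e j) (e i))
    (hpos : ∀ c : Fin n → ℝ, c ≠ 0 → 0 < B (∑ i, c i • e i) (∑ i, c i • e i)) :
    (Matrix.of fun i j => B (e i) (e j)).PosDef := by
  refine Matrix.PosDef.of_dotProduct_mulVec_pos ?_ fun c hc => ?_
  · ext i j
    simp [hsymm i j]
  · have h := hpos c hc
    have h2 : B (∑ i, c i • e i) (∑ i, c i • e i) =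
        star c ⬝ᵥ (Matrix.of fun i j => B (e i) (e j)).mulVec c := by
      simp only [map_sum, map_smul, sum_apply, smul_apply, smul_eq_mul, dotProduct, Matrix.mulVec,
        Matrix.of_apply, Finset.mul_sum, star_trivial]
      rw [Finset.sum_comm]
      exact Finset.sum_congr rfl fun i _ => Finset.sum_congr rfl fun j _ => by ring
    rwa [← h2]

/-! ### Outer normals, bodies and tangential Hessians of unit spheres -/

namespace IsC2Norm

variable {m : ℕ} {ρ : Euc m → ℝ}

theorem subadditive (hρ : IsC2Norm ρ) (x y : Euc m) : ρ (x + y) ≤ ρ x + ρ y := by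
  rcases eq_or_ne (x + y) 0 with h | h
  · rw [h, hρ.map_zero]
    exact add_nonneg (hρ.nonneg x) (hρ.nonneg y)
  · rw [← hρ.fderiv_self h, map_add]
    exact add_le_add (hρ.fderiv_le _ h x) (hρ.fderiv_le _ h y)

/-- By homogeneity the support condition becomes `⟨v, y⟩ ≤ ⟨v, x⟩ ρ(y)` for all `y`, with equality
at `x`, so the derivatives of both sides agree there. This makes the outer normal unique. -/
theorem fderiv_eq_of_support (hρ : IsC2Norm ρ) {x : Euc m} (hx : x ∈ wulff ρ)
    {v : Euc m} (hv : ∀ y ∈ wulff ρ, inner ℝ v y ≤ inner ℝ v x) :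
    v = inner ℝ v x • gradient ρ x := by
  have hx0 := hρ.ne_zero_of_mem_wulff hx
  have hle : ∀ y, inner ℝ v y ≤ inner ℝ v x * ρ y := by
    intro y
    rcases eq_or_ne y 0 with rfl | hy
    · simp [hρ.map_zero]
    · have h1 := hv _ (hρ.inv_smul_mem_wulff hy)
      rwa [inner_smul_right, inv_mul_le_iff₀ (hρ.pos y hy), mul_comm] at h1
  have hder := ((hρ.differentiableAt hx0).hasFDerivAt.const_mul (inner ℝ v x)).sub
    (innerSL ℝ v).hasFDerivAt
  have hmin : IsLocalMin (fun y => inner ℝ v x * ρ y - innerSL ℝ v y) x :=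
    Eventually.of_forall fun y => by
      have h1 : ρ x = 1 := hx
      simp only [h1, innerSL_apply_apply]
      linarith [hle y]
  have h0 := sub_eq_zero.1 (hmin.hasFDerivAt_eq_zero hder)
  refine ext_inner_right ℝ fun y => ?_
  have := congrArg (fun φ => φ y) h0
  simp only [smul_apply, smul_eq_mul, innerSL_apply_apply] at this
  rw [inner_smul_left, inner_gradient_left, ← this]
  rfl

theorem gradient_ne_zero (hρ : IsC2Norm ρ) {x : Euc m} (hx : x ≠ 0) :
    gradient ρ x ≠ 0 := by
  intro h
  have := hρ.legendre_ne_zero hx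
  rw [hρ.gradient_halfSq hx, h, smul_zero] at this
  exact this rfl

/-- The unit outer normal of a translated unit sphere. -/
theorem unitOuterNormal_eq (hρ : IsC2Norm ρ) (c : Euc m) {p : Euc m}
    (hp : p - c ∈ wulff ρ) :
    ∃ t : ℝ, 0 < t ∧ unitOuterNormal {y | y - c ∈ wulff ρ} p = t • gradient ρ (p - c) := by
  set x := p - c with hx
  have hx0 := hρ.ne_zero_of_mem_wulff hp
  have hg := hρ.gradient_ne_zero hx0
  have hex : ∃ v, IsUnitOuterNormal {y | y - c ∈ wulff ρ} p v := by
    refine ⟨‖gradient ρ x‖⁻¹ • gradient ρ x, by simp [norm_smul, hg], fun y hy => ?_⟩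
    rw [inner_smul_left, inner_gradient_left]
    refine mul_nonpos_of_nonneg_of_nonpos (by simp) ?_
    have h1 : y - p = (y - c) - x := by rw [hx]; abel
    have h2 : ρ (y - c) = 1 := hy
    have h3 : ρ x = 1 := hp
    rw [h1, map_sub, hρ.fderiv_self hx0, h3, ← h2]
    linarith [hρ.fderiv_le x hx0 (y - c)]
  obtain ⟨hnorm, hle⟩ : IsUnitOuterNormal {y | y - c ∈ wulff ρ} p
      (unitOuterNormal {y | y - c ∈ wulff ρ} p) := Classical.epsilon_spec hex
  set v := unitOuterNormal {y | y - c ∈ wulff ρ} p with hv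
  have hv0 : v ≠ 0 := fun h => by simp [h] at hnorm
  have hsup : ∀ y ∈ wulff ρ, inner ℝ v y ≤ inner ℝ v x := fun y hy => by
    have h1 := hle (y + c) (by simpa using hy)
    have h2 : y + c - p = y - x := by rw [hx]; abel
    rw [h2, inner_sub_right] at h1
    linarith
  refine ⟨inner ℝ v x, ?_, hρ.fderiv_eq_of_support hp hsup⟩
  have h1 := hsup _ (hρ.inv_smul_mem_wulff hv0)
  refine lt_of_lt_of_le ?_ h1
  rw [inner_smul_right, real_inner_self_eq_norm_sq, hnorm]
  have := hρ.pos v hv0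
  positivity

theorem exists_body (hρ : IsC2Norm ρ) (c : Euc m) :
    ∃ C : Set (Euc m), Convex ℝ C ∧ IsCompact C ∧ (interior C).Nonempty ∧
      frontier C = {y | y - c ∈ wulff ρ} := by
  have hcont : Continuous fun y => ρ (y - c) := hρ.continuous.comp (continuous_id.sub continuous_const)
  have hclosed : IsClosed {y | ρ (y - c) ≤ 1} := isClosed_le hcont continuous_const
  have hopen : {y | ρ (y - c) < 1} ⊆ interior {y | ρ (y - c) ≤ 1} :=
    interior_maximal (fun y hy => show ρ (y - c) ≤ 1 from le_of_lt hy) (isOpen_lt hcont continuous_const)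
  refine ⟨{y | ρ (y - c) ≤ 1}, ?_, ?_, ⟨c, hopen (by simp [hρ.map_zero])⟩, ?_⟩
  · intro x hx y hy a b ha hb hab
    have h1 : a • x + b • y - c = a • (x - c) + b • (y - c) := by
      have : c = (a + b) • c := by rw [hab, one_smul]
      conv_lhs => rw [this]
      module
    show ρ (a • x + b • y - c) ≤ 1
    rw [h1]
    refine (hρ.subadditive _ _).trans ?_
    rw [hρ.map_smul a ha, hρ.map_smul b hb]
    have hx' : ρ (x - c) ≤ 1 := hx
    have hy' : ρ (y - c) ≤ 1 := hy
    nlinarith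
  · obtain ⟨δ, hδ, K, h⟩ := hρ.exists_bounds
    refine Metric.isCompact_of_isClosed_isBounded hclosed
      ((Metric.isBounded_closedBall (x := c) (r := δ⁻¹)).subset fun y hy => ?_)
    have h1 := (h (y - c)).1.trans hy
    rw [mem_closedBall_iff_norm]
    rwa [← one_div, le_div_iff₀ hδ, mul_comm]
  · rw [frontier, hclosed.closure_eq]
    ext y
    constructor
    · rintro ⟨h1, h2⟩
      exact le_antisymm h1 (not_lt.1 fun h => h2 (hopen h))
    · intro hy
      have hy' : ρ (y - c) = 1 := hy
      refine ⟨hy'.le, fun hint => ?_⟩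
      -- Pushing `y` outwards along its ray from `c` makes `ρ` exceed 1, so `y` cannot be interior.
      have h1 : Tendsto (fun t : ℝ => c + t • (y - c)) (𝓝[>] 1) (𝓝 y) := by
        have : Continuous fun t : ℝ => c + t • (y - c) := by fun_prop
        have h2 := this.tendsto 1
        simp only [one_smul, add_sub_cancel] at h2
        exact h2.mono_left nhdsWithin_le_nhds
      have h2 := (h1.eventually (mem_interior_iff_mem_nhds.1 hint)).and self_mem_nhdsWithin
      obtain ⟨t, ht1, ht2⟩ := h2.exists
      have ht2' : (1 : ℝ) < t := ht2
      have ht1' : ρ (c + t • (y - c) - c) ≤ 1 := ht1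
      rw [add_sub_cancel_left, hρ.map_smul t (by linarith), hy'] at ht1'
      linarith

end IsC2Norm

namespace IsC2Norm

variable {n : ℕ} {ρ : Euc (n + 1) → ℝ} {c : Euc (n + 1)} {U : Set (Euc n)}
  {X : Euc n → Euc (n + 1)}

theorem fderiv_tangent (hρ : IsC2Norm ρ)
    (hX : IsLocalParam 2 {y | y - c ∈ wulff ρ} U X) {u : Euc n} (hu : u ∈ U) (v : Euc n) :
    fderiv ℝ ρ (X u - c) (fderiv ℝ X u v) = 0 := by
  have hx0 := hρ.ne_zero_of_mem_wulff (hX.mem hu)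
  have h1 := HasFDerivAt.comp (f := fun w => X w - c) u (hρ.differentiableAt hx0).hasFDerivAt
    (((hX.contDiffAt hu).differentiableAt (by simp)).hasFDerivAt.sub_const c)
  have h2 : (ρ ∘ fun w => X w - c) =ᶠ[𝓝 u] fun _ => 1 := by
    filter_upwards [hX.isOpen.mem_nhds hu] with w hw using hX.mem hw
  have h3 := h1.unique ((hasFDerivAt_const (1 : ℝ) u).congr_of_eventuallyEq h2)
  exact congrArg (fun φ => φ v) h3

/-- Differentiating the tangency relation `Dρ(∂_l X) = 0` turns second fundamental forms, Euclidean
and anisotropic, into Hessians of `ρ`. -/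
theorem fderiv_pd_pd (hρ : IsC2Norm ρ)
    (hX : IsLocalParam 2 {y | y - c ∈ wulff ρ} U X) {u : Euc n} (hu : u ∈ U) (i l : Fin n) :
    fderiv ℝ ρ (X u - c) (pd i (pd l X) u) =
      -fderiv ℝ (fderiv ℝ ρ) (X u - c) (pd i X u) (pd l X u) := by
  have hx0 := hρ.ne_zero_of_mem_wulff (hX.mem hu)
  have hd := (contDiffAt_pd (hX.contDiffAt hu) (l := 1) (by norm_num) l).differentiableAt
    (by simp)
  have h1 := HasFDerivAt.comp (f := fun w => X w - c) (g := fderiv ℝ ρ) u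
    (hρ.differentiableAt_fderiv hx0).hasFDerivAt
    (((hX.contDiffAt hu).differentiableAt (by simp)).hasFDerivAt.sub_const c)
  have h2 := h1.clm_apply hd.hasFDerivAt
  have h3 : (fun w => (fderiv ℝ ρ ∘ fun w => X w - c) w (pd l X w)) =ᶠ[𝓝 u] fun _ => 0 := by
    filter_upwards [hX.isOpen.mem_nhds hu] with w hw using hρ.fderiv_tangent hX hw _
  have h4 := h2.unique ((hasFDerivAt_const (0 : ℝ) u).congr_of_eventuallyEq h3)
  have h5 := congrArg (fun φ => φ (EuclideanSpace.single i 1)) h4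
  simp at h5
  simp only [pd] at h5 ⊢
  linarith

end IsC2Norm

namespace IsEllipticNorm

variable {n j : ℕ} {ρ : Euc (n + 1) → ℝ} {c : Euc (n + 1)} {U : Set (Euc n)}
  {X : Euc n → Euc (n + 1)}

/-- A nonzero tangent vector is not radial, because `Dρ` kills it whereas `Dρ(x) x = 1` on the unit
sphere. -/
theorem fderiv_fderiv_tangent_pos (hρ : IsEllipticNorm j ρ)
    (hX : IsLocalParam 2 {y | y - c ∈ wulff ρ} U X) {u : Euc n} (hu : u ∈ U) {v : Euc n}
    (hv : v ≠ 0) :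
    0 < fderiv ℝ (fderiv ℝ ρ) (X u - c) (fderiv ℝ X u v) (fderiv ℝ X u v) := by
  have hx := hX.mem hu
  have hx0 := hρ.ne_zero_of_mem_wulff hx
  refine hρ.fderiv_fderiv_pos hx0 fun t ht => ?_
  have h1 := hρ.fderiv_tangent hX hu v
  rw [ht, _root_.map_smul, hρ.fderiv_self hx0, show ρ (X u - c) = 1 from hx, smul_eq_mul,
    mul_one] at h1
  rw [h1, zero_smul] at ht
  exact hv (hX.injective_fderiv u hu (by rw [ht, _root_.map_zero]))

/-- Translated unit spheres of elliptic norms are strongly convex. -/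
theorem isStronglyConvexHypersurface (hρ : IsEllipticNorm j ρ) (c : Euc (n + 1)) :
    IsStronglyConvexHypersurface {y | y - c ∈ wulff ρ} where
  exists_body := hρ.exists_body c
  isHypersurface p hp := by
    have hx0 := hρ.ne_zero_of_mem_wulff hp
    have hsm : ContDiffOn ℝ 2 ρ {x | x ≠ 0} := fun x hx => (hρ.contDiffAt_two hx).contDiffWithinAt
    obtain ⟨Z, π, hZ, -, hright⟩ := exists_radialParam (by simp) hρ.posHomogeneous hρ.pos hsm hx0
    refine ⟨univ, fun u => Z u + c, hZ.translate c, π (p - c), mem_univ _, ?_⟩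
    have h1 := hright (p - c) (by rw [real_inner_self_eq_norm_sq]; positivity)
    rw [show ρ (p - c) = 1 from hp, inv_one, one_smul] at h1
    simp [h1]
  posDef U X hX u hu := by
    obtain ⟨t, ht, hn⟩ := hρ.unitOuterNormal_eq c (hX.mem hu)
    have hx0 := hρ.ne_zero_of_mem_wulff (hX.mem hu)
    have h1 : euclideanSecondForm {y | y - c ∈ wulff ρ} X u = Matrix.of fun i l =>
        (t • fderiv ℝ (fderiv ℝ ρ) (X u - c)) (pd i X u) (pd l X u) := by
      ext i l
      rw [euclideanSecondForm, Matrix.of_apply, hn, inner_smul_left, inner_gradient_left,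
        hρ.fderiv_pd_pd hX hu]
      simp
    rw [h1]
    refine posDef_of_bilinear _ _ (fun i l => ?_) fun a ha => ?_
    · simp only [smul_apply]
      rw [isSymmSndFDerivAt_of_contDiffAt (hρ.contDiffAt_two hx0)]
    · have h2 : ∑ i, a i • pd i X u = fderiv ℝ X u (WithLp.toLp 2 a) :=
        (fderiv_eq_sum_pd X u _).symm
      rw [h2]
      exact mul_pos ht (hρ.fderiv_fderiv_tangent_pos hX hu (fun h => ha (by
        funext i; exact congrArg (fun w : Euc n => w i) h)))

end IsEllipticNorm

/-! ### Strongly convex hypersurfaces are unit spheres of elliptic norms -/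

section Cone

variable {n : ℕ} {C : Set (Euc (n + 1))} {c : Euc (n + 1)} {U : Set (Euc n)}
  {X : Euc n → Euc (n + 1)}

/-- The boundary of a convex body is transversal to the rays from an interior point. -/
theorem smul_add_fderiv_injective (hC : Convex ℝ C) (hcpt : IsCompact C) (hc : c ∈ interior C)
    (hX : IsLocalParam 2 (frontier C) U X) {u : Euc n} (hu : u ∈ U) {s : ℝ} {w : Euc n}
    (h : s • (X u - c) + fderiv ℝ X u w = 0) : s = 0 ∧ w = 0 := by
  have hXu : X u ∉ interior C := (hX.mem hu).2
  -- A supporting functional at `X u` attains its maximum over the body there, so it kills tangent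
  -- vectors; yet it is positive on `X u - c`.
  obtain ⟨f, hf⟩ := geometric_hahn_banach_open_point hC.interior isOpen_interior hXu
  have hle : ∀ y ∈ C, f y ≤ f (X u) := by
    intro y hy
    have h1 : y ∈ closure (interior C) := by
      rw [hC.closure_interior_eq_closure_of_nonempty_interior ⟨c, hc⟩]
      exact subset_closure hy
    exact closure_minimal (fun a ha => (hf a ha).le)
      (isClosed_le f.continuous continuous_const) h1
  have hd : HasFDerivAt (fun w => f (X w)) (f.comp (fderiv ℝ X u)) u :=
    f.hasFDerivAt.comp u ((hX.contDiffAt hu).differentiableAt (by simp)).hasFDerivAt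
  have hmax : IsLocalMax (fun w => f (X w)) u := by
    filter_upwards [hX.isOpen.mem_nhds hu] with w hw
    exact hle _ (hcpt.isClosed.frontier_subset (hX.mem hw))
  have h0 : f (fderiv ℝ X u w) = 0 := congrArg (fun φ => φ w) (hmax.hasFDerivAt_eq_zero hd)
  have h1 := congrArg f h
  rw [map_add, map_smul, h0, add_zero, map_zero, map_sub, smul_eq_mul] at h1
  have h2 : f (X u) - f c ≠ 0 := (sub_pos.2 (hf c hc)).ne'
  have hs : s = 0 := (mul_eq_zero.1 h1).resolve_right h2
  rw [hs, zero_smul, zero_add] at h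
  exact ⟨hs, hX.injective_fderiv u hu (by rw [h, map_zero])⟩

theorem hasFDerivAt_cone (hX : IsLocalParam 2 (frontier C) U X) {u : Euc n} (hu : u ∈ U) (t : ℝ) :
    HasFDerivAt (fun p : ℝ × Euc n => p.1 • (X p.2 - c))
      (t • (fderiv ℝ X u).comp (ContinuousLinearMap.snd ℝ ℝ (Euc n))
        + (ContinuousLinearMap.fst ℝ ℝ (Euc n)).smulRight (X u - c)) (t, u) := by
  have h1 : HasFDerivAt (fun p : ℝ × Euc n => X p.2 - c)
      ((fderiv ℝ X u).comp (ContinuousLinearMap.snd ℝ ℝ (Euc n))) (t, u) :=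
    (HasFDerivAt.comp (f := Prod.snd) (t, u)
      ((hX.contDiffAt hu).differentiableAt (by simp)).hasFDerivAt hasFDerivAt_snd).sub_const c
  exact hasFDerivAt_fst.smul h1

theorem fderiv_cone_injective (hC : Convex ℝ C) (hcpt : IsCompact C) (hc : c ∈ interior C)
    (hX : IsLocalParam 2 (frontier C) U X) {u : Euc n} (hu : u ∈ U) {t : ℝ} (ht : 0 < t) :
    Function.Injective (fderiv ℝ (fun p : ℝ × Euc n => p.1 • (X p.2 - c)) (t, u)) := by
  rw [(hasFDerivAt_cone hX hu t).fderiv, injective_iff_map_eq_zero]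
  rintro ⟨s, w⟩ h
  have h1 : s • (X u - c) + fderiv ℝ X u (t • w) = 0 := by
    rw [map_smul, add_comm (s • _)]
    simpa using h
  obtain ⟨h2, h3⟩ := smul_add_fderiv_injective hC hcpt hc hX hu h1
  rw [h2, (smul_eq_zero.1 h3).resolve_left ht.ne']
  rfl

/-- The cone map `(t, u) ↦ t (X(u) - c)` is a local diffeomorphism of class C², and in these
coordinates `ρ` is just `t`. -/
theorem contDiffAt_of_cone (hC : Convex ℝ C) (hcpt : IsCompact C) (hc : c ∈ interior C)
    (hX : IsLocalParam 2 (frontier C) U X) {u : Euc n} (hu : u ∈ U) {t : ℝ} (ht : 0 < t)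
    {ρ : Euc (n + 1) → ℝ} (hhom : PosHomogeneous ρ) (hρ : ∀ u ∈ U, ρ (X u - c) = 1) :
    ContDiffAt ℝ 2 ρ (t • (X u - c)) := by
  have hsm : ContDiffAt ℝ 2 (fun p : ℝ × Euc n => p.1 • (X p.2 - c)) (t, u) :=
    contDiffAt_fst.smul (((hX.contDiffAt hu).comp (t, u) contDiffAt_snd).sub contDiffAt_const)
  have hnhds : (Ioi 0 ×ˢ U : Set (ℝ × Euc n)) ∈ 𝓝 (t, u) :=
    (isOpen_Ioi.prod hX.isOpen).mem_nhds ⟨ht, hu⟩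
  obtain ⟨g, hg, -, hev⟩ := exists_contDiffAt_rightInverse (by simp [add_comm]) (by simp) hsm
    (fderiv_cone_injective hC hcpt hc hX hu ht) hnhds
  refine (contDiffAt_fst.comp _ hg).congr_of_eventuallyEq ?_
  filter_upwards [hev] with y ⟨⟨hy1, hy2⟩, hy3⟩
  conv_lhs => rw [← hy3]
  rw [hhom _ hy1, hρ _ hy2, mul_one]
  rfl

end Cone

/-- `ρ` is the gauge of the body about an interior point `c`. Cone coordinates make it C² off the
origin, and its Hessian on tangent vectors is a positive multiple of the second fundamental form,
hence positive. -/
theorem exists_isEllipticNorm_of_isStronglyConvexHypersurface {n : ℕ} {M : Set (Euc (n + 1))}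
    (hM : IsStronglyConvexHypersurface M) :
    ∃ (c : Euc (n + 1)) (ρ : Euc (n + 1) → ℝ), IsEllipticNorm 1 ρ ∧ M = {y | y - c ∈ wulff ρ} := by
  obtain ⟨C, hC, hcpt, ⟨c, hc⟩, rfl⟩ := hM.exists_body
  set D : Set (Euc (n + 1)) := {x | x + c ∈ C} with hD
  have hDconv : Convex ℝ D := hC.translate_preimage_left c
  have hD0 : D ∈ 𝓝 (0 : Euc (n + 1)) := by
    have h1 : ContinuousAt (fun x : Euc (n + 1) => x + c) 0 := by fun_prop
    exact h1 (by simpa using mem_interior_iff_mem_nhds.1 hc)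
  have hDabs : Absorbent ℝ D := absorbent_nhds_zero hD0
  have hDbdd : Bornology.IsVonNBounded ℝ D := by
    rw [NormedSpace.isVonNBounded_iff]
    exact ((Homeomorph.addRight c).isCompact_preimage.2 hcpt).isBounded
  set ρ := gauge D with hρ
  have hfr : ∀ x, x ∈ wulff ρ ↔ x + c ∈ frontier C := fun x => by
    have h1 : frontier D = (Homeomorph.addRight c) ⁻¹' frontier C :=
      ((Homeomorph.addRight c).preimage_frontier C).symm
    show gauge D x = 1 ↔ _
    rw [gauge_eq_one_iff_mem_frontier hDconv hD0, h1]
    rfl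
  have hMeq : frontier C = {y | y - c ∈ wulff ρ} := by
    ext y
    rw [mem_ofPred_eq, hfr, sub_add_cancel]
  have hsmul : ∀ t : ℝ, 0 ≤ t → ∀ x, ρ (t • x) = t * ρ x := fun t ht x =>
    gauge_smul_of_nonneg ht x
  have hhom : PosHomogeneous ρ := fun t ht x => hsmul t ht.le x
  have hpos : ∀ x, x ≠ 0 → 0 < ρ x := fun x hx => (gauge_pos hDabs hDbdd).2 hx
  have hcone : ∀ x, x ≠ 0 → ∃ (U : Set (Euc n)) (X : Euc n → Euc (n + 1)),
      IsLocalParam 2 (frontier C) U X ∧ ∃ u ∈ U, x = ρ x • (X u - c) := by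
    intro x hx
    have hx1 : (ρ x)⁻¹ • x ∈ wulff ρ := by
      show ρ _ = 1
      rw [hhom _ (inv_pos.2 (hpos x hx)), inv_mul_cancel₀ (hpos x hx).ne']
    obtain ⟨U, X, hX, u, hu, hXu⟩ := hM.isHypersurface _ ((hfr _).1 hx1)
    refine ⟨U, X, hX, u, hu, ?_⟩
    rw [hXu, add_sub_cancel_right, smul_smul, mul_inv_cancel₀ (hpos x hx).ne', one_smul]
  have hρX : ∀ (U : Set (Euc n)) (X : Euc n → Euc (n + 1)), IsLocalParam 2 (frontier C) U X →
      ∀ u ∈ U, ρ (X u - c) = 1 := fun U X hX u hu => by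
    have := hX.mem hu
    rwa [hMeq] at this
  have hsm : ∀ x, x ≠ 0 → ContDiffAt ℝ 2 ρ x := by
    intro x hx
    obtain ⟨U, X, hX, u, hu, hXu⟩ := hcone x hx
    rw [hXu]
    exact contDiffAt_of_cone hC hcpt hc hX hu (hpos x hx) hhom (hρX U X hX)
  have hC2 : IsC2Norm ρ :=
    { map_smul := hsmul
      pos := hpos
      contDiffOn_two := fun x hx => (hsm x hx).contDiffWithinAt
      fderiv_le := fun x hx y => fderiv_le_of_subadditive hhom (gauge_add_le hDconv hDabs)
        ((hsm x hx).differentiableAt (by simp)) y }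
  refine ⟨c, ρ, { hC2 with one_le := le_rfl, smooth := hC2.contDiffOn_two, elliptic := ?_ }, hMeq⟩
  intro x hx ξ hξ
  refine hC2.elliptic_of_fderiv_fderiv_pos hx (fun v hv => ?_) hξ
  obtain ⟨U, X, hX, u, hu, hXu⟩ := hcone x hx
  set x₁ := X u - c with hx₁
  have hX' : IsLocalParam 2 {y | y - c ∈ wulff ρ} U X := hMeq ▸ hX
  have hx₁0 : x₁ ≠ 0 := hC2.ne_zero_of_mem_wulff (hX'.mem hu)
  have hρx := hpos x hx
  obtain ⟨f', hf'⟩ := exists_continuousLinearEquiv (by simp [add_comm]) _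
    (fderiv_cone_injective hC hcpt hc hX hu zero_lt_one)
  -- The derivative of the cone map at `(1, u)` is bijective and splits `v` into a radial part,
  -- invisible to the Hessian, and a tangential part, nonzero since `v` is not radial.
  obtain ⟨s, w, hsw⟩ : ∃ s w, v = s • x₁ + fderiv ℝ X u w := by
    refine ⟨(f'.symm v).1, (f'.symm v).2, ?_⟩
    have h1 : f' (f'.symm v) = v := f'.apply_symm_apply v
    have h2 : f' (f'.symm v) = (f' : ℝ × Euc n →L[ℝ] Euc (n + 1)) (f'.symm v) := rfl
    rw [h2, hf', (hasFDerivAt_cone hX hu 1).fderiv] at h1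
    conv_lhs => rw [← h1]
    simp [add_comm, hx₁]
  have hw : w ≠ 0 := by
    rintro rfl
    refine hv (s * (ρ x)⁻¹) ?_
    rw [hsw, map_zero, add_zero, hXu, hhom _ hρx, hρX U X hX u hu, mul_one, smul_smul,
      inv_mul_cancel_right₀ hρx.ne']
  rw [hXu, hhom.fderiv_fderiv_smul hρx]
  have hker : fderiv ℝ (fderiv ℝ ρ) x₁ x₁ = 0 :=
    hhom.fderiv_fderiv_self (hC2.differentiableAt_fderiv hx₁0)
  have hker' : ∀ v, fderiv ℝ (fderiv ℝ ρ) x₁ v x₁ = 0 := fun v => by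
    rw [isSymmSndFDerivAt_of_contDiffAt (hsm x₁ hx₁0), hker]
    rfl
  have hred : fderiv ℝ (fderiv ℝ ρ) x₁ v v =
      fderiv ℝ (fderiv ℝ ρ) x₁ (fderiv ℝ X u w) (fderiv ℝ X u w) := by
    rw [hsw]
    simp [hker, hker']
  rw [smul_apply, smul_apply, smul_eq_mul, hred]
  refine mul_pos (inv_pos.2 hρx) ?_
  obtain ⟨t, ht, hn⟩ := hC2.unitOuterNormal_eq c (hX'.mem hu)
  have hpd := (hM.posDef U X hX u hu).dotProduct_mulVec_pos (x := (w : Fin n → ℝ))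
    (fun h => hw (by ext i; exact congrFun h i))
  have hform : euclideanSecondForm (frontier C) X u = Matrix.of fun i l =>
      (t • fderiv ℝ (fderiv ℝ ρ) x₁) (pd i X u) (pd l X u) := by
    ext i l
    rw [euclideanSecondForm, Matrix.of_apply, hMeq, hn, inner_smul_left, inner_gradient_left,
      hC2.fderiv_pd_pd hX' hu]
    simp [hx₁]
  have h2 := bilinear_fderiv_eq_sum (t • fderiv ℝ (fderiv ℝ ρ) x₁) X u w w
  have h3 : star (w : Fin n → ℝ) ⬝ᵥ
      (euclideanSecondForm (frontier C) X u).mulVec (w : Fin n → ℝ) =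
      (t • fderiv ℝ (fderiv ℝ ρ) x₁) (fderiv ℝ X u w) (fderiv ℝ X u w) := by
    rw [h2, hform]
    simp only [dotProduct, Matrix.mulVec, Matrix.of_apply, Finset.mul_sum, star_trivial]
    exact Finset.sum_congr rfl fun i _ => Finset.sum_congr rfl fun l _ => by simp; ring
  rw [h3] at hpd
  exact (pos_iff_pos_of_mul_pos hpd).1 ht

/-! ### Matrices -/

section Matrices

open Polynomial

variable {n : ℕ}

/-- The orthogonal matrix that diagonalizes `A` diagonalizes its inverse `H` as well, with inverse
eigenvalues. -/
theorem roots_charpoly_of_mul_eq_one {A H : Matrix (Fin n) (Fin n) ℝ} (hA : A.IsHermitian)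
    (hHA : H * A = 1) : A.charpoly.roots = H.charpoly.roots.map fun κ => κ⁻¹ := by
  set Λ := Matrix.diagonal (hA.eigenvalues) with hΛ
  set U : Matrix (Fin n) (Fin n) ℝ := hA.eigenvectorUnitary.1 with hU
  have hUU : star U * U = 1 := Unitary.coe_star_mul_self hA.eigenvectorUnitary
  have hUU' : U * star U = 1 := Unitary.coe_mul_star_self hA.eigenvectorUnitary
  have hspec : A = U * Λ * star U := by
    have := hA.spectral_theorem
    rw [Unitary.conjStarAlgAut_apply] at this
    exact this
  have hne : ∀ i, hA.eigenvalues i ≠ 0 := by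
    intro i hi
    have h1 := congrArg Matrix.det hHA
    rw [Matrix.det_mul, Matrix.det_one, hA.det_eq_prod_eigenvalues,
      Finset.prod_eq_zero (Finset.mem_univ i) (by simp [hi]), mul_zero] at h1
    exact zero_ne_one h1
  set Λ' := Matrix.diagonal (fun i => (hA.eigenvalues i)⁻¹) with hΛ'
  have hΛΛ : Λ * Λ' = 1 := by
    rw [hΛ, hΛ', Matrix.diagonal_mul_diagonal, ← Matrix.diagonal_one]
    congr 1
    funext i
    exact mul_inv_cancel₀ (hne i)
  have hH : H = U * Λ' * star U := by
    have h1 : A * (U * Λ' * star U) = 1 := by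
      rw [hspec]
      calc U * Λ * star U * (U * Λ' * star U)
          = U * (Λ * (star U * U) * Λ') * star U := by simp only [Matrix.mul_assoc]
        _ = 1 := by rw [hUU, Matrix.mul_one, hΛΛ, Matrix.mul_one, hUU']
    calc H = H * (A * (U * Λ' * star U)) := by rw [h1, Matrix.mul_one]
      _ = U * Λ' * star U := by rw [← Matrix.mul_assoc, hHA, Matrix.one_mul]
  have hroots : H.charpoly.roots =
      Multiset.map (fun i => (hA.eigenvalues i)⁻¹) Finset.univ.val := by
    rw [hH, Matrix.charpoly_mul_comm, ← Matrix.mul_assoc, hUU, Matrix.one_mul,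
      Matrix.charpoly_diagonal, Polynomial.roots_prod]
    · simp
    · simp [Finset.prod_ne_zero_iff, Polynomial.X_sub_C_ne_zero]
  rw [hroots, hA.roots_charpoly_eq_eigenvalues, Multiset.map_map]
  exact Multiset.map_congr rfl fun i _ => by simp

/-- `B` is the change from an orthonormal frame to a coordinate frame, `P` the metric and `R` the
second form; then `P⁻¹ R` is conjugate to `H` by `Bᵀ`. -/
theorem roots_charpoly_and_det {A H B P R : Matrix (Fin n) (Fin n) ℝ} (hA : A.IsHermitian)
    (hHA : H * A = 1) (hP : P = B * B.transpose) (hR : R = B * H * B.transpose)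
    (hB : IsUnit B.det) :
    A.charpoly.roots = (P⁻¹ * R).charpoly.roots.map (fun κ => κ⁻¹) ∧
      A.det = 1 / (P⁻¹ * R).det := by
  have hBt : IsUnit B.transpose.det := by rwa [Matrix.det_transpose]
  have h1 : P⁻¹ * R = B.transpose⁻¹ * (H * B.transpose) := by
    rw [hP, hR, Matrix.mul_inv_rev, Matrix.mul_assoc B, Matrix.mul_assoc,
      ← Matrix.mul_assoc B⁻¹, Matrix.nonsing_inv_mul _ hB, Matrix.one_mul]
  have h2 : (P⁻¹ * R).charpoly = H.charpoly := by
    rw [h1, Matrix.charpoly_mul_comm, Matrix.mul_assoc, Matrix.mul_nonsing_inv _ hBt,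
      Matrix.mul_one]
  have h3 : (P⁻¹ * R).det = H.det := by
    rw [h1, Matrix.det_mul_comm, Matrix.mul_assoc, Matrix.mul_nonsing_inv _ hBt, Matrix.mul_one]
  have h4 : H.det * A.det = 1 := by rw [← Matrix.det_mul, hHA, Matrix.det_one]
  refine ⟨by rw [h2]; exact roots_charpoly_of_mul_eq_one hA hHA, ?_⟩
  rw [h3]
  exact eq_one_div_of_mul_eq_one_right h4

open scoped MatrixOrder Matrix.Norms.L2Operator in
theorem exists_transpose_mul_mul_eq_one {P : Matrix (Fin n) (Fin n) ℝ} (hP : P.PosDef) :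
    ∃ A : Matrix (Fin n) (Fin n) ℝ, A.transpose * P * A = 1 := by
  obtain ⟨y, hy, rfl⟩ := CStarAlgebra.isStrictlyPositive_iff_eq_star_mul_self.mp
    hP.isStrictlyPositive
  have hdet : IsUnit y.det := (Matrix.isUnit_iff_isUnit_det y).1 hy
  refine ⟨y⁻¹, ?_⟩
  have h1 : star y = y.transpose := by
    ext i j
    simp [Matrix.star_apply]
  rw [h1, Matrix.transpose_nonsing_inv, Matrix.mul_assoc, Matrix.mul_assoc,
    Matrix.mul_nonsing_inv _ hdet, Matrix.mul_one, Matrix.nonsing_inv_mul _ (by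
      rwa [Matrix.det_transpose])]

end Matrices

/-! ### Duality of gradients -/

namespace IsEllipticNorm

variable {m j : ℕ} {F : Euc m → ℝ}

theorem legendre_eq_gradient (hF : IsEllipticNorm j F) {z : Euc m} (hz : z ∈ wulff F) :
    gradient (halfSq F) z = gradient F z := by
  rw [hF.gradient_halfSq (hF.ne_zero_of_mem_wulff hz), show F z = 1 from hz, one_smul]

theorem gradient_dualNorm_mem_wulff (hF : IsEllipticNorm j F) {ξ : Euc m} (hξ : ξ ≠ 0) :
    gradient (dualNorm F) ξ ∈ wulff F := by
  obtain ⟨x, hx, rfl⟩ := hF.exists_legendre_eq hξ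
  rw [hF.gradient_dualNorm_legendre hx]
  exact hF.inv_smul_mem_wulff hx

theorem gradient_dualNorm_gradient (hF : IsEllipticNorm j F) {x : Euc m} (hx : x ≠ 0) :
    gradient (dualNorm F) (gradient F x) = (F x)⁻¹ • x := by
  have h1 := hF.gradient_dualNorm_legendre hx
  rwa [hF.gradient_halfSq hx, hF.dual.posHomogeneous.gradient_smul (hF.pos x hx)] at h1

theorem gradient_dualNorm_legendre_wulff (hF : IsEllipticNorm j F) {z : Euc m}
    (hz : z ∈ wulff F) : gradient (dualNorm F) (gradient (halfSq F) z) = z := by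
  rw [hF.gradient_dualNorm_legendre (hF.ne_zero_of_mem_wulff hz), show F z = 1 from hz, inv_one,
    one_smul]

theorem gradient_gradient_dualNorm (hF : IsEllipticNorm j F) {ξ : Euc m} (hξ : ξ ≠ 0) :
    gradient F (gradient (dualNorm F) ξ) = (dualNorm F ξ)⁻¹ • ξ := by
  have h := hF.dual.gradient_dualNorm_gradient hξ
  rwa [hF.dualNorm_dualNorm] at h

/-- The Hessians of a norm and of its dual are inverse to each other on tangent vectors. -/
theorem fderiv_fderiv_dualNorm_apply (hF : IsEllipticNorm j F) {ξ : Euc m} (hξ : ξ ≠ 0)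
    {v : Euc m} (hv : fderiv ℝ F (gradient (dualNorm F) ξ) v = 0) (η : Euc m) :
    fderiv ℝ (fderiv ℝ (dualNorm F)) ξ
      (dualNorm F ξ • fderiv ℝ (gradient F) (gradient (dualNorm F) ξ) v) η = inner ℝ v η := by
  set x := gradient (dualNorm F) ξ with hx
  have hxW : x ∈ wulff F := hF.gradient_dualNorm_mem_wulff hξ
  have hx0 : x ≠ 0 := hF.ne_zero_of_mem_wulff hxW
  have hσ := hF.dual.pos ξ hξ
  set σ := dualNorm F ξ with hσdef
  have hgx : gradient F x = σ⁻¹ • ξ := hF.gradient_gradient_dualNorm hξ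
  have hξ' : ξ = σ • gradient F x := by rw [hgx, smul_smul, mul_inv_cancel₀ hσ.ne', one_smul]
  have hg0 : gradient F x ≠ 0 := hF.gradient_ne_zero hx0
  have hdg : HasFDerivAt (gradient F) (fderiv ℝ (gradient F) x) x :=
    (hasFDerivAt_gradient (hF.differentiableAt_fderiv hx0)).differentiableAt.hasFDerivAt
  have hdd := hF.dual.differentiableAt_fderiv hg0
  have hcomp := HasFDerivAt.comp (f := gradient F) x
    (hasFDerivAt_gradient hdd).differentiableAt.hasFDerivAt hdg
  have hright := ((hasDerivAt_inv (hF.pos x hx0).ne').comp_hasFDerivAt x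
    (hF.differentiableAt hx0).hasFDerivAt).smul (hasFDerivAt_id x)
  -- Differentiate `DF⁰(DF(y)) = y / F(y)` at a point with `F = 1`: in a direction killed by `DF`
  -- the factor `1 / F` does not contribute.
  have heq : gradient (dualNorm F) ∘ gradient F =ᶠ[𝓝 x] fun y => (F y)⁻¹ • id y := by
    filter_upwards [isOpen_ne_zero.mem_nhds hx0] with y hy using hF.gradient_dualNorm_gradient hy
  have h1 := congrArg (fun φ => φ v) (hcomp.unique (hright.congr_of_eventuallyEq heq))
  have h2 : fderiv ℝ (gradient (dualNorm F)) (gradient F x) (fderiv ℝ (gradient F) x v) = v := by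
    have hF1 : F x = 1 := hxW
    simpa [hv, hF1] using h1
  conv_lhs => rw [hξ']
  rw [hF.dual.posHomogeneous.fderiv_fderiv_smul hσ]
  simp only [_root_.map_smul, smul_apply]
  rw [smul_smul, mul_inv_cancel₀ hσ.ne', one_smul, ← inner_fderiv_gradient hdd, h2]

end IsEllipticNorm

/-! ### The anisotropic Gauss map and support function of a unit sphere -/

theorem IsLocalParam.congr {n : ℕ} {k : WithTop ℕ∞} {M : Set (Euc (n + 1))} {U : Set (Euc n)}
    {X Y : Euc n → Euc (n + 1)} (h : IsLocalParam k M U X) (hXY : EqOn Y X U) :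
    IsLocalParam k M U Y where
  isOpen := h.isOpen
  contDiffOn := h.contDiffOn.congr hXY
  injective_fderiv u hu := by
    have : Y =ᶠ[𝓝 u] X := hXY.eventuallyEq_of_mem (h.isOpen.mem_nhds hu)
    rw [this.fderiv_eq]
    exact h.injective_fderiv u hu
  isEmbedding := by
    have : U.domRestrict Y = U.domRestrict X := funext fun u => hXY u.2
    rw [this]
    exact h.isEmbedding
  image_eq := by
    rw [hXY.image_eq]
    exact h.image_eq

section GaussMap

variable {m i j : ℕ} {F ρ : Euc m → ℝ}

theorem gaussMap_eq (hF : IsEllipticNorm i F) (hρ : IsEllipticNorm j ρ) (c : Euc m) {p : Euc m}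
    (hp : p - c ∈ wulff ρ) :
    gaussMap F {y | y - c ∈ wulff ρ} p = gradient (dualNorm F) (gradient ρ (p - c)) := by
  obtain ⟨t, ht, hn⟩ := hρ.unitOuterNormal_eq c hp
  rw [gaussMap, hn, hF.dual.posHomogeneous.gradient_smul ht]

theorem mem_of_wulff (hF : IsEllipticNorm i F) (hρ : IsEllipticNorm j ρ) (c : Euc m) {z : Euc m}
    (hz : z ∈ wulff F) :
    c + gradient (dualNorm ρ) (gradient (halfSq F) z) ∈ {y | y - c ∈ wulff ρ} := by
  rw [mem_ofPred_eq, add_sub_cancel_left]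
  exact hρ.gradient_dualNorm_mem_wulff (hF.legendre_ne_zero (hF.ne_zero_of_mem_wulff hz))

theorem gaussMap_right (hF : IsEllipticNorm i F) (hρ : IsEllipticNorm j ρ) (c : Euc m) {z : Euc m}
    (hz : z ∈ wulff F) :
    gaussMap F {y | y - c ∈ wulff ρ}
      (c + gradient (dualNorm ρ) (gradient (halfSq F) z)) = z := by
  have hξ := hF.legendre_ne_zero (hF.ne_zero_of_mem_wulff hz)
  rw [gaussMap_eq hF hρ c (mem_of_wulff hF hρ c hz), add_sub_cancel_left,
    hρ.gradient_gradient_dualNorm hξ,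
    hF.dual.posHomogeneous.gradient_smul (inv_pos.2 (hρ.dual.pos _ hξ)),
    hF.gradient_dualNorm_legendre_wulff hz]

/-- `DF⁰` and `ℓ` are mutually inverse up to positive factors, and so are `Dρ` and `Dρ⁰`. The
factors disappear because these gradients are 0-homogeneous. -/
theorem gaussMap_left (hF : IsEllipticNorm i F) (hρ : IsEllipticNorm j ρ) (c : Euc m) {p : Euc m}
    (hp : p - c ∈ wulff ρ) :
    c + gradient (dualNorm ρ) (gradient (halfSq F) (gaussMap F {y | y - c ∈ wulff ρ} p)) = p := by
  have hx0 := hρ.ne_zero_of_mem_wulff hp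
  have hg0 := hρ.gradient_ne_zero hx0
  rw [gaussMap_eq hF hρ c hp, hF.legendre_eq_gradient (hF.gradient_dualNorm_mem_wulff hg0),
    hF.gradient_gradient_dualNorm hg0,
    hρ.dual.posHomogeneous.gradient_smul (inv_pos.2 (hF.dual.pos _ hg0)),
    hρ.gradient_dualNorm_gradient hx0, show ρ (p - c) = 1 from hp, inv_one, one_smul]
  abel

theorem bijOn_gaussMap (hF : IsEllipticNorm i F) (hρ : IsEllipticNorm j ρ) (c : Euc m) :
    BijOn (gaussMap F {y | y - c ∈ wulff ρ}) {y | y - c ∈ wulff ρ} (wulff F) := by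
  refine ⟨fun p hp => ?_, fun p hp q hq hpq => ?_, fun z hz =>
    ⟨_, mem_of_wulff hF hρ c hz, gaussMap_right hF hρ c hz⟩⟩
  · rw [gaussMap_eq hF hρ c hp]
    exact hF.gradient_dualNorm_mem_wulff (hρ.gradient_ne_zero (hρ.ne_zero_of_mem_wulff hp))
  · rw [← gaussMap_left hF hρ c hp, hpq, gaussMap_left hF hρ c hq]

theorem inverseGaussMap_eq (hF : IsEllipticNorm i F) (hρ : IsEllipticNorm j ρ) (c : Euc m)
    {z : Euc m} (hz : z ∈ wulff F) :
    inverseGaussMap F {y | y - c ∈ wulff ρ} z =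
      c + gradient (dualNorm ρ) (gradient (halfSq F) z) := by
  have h := (bijOn_gaussMap hF hρ c).injOn.leftInvOn_invFunOn (mem_of_wulff hF hρ c hz)
  rwa [gaussMap_right hF hρ c hz] at h

theorem G_gradient_dualNorm (hF : IsEllipticNorm i F) (hρ : IsEllipticNorm j ρ) (c : Euc m)
    {z : Euc m} (hz : z ∈ wulff F) :
    G F z z (c + gradient (dualNorm ρ) (gradient (halfSq F) z)) =
      dualNorm ρ (gradient (halfSq F) z) + inner ℝ c (gradient (halfSq F) z) := by
  have hz0 := hF.ne_zero_of_mem_wulff hz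
  rw [← hF.inner_legendre hz0, inner_add_right, add_comm, real_inner_comm, inner_gradient_left,
    hρ.dual.fderiv_self (hF.legendre_ne_zero hz0), real_inner_comm]

/-- As `G(z)(z, y) = ⟨ℓ(z), y⟩`, this is the Euclidean support function at `ℓ(z)`; the supremum is
attained at the preimage of `z` under the Gauss map. -/
theorem supportFunction_eq (hF : IsEllipticNorm i F) (hρ : IsEllipticNorm j ρ) (c : Euc m)
    {z : Euc m} (hz : z ∈ wulff F) :
    supportFunction F {y | y - c ∈ wulff ρ} z =
      dualNorm ρ (gradient (halfSq F) z) + inner ℝ c (gradient (halfSq F) z) := by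
  refine IsGreatest.csSup_eq ⟨⟨_, mem_of_wulff hF hρ c hz, G_gradient_dualNorm hF hρ c hz⟩, ?_⟩
  rintro _ ⟨y, hy, rfl⟩
  show G F z z y ≤ _
  have h1 := hρ.inner_le_mul_dualNorm (y - c) (gradient (halfSq F) z)
  rw [show ρ (y - c) = 1 from hy, one_mul, inner_sub_left] at h1
  rw [← hF.inner_legendre (hF.ne_zero_of_mem_wulff hz), real_inner_comm]
  linarith

/-- The Euclidean support function of the unit sphere of `ρ` with centre `c`. -/
theorem contDiffOn_support (hρ : IsEllipticNorm j ρ) (c : Euc m) :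
    ContDiffOn ℝ 2 (fun ξ => dualNorm ρ ξ + inner ℝ c ξ) {ξ | ξ ≠ 0} :=
  hρ.dual.contDiffOn_two.add (innerSL ℝ c).contDiff.contDiffOn

theorem posHomogeneous_support (hρ : IsEllipticNorm j ρ) (c : Euc m) :
    PosHomogeneous (fun ξ => dualNorm ρ ξ + inner ℝ c ξ) := fun t ht ξ => by
  simp only [hρ.dual.posHomogeneous t ht ξ, inner_smul_right]
  ring

theorem fderiv_fderiv_add_inner {h : Euc m → ℝ} (hh : ContDiffOn ℝ 2 h {ξ | ξ ≠ 0}) (c : Euc m)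
    {ξ : Euc m} (hξ : ξ ≠ 0) :
    fderiv ℝ (fderiv ℝ (fun ξ => h ξ + inner ℝ c ξ)) ξ = fderiv ℝ (fderiv ℝ h) ξ := by
  have h1 : fderiv ℝ (fun ξ => h ξ + inner ℝ c ξ) =ᶠ[𝓝 ξ]
      fun η => fderiv ℝ h η + innerSL ℝ c := by
    filter_upwards [isOpen_ne_zero.mem_nhds hξ] with η hη
    exact (((hh.contDiffAt (isOpen_ne_zero.mem_nhds hη)).differentiableAt
      (by simp)).hasFDerivAt.add (innerSL ℝ c).hasFDerivAt).fderiv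
  rw [h1.fderiv_eq, fderiv_add_const]

end GaussMap

/-! ### The inverse Gauss map as a regular parametrization -/

section Parametrization

variable {n i j : ℕ} {F ρ : Euc (n + 1) → ℝ} {V : Set (Euc n)} {Z : Euc n → Euc (n + 1)}
  {k : WithTop ℕ∞}

/-- `Dℓ(z)` is injective and sends `z` to `ℓ(z)`, so it carries non-radial vectors to non-radial
ones. This makes the Hessian of `ρ⁰` positive on the images of tangent vectors. -/
theorem fderiv_legendre_tangent_ne (hF : IsEllipticNorm i F) (hZ : IsLocalParam k (wulff F) V Z)
    (hk : k ≠ 0) {u : Euc n} (hu : u ∈ V) {v : Euc n} (hv : fderiv ℝ Z u v ≠ 0) (t : ℝ) :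
    fderiv ℝ (gradient (halfSq F)) (Z u) (fderiv ℝ Z u v) ≠ t • gradient (halfSq F) (Z u) := by
  intro h
  have hz := hZ.mem hu
  have hz0 := hF.ne_zero_of_mem_wulff hz
  rw [← hF.fderiv_legendre_self hz0, ← map_smul] at h
  have h1 := hF.fderiv_legendre_injective hz0 h
  have h2 := hF.G_self_fderiv hZ hk hu v
  rw [h1, hF.G_self_left hz0, map_smul, hF.fderiv_self hz0, show F (Z u) = 1 from hz] at h2
  simp at h2
  rw [h2, zero_smul] at h1
  exact hv h1

theorem isLocalParam_inverseGaussMap (hF : IsEllipticNorm i F) (hρ : IsEllipticNorm j ρ)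
    (c : Euc (n + 1)) (hZ : IsLocalParam ∞ (wulff F) V Z) :
    IsLocalParam 1 {y | y - c ∈ wulff ρ} V
      (fun u => inverseGaussMap F {y | y - c ∈ wulff ρ} (Z u)) := by
  have hsm : ∀ z, z ≠ 0 →
      ContDiffAt ℝ 1 (fun z => c + gradient (dualNorm ρ) (gradient (halfSq F) z)) z := by
    intro z hz
    have h1 : ContDiffAt ℝ 1 (gradient (halfSq F)) z :=
      contDiffAt_gradient (hF.contDiffAt_halfSq_two hz) (by norm_num)
    have h2 : ContDiffAt ℝ 1 (gradient (dualNorm ρ)) (gradient (halfSq F) z) :=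
      contDiffAt_gradient (hρ.dual.contDiffAt_two (hF.legendre_ne_zero hz)) (by norm_num)
    exact contDiffAt_const.add (h2.comp z h1)
  suffices h : IsLocalParam 1 {y | y - c ∈ wulff ρ} V
      (fun u => c + gradient (dualNorm ρ) (gradient (halfSq F) (Z u))) from
    h.congr fun u hu => inverseGaussMap_eq hF hρ c (hZ.mem hu)
  have hZ1 : ∀ u ∈ V, ContDiffAt ℝ 1 Z u := fun u hu =>
    (hZ.contDiffAt hu).of_le ENat.LEInfty.out
  set Φ : Euc (n + 1) → Euc (n + 1) := fun z =>
    c + gradient (dualNorm ρ) (gradient (halfSq F) z) with hΦ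
  have hΦcont : ContinuousOn Φ (wulff F) := fun z hz =>
    (hsm z (hF.ne_zero_of_mem_wulff hz)).continuousAt.continuousWithinAt
  have hΦinj : InjOn Φ (wulff F) := fun z hz w hw hzw => by
    rw [← gaussMap_right hF hρ c hz, ← gaussMap_right hF hρ c hw]
    exact congrArg _ hzw
  refine ⟨hZ.isOpen, fun u hu => ?_, fun u hu => ?_, ?_, ?_⟩
  · exact ((hsm _ (hF.ne_zero_of_mem_wulff (hZ.mem hu))).comp u (hZ1 u hu)).contDiffWithinAt
  · have hz0 := hF.ne_zero_of_mem_wulff (hZ.mem hu)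
    have hξ := hF.legendre_ne_zero hz0
    have hdd := hρ.dual.differentiableAt_fderiv hξ
    have h1 := HasFDerivAt.comp (f := Z) u (hF.differentiableAt_legendre hz0).hasFDerivAt
      ((hZ1 u hu).differentiableAt (by simp)).hasFDerivAt
    have h2 := (HasFDerivAt.comp (f := gradient (halfSq F) ∘ Z) u
      (hasFDerivAt_gradient hdd).differentiableAt.hasFDerivAt h1).const_add c
    have h3 : HasFDerivAt (fun u => c + gradient (dualNorm ρ) (gradient (halfSq F) (Z u))) _ u := h2
    rw [h3.fderiv, injective_iff_map_eq_zero]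
    intro v hv
    by_contra hv0
    have hne : fderiv ℝ Z u v ≠ 0 := fun h =>
      hv0 (hZ.injective_fderiv u hu (by rw [h, map_zero]))
    have h4 := hρ.dual.fderiv_fderiv_pos hξ
      (fderiv_legendre_tangent_ne hF hZ (by simp) hu hne)
    rw [← inner_fderiv_gradient hdd] at h4
    have h5 : fderiv ℝ (gradient (dualNorm ρ)) (gradient (halfSq F) (Z u))
      (fderiv ℝ (gradient (halfSq F)) (Z u) (fderiv ℝ Z u v)) = 0 := hv
    rw [h5, inner_zero_left] at h4
    exact lt_irrefl _ h4
  -- A continuous injection of the compact Wulff shape is an embedding, and the chart `Z` is one as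
  -- well.
  · have : CompactSpace (wulff F) := isCompact_iff_compactSpace.1 hF.isCompact_wulff
    have h1 : Topology.IsEmbedding ((wulff F).domRestrict Φ) :=
      (hΦcont.domRestrict.isClosedEmbedding
        (injOn_iff_injective.1 hΦinj)).isEmbedding
    have hmem : ∀ u : V, V.domRestrict Z u ∈ wulff F := fun u => hZ.mem u.2
    have h2 : Topology.IsEmbedding (codRestrict (V.domRestrict Z) (wulff F) hmem) :=
      hZ.isEmbedding.codRestrict (wulff F) hmem
    have h3 : (wulff F).domRestrict Φ ∘ codRestrict (V.domRestrict Z) (wulff F) hmem =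
        V.domRestrict fun u => Φ (Z u) := by
      funext u
      rfl
    rw [← h3]
    exact h1.comp h2
  -- If `O` cuts `Z(V)` out of the Wulff shape, then the complement of the compact set `Φ(wulff F \
  -- O)` cuts the image out of `M`.
  · obtain ⟨O, hO, hZO⟩ := hZ.image_eq
    have hcpt : IsCompact (Φ '' (wulff F \ O)) :=
      (hF.isCompact_wulff.diff hO).image_of_continuousOn (hΦcont.mono sdiff_subset)
    refine ⟨(Φ '' (wulff F \ O))ᶜ, hcpt.isClosed.isOpen_compl, ?_⟩
    ext y
    constructor
    · rintro ⟨u, hu, rfl⟩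
      refine ⟨mem_of_wulff hF hρ c (hZ.mem hu), ?_⟩
      rintro ⟨w, ⟨hw, hwO⟩, hwu⟩
      have h1 := hΦinj hw (hZ.mem hu) hwu
      have h2 : Z u ∈ wulff F ∩ O := hZO ▸ mem_image_of_mem Z hu
      exact hwO (h1 ▸ h2.2)
    · rintro ⟨hy, hyO⟩
      have hgy := (bijOn_gaussMap hF hρ c).mapsTo hy
      have hy' := gaussMap_left hF hρ c hy
      have hgO : gaussMap F {y | y - c ∈ wulff ρ} y ∈ O := by
        by_contra hne
        exact hyO ⟨_, ⟨hgy, hne⟩, hy'⟩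
      have h3 : gaussMap F {y | y - c ∈ wulff ρ} y ∈ Z '' V := hZO ▸ ⟨hgy, hgO⟩
      obtain ⟨u, hu, hZu⟩ := h3
      exact ⟨u, hu, by rw [← hZu] at hy'; exact hy'⟩

end Parametrization

/-! ### Principal radii -/

theorem bilinear_apply_eq_mul_mul_transpose {n : ℕ} {W : Type*} [NormedAddCommGroup W]
    [NormedSpace ℝ W] (T : W →L[ℝ] W →L[ℝ] ℝ) {e f : Fin n → W} {B : Matrix (Fin n) (Fin n) ℝ}
    (hf : ∀ i, f i = ∑ k, B i k • e k) (i l : Fin n) :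
    T (f i) (f l) = (B * (Matrix.of fun p q => T (e p) (e q)) * B.transpose) i l := by
  simp only [hf, map_sum, map_smul, sum_apply, smul_apply, smul_eq_mul, Matrix.mul_apply,
    Matrix.transpose_apply, Matrix.of_apply]
  exact Finset.sum_congr rfl fun q _ => mul_comm _ _

section Radii

variable {n j : ℕ} {F ρ : Euc (n + 1) → ℝ} {V : Set (Euc n)} {Z : Euc n → Euc (n + 1)}

theorem IsOrthonormalFrame.sum_ne_zero {u : Euc n} {a : Fin n → Euc n}
    (ha : IsOrthonormalFrame F Z u a) {b : Fin n → ℝ} (hb : b ≠ 0) :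
    fderiv ℝ Z u (∑ i, b i • a i) ≠ 0 := by
  intro h
  refine hb (funext fun l => ?_)
  have h1 : G F (Z u) (fderiv ℝ Z u (∑ i, b i • a i)) (fderiv ℝ Z u (a l)) = b l := by
    have h2 : G F (Z u) (fderiv ℝ Z u (∑ i, b i • a i)) (fderiv ℝ Z u (a l)) =
        ∑ i, b i * G F (Z u) (fderiv ℝ Z u (a i)) (fderiv ℝ Z u (a l)) := by
      simp [G]
    rw [h2]
    simp [ha _ l]
  rw [← h1, h]
  simp [G]

/-- The centre `c` enters the support function only through a linear term, which has no Hessian. -/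
theorem supportMatrix_eq (hF : IsEllipticNorm 2 F) (hρ : IsEllipticNorm j ρ) (c : Euc (n + 1))
    (hZ : IsLocalParam ∞ (wulff F) V Z) {u : Euc n} (hu : u ∈ V) {a : Fin n → Euc n}
    (ha : IsOrthonormalFrame F Z u a) :
    supportMatrix F (supportFunction F {y | y - c ∈ wulff ρ}) Z u a = Matrix.of fun p q =>
      fderiv ℝ (fderiv ℝ (dualNorm ρ)) (gradient (halfSq F) (Z u))
        (fderiv ℝ (gradient (halfSq F)) (Z u) (fderiv ℝ Z u (a p)))
        (fderiv ℝ (gradient (halfSq F)) (Z u) (fderiv ℝ Z u (a q))) := by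
  ext p q
  rw [hF.supportMatrix_apply (contDiffOn_support hρ c) (posHomogeneous_support hρ c)
    (fun z hz => supportFunction_eq hF hρ c hz) hZ ENat.LEInfty.out hu ha,
    fderiv_fderiv_add_inner hρ.dual.contDiffOn_two c
      (hF.legendre_ne_zero (hF.ne_zero_of_mem_wulff (hZ.mem hu)))]
  rfl

theorem posDef_supportMatrix (hF : IsEllipticNorm 2 F) (hρ : IsEllipticNorm j ρ)
    (c : Euc (n + 1)) (hZ : IsLocalParam ∞ (wulff F) V Z) {u : Euc n} (hu : u ∈ V)
    {a : Fin n → Euc n} (ha : IsOrthonormalFrame F Z u a) :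
    (supportMatrix F (supportFunction F {y | y - c ∈ wulff ρ}) Z u a).PosDef := by
  have hξ := hF.legendre_ne_zero (hF.ne_zero_of_mem_wulff (hZ.mem hu))
  rw [supportMatrix_eq hF hρ c hZ hu ha]
  refine posDef_of_bilinear _ _
    (fun p q => isSymmSndFDerivAt_of_contDiffAt (hρ.dual.contDiffAt_two hξ) _ _) fun b hb => ?_
  have h1 : ∑ i, b i • fderiv ℝ (gradient (halfSq F)) (Z u) (fderiv ℝ Z u (a i)) =
      fderiv ℝ (gradient (halfSq F)) (Z u) (fderiv ℝ Z u (∑ i, b i • a i)) := by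
    simp only [map_sum, map_smul]
  rw [h1]
  exact hρ.dual.fderiv_fderiv_pos hξ
    (fderiv_legendre_tangent_ne hF hZ (by simp) hu (ha.sum_ne_zero hb))

theorem fderiv_comm_dual (hF : IsEllipticNorm 2 F) (hρ : IsEllipticNorm j ρ) {z : Euc (n + 1)}
    (hz : z ∈ wulff F) (v : Euc (n + 1)) :
    fderiv ℝ ρ (gradient (dualNorm ρ) (gradient (halfSq F) z)) v =
      (dualNorm ρ (gradient (halfSq F) z))⁻¹ * G F z z v := by
  have hz0 := hF.ne_zero_of_mem_wulff hz
  rw [← inner_gradient_left, hρ.gradient_gradient_dualNorm (hF.legendre_ne_zero hz0),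
    inner_smul_left, hF.inner_legendre hz0]
  rfl

/-- The basis dual to a `G`-orthonormal frame together with `z` is its image under the derivative
of the Legendre map. -/
theorem IsEllipticNorm.eq_sum_legendre_of_orthonormal (hF : IsEllipticNorm j F) {z : Euc (n + 1)}
    (hz : z ∈ wulff F) {e : Fin n → Euc (n + 1)}
    (he : ∀ i j, G F z (e i) (e j) = if i = j then 1 else 0) (hze : ∀ i, G F z z (e i) = 0)
    (ζ : Euc (n + 1)) : ζ = inner ℝ ζ z • gradient (halfSq F) z
      + ∑ k, inner ℝ ζ (e k) • fderiv ℝ (gradient (halfSq F)) z (e k) := by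
  have hz0 := hF.ne_zero_of_mem_wulff hz
  refine ext_inner_right ℝ fun v => ?_
  rw [inner_add_left, sum_inner, inner_smul_left, hF.inner_legendre hz0]
  conv_lhs => rw [hF.eq_sum_of_orthonormal hz he hze v]
  simp only [inner_add_right, inner_sum, inner_smul_right, inner_smul_left,
    hF.inner_fderiv_legendre hz0]
  congr 1
  · simp [mul_comm]
  · exact Finset.sum_congr rfl fun k _ => by simp [mul_comm]

/-- The Hessians of a norm and of its dual, restricted to tangent spaces, are inverse matrices with
respect to the metric `G`. -/
theorem hessian_mul_hessian_dualNorm (hF : IsEllipticNorm 2 F) (hρ : IsEllipticNorm j ρ)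
    {z : Euc (n + 1)} (hz : z ∈ wulff F) {e : Fin n → Euc (n + 1)}
    (he : ∀ i j, G F z (e i) (e j) = if i = j then 1 else 0) (hze : ∀ i, G F z z (e i) = 0) :
    (Matrix.of fun p q => (dualNorm ρ (gradient (halfSq F) z) •
        fderiv ℝ (fderiv ℝ ρ) (gradient (dualNorm ρ) (gradient (halfSq F) z))) (e p) (e q)) *
      (Matrix.of fun p q => fderiv ℝ (fderiv ℝ (dualNorm ρ)) (gradient (halfSq F) z)
        (fderiv ℝ (gradient (halfSq F)) z (e p)) (fderiv ℝ (gradient (halfSq F)) z (e q))) = 1 := by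
  have hz0 := hF.ne_zero_of_mem_wulff hz
  have hξ := hF.legendre_ne_zero hz0
  have hx0 := hρ.ne_zero_of_mem_wulff (hρ.gradient_dualNorm_mem_wulff hξ)
  ext i l
  -- `ζ` represents the `i`-th row of the first matrix. Expand it in the basis `ℓ(z)`, `Dℓ(e_k)` and
  -- apply `D²ρ⁰`, which kills `ℓ(z)`: pairing with `Dℓ(e_l)` gives the entry of the product, and it
  -- equals `⟨e_i, Dℓ(e_l)⟩`.
  obtain ⟨ζ, h1, h2⟩ : ∃ ζ : Euc (n + 1),
      (∀ η, fderiv ℝ (fderiv ℝ (dualNorm ρ)) (gradient (halfSq F) z) ζ η = inner ℝ (e i) η) ∧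
      ∀ v, inner ℝ ζ v = (dualNorm ρ (gradient (halfSq F) z) •
        fderiv ℝ (fderiv ℝ ρ) (gradient (dualNorm ρ) (gradient (halfSq F) z))) (e i) v := by
    refine ⟨_, hρ.fderiv_fderiv_dualNorm_apply hξ
      (by rw [fderiv_comm_dual hF hρ hz, hze, mul_zero]), fun v => ?_⟩
    rw [inner_smul_left, inner_fderiv_gradient (hρ.differentiableAt_fderiv hx0)]
    simp
  have h3 := hF.eq_sum_legendre_of_orthonormal hz he hze ζ
  have h4 : fderiv ℝ (fderiv ℝ (dualNorm ρ)) (gradient (halfSq F) z)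
      (gradient (halfSq F) z) = 0 :=
    hρ.dual.posHomogeneous.fderiv_fderiv_self (hρ.dual.differentiableAt_fderiv hξ)
  have h5 := h1 (fderiv ℝ (gradient (halfSq F)) z (e l))
  rw [h3, map_add, map_smul, h4, smul_zero, zero_add, map_sum, sum_apply, real_inner_comm,
    hF.inner_fderiv_legendre hz0, hF.G_symm hz0, he] at h5
  rw [Matrix.mul_apply, Matrix.one_apply, ← h5]
  simp [h2]

theorem posDef_metric (hF : IsEllipticNorm 2 F) {M : Set (Euc (n + 1))} {k : WithTop ℕ∞}
    {U : Set (Euc n)} {X : Euc n → Euc (n + 1)} (hX : IsLocalParam k M U X) {w : Euc n}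
    (hw : w ∈ U) (h0 : gaussMap F M (X w) ≠ 0) : (metric F M X w).PosDef := by
  refine posDef_of_bilinear (fderiv ℝ (fderiv ℝ (halfSq F)) (gaussMap F M (X w))) _
    (fun p q => hF.G_symm h0 _ _) fun b hb => ?_
  have h3 : ∑ i, b i • pd i X w = fderiv ℝ X w (WithLp.toLp 2 b) :=
    (fderiv_eq_sum_pd X w _).symm
  rw [h3]
  refine hF.elliptic _ h0 _ fun h => hb ?_
  have h4 := hX.injective_fderiv w hw (h.trans (map_zero _).symm)
  funext i
  exact congrArg (fun v : Euc n => v i) h4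

theorem principalRadii_eq (hF : IsEllipticNorm 2 F) (hρ : IsEllipticNorm j ρ)
    (c : Euc (n + 1)) (hZ : IsLocalParam ∞ (wulff F) V Z) {u : Euc n} (hu : u ∈ V)
    {a : Fin n → Euc n} (ha : IsOrthonormalFrame F Z u a) {U : Set (Euc n)}
    {X : Euc n → Euc (n + 1)} (hX : IsLocalParam 2 {y | y - c ∈ wulff ρ} U X) {w : Euc n}
    (hw : w ∈ U) (hXw : X w = inverseGaussMap F {y | y - c ∈ wulff ρ} (Z u)) :
    (supportMatrix F (supportFunction F {y | y - c ∈ wulff ρ}) Z u a).charpoly.roots =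
        principalRadii F {y | y - c ∈ wulff ρ} X w ∧
      (supportMatrix F (supportFunction F {y | y - c ∈ wulff ρ}) Z u a).det =
        1 / gaussKronecker F {y | y - c ∈ wulff ρ} X w := by
  have hAdef := supportMatrix_eq hF hρ c hZ hu ha
  have hApos := posDef_supportMatrix hF hρ c hZ hu ha
  set A := supportMatrix F (supportFunction F {y | y - c ∈ wulff ρ}) Z u a with hA
  have hzW := hZ.mem hu
  have hze : ∀ i, G F (Z u) (Z u) (fderiv ℝ Z u (a i)) = 0 := fun i =>
    hF.G_self_fderiv hZ (by simp) hu (a i)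
  have hexp := hF.eq_sum_of_orthonormal hzW ha hze
  rw [inverseGaussMap_eq hF hρ c hzW] at hXw
  set z := Z u with hz
  set e : Fin n → Euc (n + 1) := fun i => fderiv ℝ Z u (a i) with he
  have hz0 := hF.ne_zero_of_mem_wulff hzW
  set ξ := gradient (halfSq F) z with hξdef
  have hξ : ξ ≠ 0 := hF.legendre_ne_zero hz0
  have hXx : X w - c = gradient (dualNorm ρ) ξ := by rw [hXw, add_sub_cancel_left]
  set x := gradient (dualNorm ρ) ξ with hx
  have hx0 : x ≠ 0 := hρ.ne_zero_of_mem_wulff (hρ.gradient_dualNorm_mem_wulff hξ)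
  set σ := dualNorm ρ ξ with hσ
  have hσpos : 0 < σ := hρ.dual.pos ξ hξ
  have hgauss : gaussMap F {y | y - c ∈ wulff ρ} (X w) = z := by
    rw [hXw]
    exact gaussMap_right hF hρ c hzW
  have hdρ : ∀ v, fderiv ℝ ρ x v = σ⁻¹ * G F z z v := fderiv_comm_dual hF hρ hzW
  -- The rows of `B` are the coordinates of `∂_i X` in the frame `e`. There is no `z` component,
  -- because `M` at `X w` and the Wulff shape at `z` have parallel tangent spaces.
  set B : Matrix (Fin n) (Fin n) ℝ := Matrix.of fun i k => G F z (e k) (pd i X w) with hB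
  set H : Matrix (Fin n) (Fin n) ℝ := Matrix.of fun i k =>
    (σ • fderiv ℝ (fderiv ℝ ρ) x) (e i) (e k) with hH
  have hzX : ∀ i, G F z z (pd i X w) = 0 := fun i => by
    have h1 := hρ.fderiv_tangent hX hw (EuclideanSpace.single i 1)
    rw [hXx, hdρ] at h1
    exact (mul_eq_zero.1 h1).resolve_left (inv_pos.2 hσpos).ne'
  have hXe : ∀ i, pd i X w = ∑ k, B i k • e k := fun i => by
    have h1 := hexp (pd i X w)
    rwa [hzX, zero_smul, zero_add] at h1
  have hbil : ∀ (T : Euc (n + 1) →L[ℝ] Euc (n + 1) →L[ℝ] ℝ) (i l : Fin n),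
      T (pd i X w) (pd l X w) = (B * (Matrix.of fun p q => T (e p) (e q)) * B.transpose) i l :=
    fun T i l => bilinear_apply_eq_mul_mul_transpose T hXe i l
  have hP : metric F {y | y - c ∈ wulff ρ} X w = B * B.transpose := by
    have h1 : (Matrix.of fun p q => fderiv ℝ (fderiv ℝ (halfSq F)) z (e p) (e q)) = 1 := by
      ext p q
      rw [Matrix.one_apply]
      exact ha p q
    ext i l
    rw [metric, Matrix.of_apply, hgauss, G, hbil, h1, Matrix.mul_one]
  have hR : secondForm F {y | y - c ∈ wulff ρ} X w = B * H * B.transpose := by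
    ext i l
    refine Eq.trans ?_ (hbil (σ • fderiv ℝ (fderiv ℝ ρ) x) i l)
    rw [secondForm, Matrix.of_apply, hgauss]
    have h1 := hρ.fderiv_pd_pd hX hw i l
    rw [hXx, hdρ, inv_mul_eq_iff_eq_mul₀ hσpos.ne'] at h1
    rw [h1]
    simp
  have hHA : H * A = 1 := by
    rw [hAdef]
    exact hessian_mul_hessian_dualNorm hF hρ hzW ha hze
  have hBdet : IsUnit B.det := by
    have h2 := (posDef_metric hF hX hw (hgauss ▸ hz0)).det_pos
    rw [hP, Matrix.det_mul, Matrix.det_transpose] at h2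
    exact isUnit_iff_ne_zero.2 fun h => by simp [h] at h2
  exact roots_charpoly_and_det hApos.isHermitian hHA hP hR hBdet

end Radii

/-- Geometry of a strongly convex hypersurface in terms of its anisotropic support function. -/
theorem stronglyConvex_support {n : ℕ} {F : Euc (n + 1) → ℝ} (hF : IsMinkowskiNorm F)
    (M : Set (Euc (n + 1))) (hM : IsStronglyConvexHypersurface M) :
      Set.BijOn (gaussMap F M) M (wulff F) ∧
      IsC2OnWulff F (supportFunction F M) ∧
      ∀ (V : Set (Euc n)) (Z : Euc n → Euc (n + 1)), IsLocalParam ∞ (wulff F) V Z →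
        IsLocalParam 1 M V (fun u => inverseGaussMap F M (Z u)) ∧
        ∀ u ∈ V,
          supportFunction F M (Z u) = G F (Z u) (Z u) (inverseGaussMap F M (Z u)) ∧
          ∀ a : Fin n → Euc n, IsOrthonormalFrame F Z u a →
            (supportMatrix F (supportFunction F M) Z u a).PosDef ∧
            ∀ (U : Set (Euc n)) (X : Euc n → Euc (n + 1)), IsLocalParam 2 M U X →
              ∀ w ∈ U, X w = inverseGaussMap F M (Z u) →
                (supportMatrix F (supportFunction F M) Z u a).charpoly.roots =
                  principalRadii F M X w ∧
                (supportMatrix F (supportFunction F M) Z u a).det =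
                  1 / gaussKronecker F M X w := by
  have hF2 := hF.isEllipticNorm 2 (by norm_num)
  obtain ⟨c, ρ, hρ, rfl⟩ := exists_isEllipticNorm_of_isStronglyConvexHypersurface hM
  refine ⟨bijOn_gaussMap hF2 hρ c, fun V Z hZ => ?_, fun V Z hZ =>
    ⟨isLocalParam_inverseGaussMap hF2 hρ c hZ, fun u hu => ⟨?_, fun a ha =>
      ⟨posDef_supportMatrix hF2 hρ c hZ hu ha, fun U X hX w hw hXw =>
        principalRadii_eq hF2 hρ c hZ hu ha hX hw hXw⟩⟩⟩⟩
  · have h1 : ContDiffOn ℝ 2 (fun u => dualNorm ρ (gradient (halfSq F) (Z u))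
        + inner ℝ c (gradient (halfSq F) (Z u))) V := by
      intro u hu
      have hz0 := hF2.ne_zero_of_mem_wulff (hZ.mem hu)
      have h2 : ContDiffAt ℝ 2 (fun u => gradient (halfSq F) (Z u)) u :=
        (hF2.contDiffAt_legendre hz0).comp u ((hZ.contDiffAt hu).of_le ENat.LEInfty.out)
      exact (((contDiffOn_support hρ c).contDiffAt (isOpen_ne_zero.mem_nhds
        (hF2.legendre_ne_zero hz0))).comp u h2).contDiffWithinAt
    exact h1.congr fun u hu => supportFunction_eq hF2 hρ c (hZ.mem hu)
  · rw [supportFunction_eq hF2 hρ c (hZ.mem hu), inverseGaussMap_eq hF2 hρ c (hZ.mem hu),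
      G_gradient_dualNorm hF2 hρ c (hZ.mem hu)]

/-! ### Homogeneous functions with positive definite transversal Hessian -/

theorem exists_ne_smul {n : ℕ} (hn : 1 ≤ n) (ξ : Euc (n + 1)) : ∃ v : Euc (n + 1), ∀ t : ℝ,
    v ≠ t • ξ := by
  by_contra! h
  have h1 := finrank_le_one (R := ℝ) ξ fun w => (h w).imp fun t ht => ht.symm
  rw [finrank_euclideanSpace_fin] at h1
  omega

section Hessian

variable {m : ℕ} {h : Euc m → ℝ}

theorem PosHomogeneous.map_zero (hhom : PosHomogeneous h) : h 0 = 0 := by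
  have := hhom 2 two_pos 0
  rw [smul_zero] at this
  linarith

/-- A homogeneous function with positive transversal Hessian lies strictly above its tangent
hyperplanes, off their rays of contact. -/
theorem PosHomogeneous.fderiv_lt (hhom : PosHomogeneous h) (hh : ContDiffOn ℝ 2 h {ξ | ξ ≠ 0})
    (hpos : ∀ ξ : Euc m, ξ ≠ 0 → ∀ v : Euc m, (∀ t : ℝ, v ≠ t • ξ) →
      0 < fderiv ℝ (fderiv ℝ h) ξ v v)
    {ξ η : Euc m} (hη : ∀ t : ℝ, η ≠ t • ξ) (hξ : ξ ≠ 0) :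
    fderiv ℝ h ξ η < h η := by
  have hC : ∀ x : Euc m, x ≠ 0 → ContDiffAt ℝ 2 h x := fun x hx =>
    hh.contDiffAt (isOpen_ne_zero.mem_nhds hx)
  have hd : ∀ x : Euc m, x ≠ 0 → DifferentiableAt ℝ (fderiv ℝ h) x := fun x hx =>
    ((hC x hx).fderiv_right (m := 1) (by norm_num)).differentiableAt (by simp)
  have hlin : ∀ a b : ℝ, a • ξ + b • η = 0 → b = 0 := by
    intro a b hab
    by_contra hb
    refine hη (-(b⁻¹ * a)) ?_
    have h1 : b⁻¹ • (a • ξ + b • η) = 0 := by rw [hab, smul_zero]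
    rw [smul_add, smul_smul, smul_smul, inv_mul_cancel₀ hb, one_smul] at h1
    rw [neg_smul]
    exact eq_neg_of_add_eq_zero_right h1
  set γ : ℝ → Euc m := fun t => ξ + t • (η - ξ) with hγ
  have hγ0 : ∀ t, γ t ≠ 0 := by
    intro t ht
    have h1 : (1 - t) • ξ + t • η = 0 := by rw [← ht, hγ]; module
    have h2 := hlin _ _ h1
    rw [h2, zero_smul, add_zero, sub_zero, one_smul] at h1
    exact hξ h1
  have hder : ∀ t, HasDerivAt (fun t => fderiv ℝ h (γ t) η)
      ((1 - t) * fderiv ℝ (fderiv ℝ h) (γ t) (η - ξ) (η - ξ)) t := by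
    intro t
    have h1 : HasDerivAt γ (η - ξ) t := by
      have h0 := ((hasDerivAt_id t).smul_const (η - ξ)).const_add ξ
      rwa [one_smul] at h0
    have h2 := ((hd _ (hγ0 t)).hasFDerivAt.comp_hasDerivAt t h1).clm_apply
      (hasDerivAt_const t η)
    refine h2.congr_deriv ?_
    -- Euler's relation removes the `γ t` component of `η`, leaving `1 - t` times a Hessian on the
    -- diagonal.
    have h3 : η = γ t + (1 - t) • (η - ξ) := by rw [hγ]; module
    have h4 : fderiv ℝ (fderiv ℝ h) (γ t) (η - ξ) (γ t) = 0 := by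
      rw [isSymmSndFDerivAt_of_contDiffAt (hC _ (hγ0 t)),
        hhom.fderiv_fderiv_self (hd _ (hγ0 t))]
      rfl
    have h5 : fderiv ℝ (fderiv ℝ h) (γ t) (η - ξ) η =
        fderiv ℝ (fderiv ℝ h) (γ t) (η - ξ) (γ t)
          + (1 - t) * fderiv ℝ (fderiv ℝ h) (γ t) (η - ξ) (η - ξ) := by
      conv_lhs => rw [h3, map_add, map_smul, ← h3]
      rfl
    rw [_root_.map_zero, add_zero, h5, h4, zero_add]
  have hmono : StrictMonoOn (fun t => fderiv ℝ h (γ t) η) (Icc 0 1) := by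
    refine strictMonoOn_of_deriv_pos (convex_Icc 0 1)
      (fun t _ => (hder t).continuousAt.continuousWithinAt) fun t ht => ?_
    rw [interior_Icc] at ht
    rw [(hder t).deriv]
    refine mul_pos (sub_pos.2 ht.2) (hpos _ (hγ0 t) _ fun s hs => ?_)
    -- If `η - ξ` were `s • γ t`, comparing coefficients of `ξ` and `η` would give both `s t = 1`
    -- and `s = 0`.
    have h1 : (-1 - s * (1 - t)) • ξ + (1 - s * t) • η = 0 := by
      have : (-1 - s * (1 - t)) • ξ + (1 - s * t) • η = (η - ξ) - s • γ t := by
        rw [hγ]; module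
      rw [this, hs, sub_self]
    have h2 := hlin _ _ h1
    rw [h2, zero_smul, add_zero] at h1
    have h3 := (smul_eq_zero.1 h1).resolve_right hξ
    have h4 : s = 0 := by linear_combination -h3 - h2
    rw [h4, zero_mul, sub_zero] at h2
    exact one_ne_zero h2
  have h1 := hmono (left_mem_Icc.2 zero_le_one) (right_mem_Icc.2 zero_le_one) zero_lt_one
  have hη0 : η ≠ 0 := fun h0 => hη 0 (by rw [h0, zero_smul])
  simp only [hγ, zero_smul, add_zero, one_smul, add_sub_cancel] at h1
  rwa [hhom.fderiv_self ((hC η hη0).differentiableAt (by simp))] at h1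

/-- The remaining directions, those on the line through `ξ`, are limits of transversal ones, which
exist because `n ≥ 1`. The origin is treated apart, as `h` is only known to be continuous away from
it. -/
theorem PosHomogeneous.fderiv_le {n : ℕ} {h : Euc (n + 1) → ℝ} (hn : 1 ≤ n)
    (hhom : PosHomogeneous h) (hh : ContDiffOn ℝ 2 h {ξ | ξ ≠ 0})
    (hpos : ∀ ξ : Euc (n + 1), ξ ≠ 0 → ∀ v : Euc (n + 1), (∀ t : ℝ, v ≠ t • ξ) →
      0 < fderiv ℝ (fderiv ℝ h) ξ v v)
    {ξ : Euc (n + 1)} (hξ : ξ ≠ 0) (η : Euc (n + 1)) : fderiv ℝ h ξ η ≤ h η := by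
  by_cases hη : ∀ t : ℝ, η ≠ t • ξ
  · exact (hhom.fderiv_lt hh hpos hη hξ).le
  push Not at hη
  obtain ⟨t, rfl⟩ := hη
  rcases eq_or_ne t 0 with rfl | ht
  · simp [hhom.map_zero]
  obtain ⟨v, hv⟩ := exists_ne_smul hn ξ
  have hγ : Tendsto (fun s : ℝ => t • ξ + s • v) (𝓝[>] 0) (𝓝 (t • ξ)) := by
    have : Continuous fun s : ℝ => t • ξ + s • v := by fun_prop
    have h1 := (this.tendsto 0).mono_left (nhdsWithin_le_nhds (s := Ioi 0))
    simpa using h1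
  have h2 : ContinuousAt h (t • ξ) :=
    (hh.contDiffAt (isOpen_ne_zero.mem_nhds (smul_ne_zero ht hξ))).continuousAt
  refine le_of_tendsto_of_tendsto (((fderiv ℝ h ξ).continuous.tendsto _).comp hγ)
    (h2.tendsto.comp hγ) ?_
  filter_upwards [self_mem_nhdsWithin] with s hs
  refine (hhom.fderiv_lt hh hpos (fun r hr => hv (s⁻¹ * (r - t)) ?_) hξ).le
  have hs0 : s ≠ 0 := (mem_Ioi.1 hs).ne'
  have h3 : s • v = (r - t) • ξ := by
    rw [sub_smul, ← hr, add_sub_cancel_left]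
  rw [mul_smul, ← h3, smul_smul, inv_mul_cancel₀ hs0, one_smul]

theorem PosHomogeneous.isEllipticNorm {n : ℕ} {h : Euc (n + 1) → ℝ} (hn : 1 ≤ n)
    (hhom : PosHomogeneous h) (hh : ContDiffOn ℝ 2 h {ξ | ξ ≠ 0})
    (hpos : ∀ ξ : Euc (n + 1), ξ ≠ 0 → ∀ v : Euc (n + 1), (∀ t : ℝ, v ≠ t • ξ) →
      0 < fderiv ℝ (fderiv ℝ h) ξ v v)
    (h0 : ∀ ξ, ξ ≠ 0 → 0 < h ξ) : IsEllipticNorm 1 h := by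
  have hC2 : IsC2Norm h :=
    { map_smul := fun t ht x => by
        rcases ht.eq_or_lt with rfl | ht
        · simp [hhom.map_zero]
        · exact hhom t ht x
      pos := h0
      contDiffOn_two := hh
      fderiv_le := fun x hx y => hhom.fderiv_le hn hh hpos hx y }
  exact
    { toIsC2Norm := hC2
      one_le := le_rfl
      smooth := by simpa using hh
      elliptic := fun x hx ξ hξ => hC2.elliptic_of_fderiv_fderiv_pos hx (hpos x hx) hξ }

/-- A homogeneous function with positive transversal Hessian is positive up to a linear function. -/
theorem PosHomogeneous.exists_inner_lt {n : ℕ} {h : Euc (n + 1) → ℝ} (hn : 1 ≤ n)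
    (hhom : PosHomogeneous h) (hh : ContDiffOn ℝ 2 h {ξ | ξ ≠ 0})
    (hpos : ∀ ξ : Euc (n + 1), ξ ≠ 0 → ∀ v : Euc (n + 1), (∀ t : ℝ, v ≠ t • ξ) →
      0 < fderiv ℝ (fderiv ℝ h) ξ v v) :
    ∃ c : Euc (n + 1), ∀ ξ, ξ ≠ 0 → inner ℝ c ξ < h ξ := by
  obtain ⟨ξ₁, hξ₁⟩ := exists_ne (0 : Euc (n + 1))
  obtain ⟨ξ₂, h12⟩ := exists_ne_smul hn ξ₁
  have hξ₂ : ξ₂ ≠ 0 := fun h0 => h12 0 (by rw [h0, zero_smul])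
  -- The mean of the gradients at two independent points: no nonzero `ξ` lies on both lines, so at
  -- least one of the two tangent inequalities is strict.
  refine ⟨(1 / 2 : ℝ) • (gradient h ξ₁ + gradient h ξ₂), fun ξ hξ => ?_⟩
  rw [real_inner_smul_left, inner_add_left, inner_gradient_left, inner_gradient_left]
  have h1 := hhom.fderiv_le hn hh hpos hξ₁ ξ
  have h2 := hhom.fderiv_le hn hh hpos hξ₂ ξ
  by_cases hs : ∀ t : ℝ, ξ ≠ t • ξ₁
  · have h3 := hhom.fderiv_lt hh hpos hs hξ₁
    linarith
  push Not at hs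
  obtain ⟨t, ht⟩ := hs
  have h3 := hhom.fderiv_lt hh hpos (ξ := ξ₂) (η := ξ) (fun s hs => ?_) hξ₂
  · linarith
  have hs0 : s ≠ 0 := fun h0 => hξ (by rw [hs, h0, zero_smul])
  refine h12 (s⁻¹ * t) ?_
  rw [mul_smul, ← ht, hs, smul_smul, inv_mul_cancel₀ hs0, one_smul]

end Hessian

/-! ### The hypersurface with a given support function -/

section Existence

variable {n : ℕ} {F S : Euc (n + 1) → ℝ}

/-- `S` is C² only through charts, so near `ξ` the factor `S(DF⁰)` is written as `(S ∘ Z) ∘ π ∘ DF⁰`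
with a radial chart `Z` around `DF⁰(ξ)`. -/
theorem contDiffOn_extension (hF : IsMinkowskiNorm F) (hS : IsC2OnWulff F S) :
    ContDiffOn ℝ 2 (fun ξ => dualNorm F ξ * S (gradient (dualNorm F) ξ)) {ξ | ξ ≠ 0} := by
  have hF2 := hF.isEllipticNorm 2 one_le_two
  intro ξ hξ
  have hz := hF2.gradient_dualNorm_mem_wulff hξ
  have hz0 := hF2.ne_zero_of_mem_wulff hz
  obtain ⟨Z, π, hZ, hπ, hZπ⟩ := exists_radialParam (by simp) hF2.posHomogeneous hF.pos
    hF.smooth hz0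
  have hg : ContDiffAt ℝ 2 (gradient (dualNorm F)) ξ :=
    contDiffAt_gradient (hF2.dual.contDiffAt hξ) (by norm_num)
  have ho : IsOpen {x : Euc (n + 1) | 0 < inner ℝ (gradient (dualNorm F) ξ) x} :=
    isOpen_lt continuous_const (by fun_prop)
  have hzo : gradient (dualNorm F) ξ ∈
      {x : Euc (n + 1) | 0 < inner ℝ (gradient (dualNorm F) ξ) x} := by
    rw [mem_ofPred_eq, real_inner_self_eq_norm_sq]
    positivity
  have h1 : ContDiffAt ℝ 2 (fun u => S (Z u)) (π (gradient (dualNorm F) ξ)) :=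
    (hS univ Z hZ).contDiffAt univ_mem
  have h2 : ContDiffAt ℝ 2 π (gradient (dualNorm F) ξ) :=
    (hπ.contDiffAt (ho.mem_nhds hzo)).of_le ENat.LEInfty.out
  have h3 : ContDiffAt ℝ 2 (fun η => dualNorm F η * S (Z (π (gradient (dualNorm F) η)))) ξ :=
    (hF2.dual.contDiffAt_two hξ).mul (h1.comp (f := fun η => π (gradient (dualNorm F) η)) ξ (h2.comp ξ hg))
  refine (h3.congr_of_eventuallyEq ?_).contDiffWithinAt
  filter_upwards [isOpen_ne_zero.mem_nhds hξ, hg.continuousAt (ho.mem_nhds hzo)] with η hη hη'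
  rw [hZπ _ hη', show F (gradient (dualNorm F) η) = 1 from hF2.gradient_dualNorm_mem_wulff hη,
    inv_one, one_smul]

theorem posHomogeneous_extension (hF : IsEllipticNorm 2 F) :
    PosHomogeneous (fun ξ => dualNorm F ξ * S (gradient (dualNorm F) ξ)) := fun t ht ξ => by
  simp only [hF.dual.posHomogeneous t ht ξ, hF.dual.posHomogeneous.gradient_smul ht]
  ring

theorem extension_legendre (hF : IsEllipticNorm 2 F) {z : Euc (n + 1)} (hz : z ∈ wulff F) :
    S z = dualNorm F (gradient (halfSq F) z) *
      S (gradient (dualNorm F) (gradient (halfSq F) z)) := by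
  rw [hF.gradient_dualNorm_legendre_wulff hz, hF.dualNorm_legendre (hF.ne_zero_of_mem_wulff hz),
    show F z = 1 from hz, one_mul]

theorem exists_isOrthonormalFrame (hF : IsEllipticNorm 2 F) {V : Set (Euc n)}
    {Z : Euc n → Euc (n + 1)} {k : WithTop ℕ∞} (hZ : IsLocalParam k (wulff F) V Z) {u : Euc n}
    (hu : u ∈ V) : ∃ a, IsOrthonormalFrame F Z u a := by
  have hz0 := hF.ne_zero_of_mem_wulff (hZ.mem hu)
  have hP : (wulffMetric F Z u).PosDef := by
    refine posDef_of_bilinear (fderiv ℝ (fderiv ℝ (halfSq F)) (Z u)) (fun i => pd i Z u)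
      (fun i j => hF.G_symm hz0 _ _) fun b hb => hF.elliptic _ hz0 _ fun h0 => hb ?_
    have h1 : fderiv ℝ Z u (WithLp.toLp 2 b) = 0 := by
      rw [fderiv_eq_sum_pd, ← h0]
    have h2 := (injective_iff_map_eq_zero _).1 (hZ.injective_fderiv u hu) _ h1
    funext i
    exact congrArg (fun v : Euc n => v i) h2
  obtain ⟨A, hA⟩ := exists_transpose_mul_mul_eq_one hP
  refine ⟨fun i => WithLp.toLp 2 fun r => A r i, fun i j => ?_⟩
  have h1 := congrFun (congrFun hA i) j
  rw [Matrix.one_apply] at h1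
  rw [← h1, G, bilinear_fderiv_eq_sum, Matrix.mul_assoc, Matrix.mul_apply]
  refine Finset.sum_congr rfl fun r _ => ?_
  rw [Matrix.mul_apply, Finset.mul_sum]
  refine Finset.sum_congr rfl fun s _ => ?_
  simp only [Matrix.transpose_apply, wulffMetric, Matrix.of_apply, G]
  ring

theorem fderiv_fderiv_extension_pos (hF : IsMinkowskiNorm F) (hS : IsC2OnWulff F S)
    (hA : ∀ (V : Set (Euc n)) (Z : Euc n → Euc (n + 1)), IsLocalParam ∞ (wulff F) V Z →
      ∀ u ∈ V, ∀ a : Fin n → Euc n, IsOrthonormalFrame F Z u a → (supportMatrix F S Z u a).PosDef)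
    {ξ : Euc (n + 1)} (hξ : ξ ≠ 0) {v : Euc (n + 1)} (hv : ∀ t : ℝ, v ≠ t • ξ) :
    0 < fderiv ℝ (fderiv ℝ fun ξ => dualNorm F ξ * S (gradient (dualNorm F) ξ)) ξ v v := by
  have hF2 := hF.isEllipticNorm 2 one_le_two
  have hh := contDiffOn_extension hF hS
  have hhom := posHomogeneous_extension (S := S) hF2
  have hL : ∀ z ∈ wulff F, S z =
      (fun ξ => dualNorm F ξ * S (gradient (dualNorm F) ξ)) (gradient (halfSq F) z) :=
    fun z hz => extension_legendre hF2 hz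
  -- From here on only the homogeneity of `h`, its regularity and `S = h ∘ ℓ` matter.
  generalize (fun ξ => dualNorm F ξ * S (gradient (dualNorm F) ξ)) = h at hh hhom hL ⊢
  obtain ⟨z, hz, t, ht, rfl⟩ : ∃ z ∈ wulff F, ∃ t : ℝ, 0 < t ∧ t • gradient (halfSq F) z = ξ := by
    have hz := hF2.gradient_dualNorm_mem_wulff hξ
    refine ⟨_, hz, dualNorm F ξ, hF2.dual.pos ξ hξ, ?_⟩
    rw [hF2.legendre_eq_gradient hz, hF2.gradient_gradient_dualNorm hξ, smul_smul,
      mul_inv_cancel₀ (hF2.dual.pos ξ hξ).ne', one_smul]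
  have hz0 := hF2.ne_zero_of_mem_wulff hz
  obtain ⟨Z, π, hZ, -, hZπ⟩ := exists_radialParam (by simp) hF2.posHomogeneous hF.pos
    hF.smooth hz0
  have hu : Z (π z) = z := by
    rw [hZπ z (by rw [real_inner_self_eq_norm_sq]; positivity), show F z = 1 from hz, inv_one,
      one_smul]
  obtain ⟨a, ha⟩ := exists_isOrthonormalFrame hF2 hZ (mem_univ (π z))
  have hPD := hA univ Z hZ _ (mem_univ (π z)) a ha
  have hmat := hF2.supportMatrix_apply hh hhom hL hZ ENat.LEInfty.out (mem_univ (π z)) ha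
  have hze := fun i => hF2.G_self_fderiv hZ (by simp) (mem_univ (π z)) (a i)
  rw [IsOrthonormalFrame] at ha
  rw [hu] at ha hmat hze
  have hC := hh.contDiffAt (isOpen_ne_zero.mem_nhds (hF2.legendre_ne_zero hz0))
  have hLd : fderiv ℝ (fderiv ℝ h) (gradient (halfSq F) z) (gradient (halfSq F) z) = 0 :=
    hhom.fderiv_fderiv_self
      ((hC.fderiv_right (m := 1) (by norm_num)).differentiableAt (by simp))
  have hLd' : ∀ w, fderiv ℝ (fderiv ℝ h) (gradient (halfSq F) z) w (gradient (halfSq F) z) = 0 :=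
    fun w => by
      rw [isSymmSndFDerivAt_of_contDiffAt hC, hLd]
      rfl
  -- Modulo the radial direction, `v` has coordinates `b` in the basis `Dℓ(e_k)`, so its Hessian
  -- value is the quadratic form of `A_S` at `b`; `b ≠ 0` since `v` is not radial.
  have hexp := hF2.eq_sum_legendre_of_orthonormal hz ha hze v
  generalize hbdef : (fun k => inner ℝ v (fderiv ℝ Z (π z) (a k))) = b at hexp
  simp only [fun k => congrFun hbdef k] at hexp
  have hb : b ≠ 0 := by
    rintro rfl
    refine hv (inner ℝ v z * t⁻¹) ?_
    rw [smul_smul, mul_assoc, inv_mul_cancel₀ ht.ne', mul_one]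
    simpa using hexp
  rw [hhom.fderiv_fderiv_smul ht, smul_apply, smul_apply, smul_eq_mul]
  refine mul_pos (inv_pos.2 ht) ((hPD.dotProduct_mulVec_pos hb).trans_eq ?_)
  generalize inner ℝ v z = r at hexp
  rw [hexp, map_add, map_smul, hLd', smul_zero, zero_add, map_add, map_smul, hLd, smul_zero,
    zero_add]
  simp only [map_smul, map_sum, smul_apply, sum_apply, smul_eq_mul, dotProduct, Matrix.mulVec,
    hmat, Pi.star_apply, star_trivial, Finset.mul_sum]
  rw [Finset.sum_comm]
  exact Finset.sum_congr rfl fun p _ => Finset.sum_congr rfl fun q _ => by ring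

/-- Subtracting `⟨c, ·⟩` from the extension makes it an elliptic norm; translating the unit sphere
of its dual by `c` adds the same linear term back to the support function. -/
theorem exists_isStronglyConvexHypersurface (hn : 1 ≤ n) (hF : IsMinkowskiNorm F)
    (hS : IsC2OnWulff F S)
    (hA : ∀ (V : Set (Euc n)) (Z : Euc n → Euc (n + 1)), IsLocalParam ∞ (wulff F) V Z →
      ∀ u ∈ V, ∀ a : Fin n → Euc n, IsOrthonormalFrame F Z u a →
        (supportMatrix F S Z u a).PosDef) :
    ∃ M : Set (Euc (n + 1)), IsStronglyConvexHypersurface M ∧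
      ∀ z ∈ wulff F, supportFunction F M z = S z := by
  have hF2 := hF.isEllipticNorm 2 one_le_two
  have hh := contDiffOn_extension hF hS
  have hhom := posHomogeneous_extension (S := S) hF2
  have hpos := fun ξ (hξ : ξ ≠ 0) v => fderiv_fderiv_extension_pos hF hS hA hξ (v := v)
  have hL : ∀ z ∈ wulff F, S z =
      (fun ξ => dualNorm F ξ * S (gradient (dualNorm F) ξ)) (gradient (halfSq F) z) :=
    fun z hz => extension_legendre hF2 hz
  generalize (fun ξ => dualNorm F ξ * S (gradient (dualNorm F) ξ)) = h at hh hhom hpos hL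
  obtain ⟨c, hc⟩ := hhom.exists_inner_lt hn hh hpos
  have hell : IsEllipticNorm 1 fun ξ => h ξ + inner ℝ (-c) ξ := by
    refine PosHomogeneous.isEllipticNorm hn (fun t ht ξ => ?_)
      (hh.add (innerSL ℝ (-c)).contDiff.contDiffOn) (fun ξ hξ v hv => ?_) fun ξ hξ => ?_
    · rw [hhom t ht, inner_smul_right]
      ring
    · rw [fderiv_fderiv_add_inner hh (-c) hξ]
      exact hpos ξ hξ v hv
    · rw [inner_neg_left]
      linarith [hc ξ hξ]
  refine ⟨_, hell.dual.isStronglyConvexHypersurface c, fun z hz => ?_⟩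
  rw [supportFunction_eq hF2 hell.dual c hz, hell.dualNorm_dualNorm, hL z hz]
  simp only [inner_neg_left, neg_add_cancel_right]

end Existence

end AnisoMinkowski

end

theorem mainTheorem10 (n : ℕ) (hn : 1 ≤ n) (F : Euc (n + 1) → ℝ) (hF : IsMinkowskiNorm F) :
    (∀ M : Set (Euc (n + 1)), IsStronglyConvexHypersurface M →
      Set.BijOn (gaussMap F M) M (wulff F) ∧
      IsC2OnWulff F (supportFunction F M) ∧
      ∀ (V : Set (Euc n)) (Z : Euc n → Euc (n + 1)), IsLocalParam ∞ (wulff F) V Z →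
        IsLocalParam 1 M V (fun u => inverseGaussMap F M (Z u)) ∧
        ∀ u ∈ V,
          supportFunction F M (Z u) = G F (Z u) (Z u) (inverseGaussMap F M (Z u)) ∧
          ∀ a : Fin n → Euc n, IsOrthonormalFrame F Z u a →
            (supportMatrix F (supportFunction F M) Z u a).PosDef ∧
            ∀ (U : Set (Euc n)) (X : Euc n → Euc (n + 1)), IsLocalParam 2 M U X →
              ∀ w ∈ U, X w = inverseGaussMap F M (Z u) →
                (supportMatrix F (supportFunction F M) Z u a).charpoly.roots =
                  principalRadii F M X w ∧
                (supportMatrix F (supportFunction F M) Z u a).det =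
                  1 / gaussKronecker F M X w) ∧
    (∀ S : Euc (n + 1) → ℝ, IsC2OnWulff F S →
      (∀ (V : Set (Euc n)) (Z : Euc n → Euc (n + 1)), IsLocalParam ∞ (wulff F) V Z →
        ∀ u ∈ V, ∀ a : Fin n → Euc n, IsOrthonormalFrame F Z u a →
          (supportMatrix F S Z u a).PosDef) →
      ∃ M : Set (Euc (n + 1)), IsStronglyConvexHypersurface M ∧
        ∀ z ∈ wulff F, supportFunction F M z = S z) :=
  ⟨stronglyConvex_support hF, fun _ hS hA => exists_isStronglyConvexHypersurface hn hF hS hA⟩
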